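/- Let $d\ge 2$ and let $\theta$ be a real skew-symmetric $d\times d$ matrix. Let $\mathbb T^d_\theta$ be the quantum $d$-torus: the von Neumann algebra generated, in the GNS representation of its canonical trace $\tau$, by unitaries $U_1,\dots,U_d$ with $U_kU_j=e^{2\pi i\theta_{kj}}U_jU_k$, where $\tau\big(\sum_m\alpha_mU^m\big)=\alpha_0$ and $U^m=U_1^{m_1}\cdots U_d^{m_d}$ for $m\in\mathbb Z^d$. For $1\le p<\infty$ let $L_p(\mathbb T^d_\theta)$ be the completion of $\mathbb T^d_\theta$ for the norm $\|x\|_p=\tau(|x|^p)^{1/p}$, and let $L_\infty(\mathbb T^d_\theta)=\mathbb T^d_\theta$ with the operator norm. Let $\mathcal S(\mathbb T^d_\theta)$ be the space of all $\sum_m a_mU^m$ with rapidly decreasing $(a_m)$, with the topology given by the norms $\max_{|m|_1\le k}\|D^mx\|_\infty$, $k\ge 0$, where $D^m=\partial_1^{m_1}\cdots\partial_d^{m_d}$ for $m\in\mathbb N_0^d$, $|m|_1=m_1+\cdots+m_d$, and $\partial_jU^n=2\pi i\,n_jU^n$. Let $\mathcal S'(\mathbb T^d_\theta)$ be its dual,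 the space of distributions, into which each $L_p(\mathbb T^d_\theta)$ is embedded by $y\mapsto\big(x\mapsto\tau(yx)\big)$; $D^m$ acts on distributions by duality. For $k\ge1$ and $1\le p\le\infty$ let $$W^k_p(\mathbb T^d_\theta)=\big\{x\in\mathcal S'(\mathbb T^d_\theta): D^mx\in L_p(\mathbb T^d_\theta)\text{ whenever }|m|_1\le k\big\},\qquad |x|_{W^k_p}=\Big(\sum_{|m|_1=k}\|D^mx\|_p^p\Big)^{1/p},$$ with a maximum in place of the sum if $p=\infty$. For $u\in\mathbb R^d$ let $\Delta_u$ be the difference operator, i.e. the Fourier multiplier $\Delta_u U^n=(e^{2\pi i u\cdot n}-1)U^n$, and let $$\omega^k_p(x,\varepsilon)=\sup_{0<|u|\le\varepsilon}\|\Delta_u^kx\|_p ,\qquad \varepsilon>0,$$ where $|u|$ is the Euclidean norm. **Theorem.** Let $d\ge2$ and $k\ge 1$. (i) There are constants $c,C>0$ depending only on $d$ and $k$ such that for all real skew-symmetric $\theta$, all $1\le p\le\infty$ and all $x\in W^k_p(\mathbb T^d_\theta)$, $$c\,|x|_{W^k_p}\ \le\ \sup_{\varepsilon>0}\frac{\omega^k_p(x,\varepsilon)}{\varepsilon^k}\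 \le\ C\,|x|_{W^k_p}.$$ (ii) For every real skew-symmetric $\theta$, the space $W^k_\infty(\mathbb T^d_\theta)$ is the quantum Lipschitz class of order $k$, that is, a distribution $x$ belongs to $W^k_\infty(\mathbb T^d_\theta)$ if and only if $x\in L_\infty(\mathbb T^d_\theta)$ and $\sup_{\varepsilon>0}\omega^k_\infty(x,\varepsilon)/\varepsilon^k<\infty$. (The case $k=1$ is Weaver's result.) -/

import Mathlib

open scoped ENNReal NNReal Topology
open Filter

noncomputable section

namespace QuantumTorus

/-! ### The Hilbert space `ℓ²(ℤ^d)` and the canonical unitaries -/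

/-- The Hilbert space `ℓ²(ℤ^d)`: the GNS space of the trace `τ`, the basis vector `δ_m`
corresponding to the monomial `U^m`. -/
abbrev HSpace (d : ℕ) : Type := lp (fun _ : Fin d → ℤ => ℂ) 2

/-- The basis vector `δ_m`. -/
def basisVec {d : ℕ} (m : Fin d → ℤ) : HSpace d := lp.single 2 m (1 : ℂ)

theorem memLp_weightedPerm {ι : Type*} (σ : Equiv.Perm ι) (c : ι → Circle)
    (f : lp (fun _ : ι => ℂ) 2) :
    Memℓp (fun n => (c n : ℂ) * f (σ n)) 2 := by
  have hf := lp.memℓp f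
  rw [memℓp_gen_iff (by norm_num)] at hf ⊢
  have h := (σ.summable_iff).mpr hf
  simpa [Function.comp_def, norm_mul, Circle.norm_coe] using h

/-- The unitary operator `(f(n))_n ↦ (c(n) f(σ n))_n` of `ℓ²`, for a permutation `σ` and
numbers `c(n)` of modulus one. -/
def weightedPerm {ι : Type*} (σ : Equiv.Perm ι) (c : ι → Circle) :
    lp (fun _ : ι => ℂ) 2 ≃ₗᵢ[ℂ] lp (fun _ : ι => ℂ) 2 where
  toFun f := ⟨fun n => (c n : ℂ) * f (σ n), memLp_weightedPerm σ c f⟩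
  invFun f := ⟨fun n => (((c (σ.symm n))⁻¹ : Circle) : ℂ) * f (σ.symm n),
    memLp_weightedPerm σ.symm (fun n => (c (σ.symm n))⁻¹) f⟩
  map_add' f g := by
    ext n
    exact mul_add _ _ _
  map_smul' a f := by
    ext n
    exact mul_left_comm _ _ _
  left_inv f := by
    ext n
    simp
  right_inv f := by
    ext n
    simp
  norm_map' f := by
    rw [lp.norm_eq_tsum_rpow (by norm_num), lp.norm_eq_tsum_rpow (by norm_num)]
    congr 1
    rw [← σ.tsum_eq (fun n => ‖f n‖ ^ (2 : ℝ≥0∞).toReal)]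
    simp [Circle.norm_coe]

theorem weightedPerm_apply {ι : Type*} (σ : Equiv.Perm ι) (c : ι → Circle)
    (f : lp (fun _ : ι => ℂ) 2) (n : ι) : weightedPerm σ c f n = (c n : ℂ) * f (σ n) := rfl

/-- The phase `exp(2πi ∑_{l<j} θ_{jl} n_l)`, produced by moving `U_j` to its place in
`U_j U_1^{n_1} ⋯ U_d^{n_d}`. -/
def phase {d : ℕ} (θ : Matrix (Fin d) (Fin d) ℝ) (j : Fin d) (n : Fin d → ℤ) : Circle :=
  Circle.exp (2 * Real.pi * ∑ l ∈ Finset.univ.filter (fun l => l < j), θ j l * n l)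

/-- The unitary `U_j`, acting by left multiplication on the basis of monomials:
`U_j δ_n = exp(2πi ∑_{l<j} θ_{jl} n_l) δ_{n+e_j}`. -/
def gen {d : ℕ} (θ : Matrix (Fin d) (Fin d) ℝ) (j : Fin d) : HSpace d ≃ₗᵢ[ℂ] HSpace d :=
  weightedPerm (Equiv.subRight (Pi.single j 1)) (phase θ j)

theorem phase_add_single {d : ℕ} (θ : Matrix (Fin d) (Fin d) ℝ) (j : Fin d) (n : Fin d → ℤ)
    (k : ℤ) : phase θ j (n + Pi.single j k) = phase θ j n := by
  unfold phase
  congr 2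
  apply Finset.sum_congr rfl
  intro l hl
  have : l ≠ j := (Finset.mem_filter.mp hl).2.ne
  simp [this]

theorem gen_basisVec {d : ℕ} (θ : Matrix (Fin d) (Fin d) ℝ) (j : Fin d) (n : Fin d → ℤ) :
    gen θ j (basisVec n) = (phase θ j n : ℂ) • basisVec (n + Pi.single j 1) := by
  ext i
  rw [gen, weightedPerm_apply]
  simp only [basisVec, lp.coeFn_smul, Pi.smul_apply, lp.coeFn_single, Equiv.subRight_apply,
    smul_eq_mul]
  by_cases h : i = n + Pi.single j 1
  · subst h
    rw [phase_add_single]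
    simp
  · have h' : i - Pi.single j 1 ≠ n := fun e => h (by rw [← e]; simp)
    rw [Pi.single_eq_of_ne h', Pi.single_eq_of_ne h]
    simp

/-- The commutation relations `U_k U_j = exp(2πi θ_{kj}) U_j U_k`. -/
theorem gen_commutation {d : ℕ} (θ : Matrix (Fin d) (Fin d) ℝ) (hθ : θ.transpose = -θ)
    (k j : Fin d) (f : HSpace d) :
    gen θ k (gen θ j f) = (Circle.exp (2 * Real.pi * θ k j) : ℂ) • gen θ j (gen θ k f) := by
  have hs : ∀ a b, θ a b = - θ b a := fun a b => by
    have := congrFun (congrFun hθ b) a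
    simpa using this
  have h0 : ∀ a, θ a a = 0 := fun a => by linarith [hs a a]
  have key : ∀ (a b : Fin d) (n : Fin d → ℤ), phase θ a (n - Pi.single b 1)
      = (if b < a then Circle.exp (-(2 * Real.pi * θ a b)) else 1) * phase θ a n := by
    intro a b n
    unfold phase
    by_cases h : b < a
    · rw [if_pos h, ← Circle.exp_add]
      congr 1
      have : ∑ l ∈ Finset.univ.filter (fun l => l < a), θ a l * ((n - Pi.single b 1 : Fin d → ℤ) l)
          = ∑ l ∈ Finset.univ.filter (fun l => l < a), θ a l * n l - θ a b := by
        simp only [Pi.sub_apply, Int.cast_sub, mul_sub, Finset.sum_sub_distrib]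
        congr 1
        rw [Finset.sum_eq_single b]
        · simp
        · intro l _ hl
          simp [hl]
        · intro hb
          simp [h] at hb
      rw [this]
      ring
    · rw [if_neg h, one_mul]
      congr 2
      apply Finset.sum_congr rfl
      intro l hl
      have : l ≠ b := fun e => h (e ▸ (Finset.mem_filter.mp hl).2)
      simp [this]
  ext n
  simp only [gen, weightedPerm_apply, lp.coeFn_smul, Pi.smul_apply, Equiv.subRight_apply,
    smul_eq_mul, key, sub_right_comm n (Pi.single j 1) (Pi.single k 1)]
  rcases lt_trichotomy k j with h | h | h
  · rw [if_pos h, if_neg h.not_gt, hs j k, show -(2 * Real.pi * -θ k j) = 2 * Real.pi * θ k j by ring]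
    push_cast
    ring
  · subst h
    simp [h0]
  · rw [if_neg h.not_gt, if_pos h]
    have e : (Circle.exp (2 * Real.pi * θ k j) : ℂ) * (Circle.exp (-(2 * Real.pi * θ k j)) : Circle)
        = 1 := by
      rw [← Circle.coe_mul, ← Circle.exp_add]
      simp
    rw [one_mul, Circle.coe_mul]
    linear_combination (-(phase θ k n : ℂ) * (phase θ j n : ℂ) *
      f (n - Pi.single k 1 - Pi.single j 1)) * e

/-- The monomial `U^m = U_1^{m_1} ⋯ U_d^{m_d}`, for `m ∈ ℤ^d` (an ordered product in the
group of unitaries of `ℓ²(ℤ^d)`). -/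
def monomialUnitary {d : ℕ} (θ : Matrix (Fin d) (Fin d) ℝ) (m : Fin d → ℤ) :
    HSpace d ≃ₗᵢ[ℂ] HSpace d :=
  ((List.finRange d).map fun j => gen θ j ^ m j).prod

/-- The monomial `U^m` as a bounded operator. -/
def monomial {d : ℕ} (θ : Matrix (Fin d) (Fin d) ℝ) (m : Fin d → ℤ) :
    HSpace d →L[ℂ] HSpace d :=
  ((monomialUnitary θ m).toContinuousLinearEquiv : HSpace d →L[ℂ] HSpace d)

theorem mul_apply_equiv {d : ℕ} (e f : HSpace d ≃ₗᵢ[ℂ] HSpace d) (x : HSpace d) :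
    (e * f) x = e (f x) := rfl

theorem gen_zpow_basisVec {d : ℕ} (θ : Matrix (Fin d) (Fin d) ℝ) (j : Fin d) (n : Fin d → ℤ)
    (hn : phase θ j n = 1) (k : ℤ) :
    (gen θ j ^ k) (basisVec n) = basisVec (n + Pi.single j k) := by
  have step : ∀ i : ℤ, gen θ j (basisVec (n + Pi.single j i))
      = basisVec (n + Pi.single j (i + 1)) := by
    intro i
    rw [gen_basisVec, phase_add_single, hn, Pi.single_add, add_assoc]
    simp
  induction k using Int.induction_on with
  | zero => simp
  | succ i ih =>
    rw [add_comm (i : ℤ) 1, zpow_add, zpow_one, mul_apply_equiv, ih, step,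
      add_comm (i : ℤ) 1]
  | pred i ih =>
    rw [sub_eq_add_neg, add_comm (-(i : ℤ)) (-1), zpow_add, mul_apply_equiv, ih,
      zpow_neg_one]
    have := step (-1 + -(i : ℤ))
    rw [show -1 + -(i : ℤ) + 1 = -(i : ℤ) by ring] at this
    rw [← this, ← mul_apply_equiv, inv_mul_cancel]
    rfl

theorem monomial_basisVec_zero {d : ℕ} (θ : Matrix (Fin d) (Fin d) ℝ) (m : Fin d → ℤ) :
    monomial θ m (basisVec 0) = basisVec m := by
  have aux : ∀ L : List (Fin d), L.Pairwise (· < ·) →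
      (L.map fun j => gen θ j ^ m j).prod (basisVec 0)
        = basisVec (fun i => if i ∈ L then m i else 0) := by
    intro L
    induction L with
    | nil =>
      intro _
      simp only [List.map_nil, List.prod_nil, List.not_mem_nil, if_false]
      rfl
    | cons j L ih =>
      intro hL
      rw [List.pairwise_cons] at hL
      rw [List.map_cons, List.prod_cons, mul_apply_equiv, ih hL.2,
        gen_zpow_basisVec]
      · congr 1
        ext i
        by_cases hij : i = j
        · subst hij
          have : i ∉ L := fun h => (hL.1 i h).false
          simp [this]
        · simp [hij]
      · unfold phase
        rw [Finset.sum_eq_zero, mul_zero, Circle.exp_zero]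
        intro l hl
        have : l ∉ L := fun h => ((hL.1 l h).trans (Finset.mem_filter.mp hl).2).false
        simp [this]
  have := aux _ (List.pairwise_lt_finRange d)
  simpa [monomial, monomialUnitary] using this

theorem norm_monomial_le {d : ℕ} (θ : Matrix (Fin d) (Fin d) ℝ) (m : Fin d → ℤ) :
    ‖monomial θ m‖ ≤ 1 :=
  ContinuousLinearMap.opNorm_le_bound _ zero_le_one fun f => by
    rw [one_mul]
    exact ((monomialUnitary θ m).norm_map f).le

/-! ### The von Neumann algebra and its trace -/

/-- The quantum torus `𝕋^d_θ`: the von Neumann algebra on `ℓ²(ℤ^d)` generated by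
`U_1, …, U_d`, that is, the bicommutant of these operators and their adjoints. -/
def torusAlgebra {d : ℕ} (θ : Matrix (Fin d) (Fin d) ℝ) : VonNeumannAlgebra (HSpace d) :=
  VonNeumannAlgebra.commutant
    { toStarSubalgebra := StarSubalgebra.centralizer ℂ
        (Set.range fun j => ((gen θ j).toContinuousLinearEquiv : HSpace d →L[ℂ] HSpace d))
      centralizer_centralizer' := by
        exact Set.centralizer_centralizer_centralizer _ }

/-- The trace `τ(a) = ⟨δ_0, a δ_0⟩`, for which `τ(∑ α_m U^m) = α_0`. -/
def trace {d : ℕ} (a : HSpace d →L[ℂ] HSpace d) : ℂ := inner ℂ (basisVec 0) (a (basisVec 0))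

/-- The operator `|a|^s = ((a^* a)^{1/2})^s`. -/
def absPow {H : Type*} [NormedAddCommGroup H] [InnerProductSpace ℂ H] [CompleteSpace H]
    (a : H →L[ℂ] H) (s : ℝ) : H →L[ℂ] H := CFC.abs a ^ s

/-- The norm `‖a‖_p = τ(|a|^p)^{1/p}` for `p < ∞`, and the operator norm for `p = ∞`. -/
def opLpNorm {d : ℕ} (p : ℝ≥0∞) (a : HSpace d →L[ℂ] HSpace d) : ℝ :=
  if p = ∞ then ‖a‖ else (trace (absPow a p.toReal)).re ^ (1 / p.toReal)

/-! ### Test functions -/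

/-- The space `𝒮(𝕋^d_θ)` of all `∑ a_m U^m` with rapidly decreasing coefficients; an element is
represented by its family of coefficients. -/
def Schwartz (d : ℕ) : Submodule ℂ ((Fin d → ℤ) → ℂ) where
  carrier := {a | ∀ N : ℕ, ∃ C : ℝ, ∀ n, (1 + ‖n‖) ^ N * ‖a n‖ ≤ C}
  zero_mem' := fun _ => ⟨0, fun _ => by simp⟩
  add_mem' := by
    intro a b ha hb N
    obtain ⟨C, hC⟩ := ha N
    obtain ⟨D, hD⟩ := hb N
    refine ⟨C + D, fun n => ?_⟩
    calc (1 + ‖n‖) ^ N * ‖(a + b) n‖ ≤ (1 + ‖n‖) ^ N * (‖a n‖ + ‖b n‖) := by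
          gcongr
          exact norm_add_le _ _
      _ ≤ C + D := by rw [mul_add]; exact add_le_add (hC n) (hD n)
  smul_mem' := by
    intro c a ha N
    obtain ⟨C, hC⟩ := ha N
    refine ⟨‖c‖ * C, fun n => ?_⟩
    rw [Pi.smul_apply, smul_eq_mul, norm_mul, mul_left_comm]
    gcongr
    exact hC n

theorem summable_prod_inv (d : ℕ) :
    Summable fun n : Fin d → ℤ => ∏ j, (1 + (n j : ℝ) ^ 2)⁻¹ := by
  have h1 : Summable fun k : ℤ => (1 + (k : ℝ) ^ 2)⁻¹ := by
    have h := (Real.summable_one_div_int_pow (p := 2)).mpr (by norm_num)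
    refine Summable.of_norm_bounded_eventually h ?_
    have h0 : ∀ᶠ k : ℤ in cofinite, k ≠ 0 := by
      rw [Filter.eventually_cofinite]
      exact (Set.finite_singleton (0 : ℤ)).subset fun k hk => not_not.mp hk
    filter_upwards [h0] with k hk
    have hk' : (0 : ℝ) < (k : ℝ) ^ 2 := by positivity
    rw [Real.norm_of_nonneg (by positivity), one_div]
    exact inv_anti₀ hk' (by linarith)
  induction d with
  | zero => exact Summable.of_finite
  | succ d ih =>
    rw [← (Fin.consEquiv fun _ : Fin (d + 1) => ℤ).summable_iff]
    have := h1.mul_of_nonneg ih (fun _ => by positivity)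
      (fun _ => Finset.prod_nonneg fun _ _ => by positivity)
    refine this.congr fun x => ?_
    simp [Fin.consEquiv, Fin.prod_univ_succ, mul_comm]

theorem norm_le_of_decay {d : ℕ} {a : (Fin d → ℤ) → ℂ} {C : ℝ}
    (h : ∀ n, (1 + ‖n‖) ^ (2 * d) * ‖a n‖ ≤ C) (n : Fin d → ℤ) :
    ‖a n‖ ≤ C * ∏ j, (1 + (n j : ℝ) ^ 2)⁻¹ := by
  have hP : (0 : ℝ) < ∏ j, (1 + (n j : ℝ) ^ 2) := Finset.prod_pos fun _ _ => by positivity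
  rw [Finset.prod_inv_distrib, ← div_eq_mul_inv, le_div_iff₀ hP, mul_comm]
  refine le_trans ?_ (h n)
  gcongr
  calc ∏ j, (1 + (n j : ℝ) ^ 2) ≤ ∏ _j : Fin d, (1 + ‖n‖) ^ 2 := by
        refine Finset.prod_le_prod (fun _ _ => by positivity) fun j _ => ?_
        have h1 : |(n j : ℝ)| ≤ ‖n‖ := by
          have := norm_le_pi_norm n j
          rwa [Int.norm_eq_abs] at this
        nlinarith [sq_abs (n j : ℝ), abs_nonneg (n j : ℝ), norm_nonneg n]
    _ = (1 + ‖n‖) ^ (2 * d) := by rw [Finset.prod_const, Finset.card_fin, pow_mul]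

theorem summable_coeff {d : ℕ} (θ : Matrix (Fin d) (Fin d) ℝ) (x : Schwartz d) :
    Summable fun n => x.1 n • monomial θ n := by
  obtain ⟨C, hC⟩ := x.2 (2 * d)
  refine Summable.of_norm_bounded ((summable_prod_inv d).mul_left C) fun n => ?_
  rw [norm_smul]
  calc ‖x.1 n‖ * ‖monomial θ n‖ ≤ ‖x.1 n‖ * 1 := by
        gcongr
        exact norm_monomial_le θ n
    _ ≤ _ := by rw [mul_one]; exact norm_le_of_decay hC n

/-- The operator `∑ a_m U^m` given by a rapidly decreasing family (a norm convergent series). -/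
def Schwartz.toOp {d : ℕ} (θ : Matrix (Fin d) (Fin d) ℝ) :
    Schwartz d →ₗ[ℂ] (HSpace d →L[ℂ] HSpace d) where
  toFun x := ∑' n, x.1 n • monomial θ n
  map_add' x y := by
    rw [← (summable_coeff θ x).tsum_add (summable_coeff θ y)]
    simp [add_smul]
  map_smul' c x := by
    rw [RingHom.id_apply, ← (summable_coeff θ x).tsum_const_smul]
    simp [mul_smul]

/-- A function `φ : ℤ^d → ℂ` of polynomial growth. -/
def PolyGrowth {d : ℕ} (φ : (Fin d → ℤ) → ℂ) : Prop :=
  ∃ (N : ℕ) (C : ℝ), ∀ n, ‖φ n‖ ≤ C * (1 + ‖n‖) ^ N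

theorem PolyGrowth.reflect {d : ℕ} {φ : (Fin d → ℤ) → ℂ} (h : PolyGrowth φ) :
    PolyGrowth fun n => φ (-n) := by
  obtain ⟨N, C, h⟩ := h
  exact ⟨N, C, fun n => by simpa using h (-n)⟩

theorem PolyGrowth.decay {d : ℕ} {φ : (Fin d → ℤ) → ℂ} {N : ℕ} {C : ℝ}
    (h : ∀ n, ‖φ n‖ ≤ C * (1 + ‖n‖) ^ N) {a : (Fin d → ℤ) → ℂ} {M : ℕ} {D : ℝ}
    (ha : ∀ n, (1 + ‖n‖) ^ (M + N) * ‖a n‖ ≤ D) (n : Fin d → ℤ) :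
    (1 + ‖n‖) ^ M * ‖φ n * a n‖ ≤ |C| * D := by
  rw [norm_mul]
  calc (1 + ‖n‖) ^ M * (‖φ n‖ * ‖a n‖)
      ≤ (1 + ‖n‖) ^ M * ((|C| * (1 + ‖n‖) ^ N) * ‖a n‖) := by
        gcongr
        exact (h n).trans (by gcongr; exact le_abs_self C)
    _ = |C| * ((1 + ‖n‖) ^ (M + N) * ‖a n‖) := by rw [pow_add]; ring
    _ ≤ |C| * D := by gcongr; exact ha n

/-- The Fourier multiplier `∑ a_m U^m ↦ ∑ φ(m) a_m U^m` on `𝒮(𝕋^d_θ)`. -/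
def Schwartz.multiplier {d : ℕ} (φ : (Fin d → ℤ) → ℂ) (hφ : PolyGrowth φ) :
    Schwartz d →ₗ[ℂ] Schwartz d where
  toFun x := ⟨fun n => φ n * x.1 n, by
    obtain ⟨N, C, h⟩ := hφ
    intro M
    obtain ⟨D, hD⟩ := x.2 (M + N)
    exact ⟨|C| * D, PolyGrowth.decay h hD⟩⟩
  map_add' x y := by
    ext n
    simp [mul_add]
  map_smul' c x := by
    ext n
    simp [mul_left_comm]

/-- The symbol `∏_j (2πi n_j)^{m_j}` of the partial derivation `D^m = ∂_1^{m_1} ⋯ ∂_d^{m_d}`,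
where `∂_j U_j = 2πi U_j` and `∂_j U_k = 0` for `k ≠ j`. -/
def derivSymbol {d : ℕ} (m : Fin d → ℕ) (n : Fin d → ℤ) : ℂ :=
  ∏ j, (2 * Real.pi * Complex.I * (n j : ℂ)) ^ m j

theorem norm_derivSymbol {d : ℕ} (m : Fin d → ℕ) (n : Fin d → ℤ) :
    ‖derivSymbol m n‖ = ∏ j, (2 * Real.pi * ‖n j‖) ^ m j := by
  simp [derivSymbol, norm_prod, abs_of_pos Real.pi_pos, Int.norm_eq_abs]

theorem polyGrowth_derivSymbol {d : ℕ} (m : Fin d → ℕ) : PolyGrowth (derivSymbol m) := by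
  refine ⟨∑ j, m j, (2 * Real.pi) ^ (∑ j, m j), fun n => ?_⟩
  rw [norm_derivSymbol, ← mul_pow, ← Finset.prod_pow_eq_pow_sum]
  refine Finset.prod_le_prod (fun _ _ => by positivity) fun j _ => ?_
  have := norm_le_pi_norm n j
  gcongr
  linarith

/-- The finite set of multi-indices `m ∈ ℕ₀^d` with `|m|₁ = m_1 + ⋯ + m_d = k`. -/
def indicesOfOrder (d k : ℕ) : Finset (Fin d → ℕ) := Finset.piAntidiag Finset.univ k

/-- The finite set of multi-indices `m ∈ ℕ₀^d` with `|m|₁ ≤ k`. -/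
def indicesUpTo (d k : ℕ) : Finset (Fin d → ℕ) := (Finset.range (k + 1)).biUnion (indicesOfOrder d)

theorem mem_indicesUpTo {d k : ℕ} {m : Fin d → ℕ} : m ∈ indicesUpTo d k ↔ ∑ j, m j ≤ k := by
  simp [indicesUpTo, indicesOfOrder]

/-- The norm `p_k(x) = max_{|m|₁ ≤ k} ‖D^m x‖_∞` on `𝒮(𝕋^d_θ)`. -/
def Schwartz.seminorm {d : ℕ} (θ : Matrix (Fin d) (Fin d) ℝ) (k : ℕ) (x : Schwartz d) : ℝ≥0 :=
  (indicesUpTo d k).sup fun m =>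
    ‖Schwartz.toOp θ (Schwartz.multiplier (derivSymbol m) (polyGrowth_derivSymbol m) x)‖₊

theorem norm_toOp_le_seminorm {d : ℕ} (θ : Matrix (Fin d) (Fin d) ℝ) {k : ℕ} {m : Fin d → ℕ}
    (hm : ∑ j, m j ≤ k) (x : Schwartz d) :
    ‖Schwartz.toOp θ (Schwartz.multiplier (derivSymbol m) (polyGrowth_derivSymbol m) x)‖
      ≤ Schwartz.seminorm θ k x := by
  have := Finset.le_sup (f := fun m => ‖Schwartz.toOp θ
    (Schwartz.multiplier (derivSymbol m) (polyGrowth_derivSymbol m) x)‖₊) (mem_indicesUpTo.mpr hm)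
  exact_mod_cast this

theorem norm_toOp_le {d : ℕ} (θ : Matrix (Fin d) (Fin d) ℝ) (x : Schwartz d) (k : ℕ) :
    ‖Schwartz.toOp θ x‖ ≤ Schwartz.seminorm θ k x := by
  have h := norm_toOp_le_seminorm θ (k := k) (m := 0) (by simp) x
  have e : Schwartz.multiplier (derivSymbol (0 : Fin d → ℕ)) (polyGrowth_derivSymbol 0) x = x := by
    ext n
    simp [Schwartz.multiplier, derivSymbol]
  rwa [e] at h

theorem seminorm_mono {d : ℕ} (θ : Matrix (Fin d) (Fin d) ℝ) {k l : ℕ} (h : k ≤ l)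
    (x : Schwartz d) : Schwartz.seminorm θ k x ≤ Schwartz.seminorm θ l x :=
  Finset.sup_mono fun _ hm => mem_indicesUpTo.mpr ((mem_indicesUpTo.mp hm).trans h)

theorem norm_coeff_le {d : ℕ} (θ : Matrix (Fin d) (Fin d) ℝ) (x : Schwartz d) (n : Fin d → ℤ) :
    ‖x.1 n‖ ≤ ‖Schwartz.toOp θ x‖ := by
  have h1 : Schwartz.toOp θ x (basisVec 0) = ∑' m, x.1 m • basisVec m := by
    have := (ContinuousLinearMap.apply ℂ (HSpace d) (basisVec 0 : HSpace d)).map_tsum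
      (summable_coeff θ x)
    simp only [ContinuousLinearMap.apply_apply, FunLike.coe_smul, Pi.smul_apply,
      monomial_basisVec_zero] at this
    exact this
  have hs : Summable fun m => x.1 m • (basisVec m : HSpace d) := by
    have := (summable_coeff θ x).map (ContinuousLinearMap.apply ℂ (HSpace d) (basisVec 0 : HSpace d))
      (ContinuousLinearMap.continuous _)
    simpa [Function.comp_def, monomial_basisVec_zero] using this
  have h2 : (Schwartz.toOp θ x (basisVec 0)) n = x.1 n := by
    have e : ∀ f : HSpace d, inner ℂ (basisVec n) f = f n := fun f => by
      rw [basisVec, lp.inner_single_left]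
      simp
    rw [h1]
    have := (innerSL ℂ (basisVec n : HSpace d)).map_tsum hs
    simp only [innerSL_apply_apply, e] at this
    rw [this, tsum_eq_single n]
    · simp [basisVec]
    · intro m hm
      have h3 : (basisVec m : HSpace d) n = 0 := lp.single_apply_ne _ _ _ hm.symm
      have h4 : (x.1 m • (basisVec m : HSpace d)) n = x.1 m * (basisVec m : HSpace d) n := rfl
      rw [h4, h3, mul_zero]
  have hb : ‖(basisVec 0 : HSpace d)‖ = 1 := by
    rw [basisVec, lp.norm_single (by norm_num), norm_one]
  calc ‖x.1 n‖ = ‖(Schwartz.toOp θ x (basisVec 0)) n‖ := by rw [h2]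
    _ ≤ ‖Schwartz.toOp θ x (basisVec 0)‖ := lp.norm_apply_le_norm (by norm_num) _ _
    _ ≤ ‖Schwartz.toOp θ x‖ := by
        have := (Schwartz.toOp θ x).le_opNorm (basisVec 0)
        rwa [hb, mul_one] at this

theorem decay_le_seminorm {d : ℕ} (θ : Matrix (Fin d) (Fin d) ℝ) (M : ℕ) (x : Schwartz d)
    (n : Fin d → ℤ) : (1 + ‖n‖) ^ M * ‖x.1 n‖ ≤ 2 ^ M * Schwartz.seminorm θ M x := by
  have h0 : ‖x.1 n‖ ≤ Schwartz.seminorm θ M x := (norm_coeff_le θ x n).trans (norm_toOp_le θ x M)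
  rcases le_total ‖n‖ 1 with h | h
  · calc (1 + ‖n‖) ^ M * ‖x.1 n‖ ≤ (1 + 1) ^ M * Schwartz.seminorm θ M x := by gcongr
      _ = _ := by norm_num
  · have hne : Nonempty (Fin d) := by
      by_contra hd
      rw [not_nonempty_iff] at hd
      have : n = 0 := Subsingleton.elim _ _
      rw [this, norm_zero] at h
      linarith
    obtain ⟨j, hj⟩ : ∃ j, ‖n‖ = ‖n j‖ := by
      obtain ⟨j, -, hj⟩ := Finset.exists_max_image Finset.univ (fun j => ‖n j‖)
        Finset.univ_nonempty
      exact ⟨j, le_antisymm ((pi_norm_le_iff_of_nonneg (norm_nonneg _)).mpr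
        fun i => hj i (Finset.mem_univ i)) (norm_le_pi_norm n j)⟩
    have h1 := (norm_coeff_le θ _ n).trans
      (norm_toOp_le_seminorm θ (k := M) (m := Pi.single j M) (by simp) x)
    have h2 : ‖n‖ ^ M * ‖x.1 n‖ ≤ Schwartz.seminorm θ M x := by
      refine le_trans ?_ h1
      have : (Schwartz.multiplier (derivSymbol (Pi.single j M))
          (polyGrowth_derivSymbol (Pi.single j M)) x).1 n
            = derivSymbol (Pi.single j M) n * x.1 n := rfl
      rw [this, norm_mul, norm_derivSymbol, Finset.prod_eq_single j, Pi.single_eq_same, hj]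
      · gcongr
        nlinarith [Real.pi_gt_three, norm_nonneg (n j)]
      · intro i _ hi
        simp [hi]
      · simp
    calc (1 + ‖n‖) ^ M * ‖x.1 n‖ ≤ (2 * ‖n‖) ^ M * ‖x.1 n‖ := by
          gcongr
          linarith
      _ = 2 ^ M * (‖n‖ ^ M * ‖x.1 n‖) := by rw [mul_pow]; ring
      _ ≤ _ := by gcongr

theorem seminorm_multiplier_le {d : ℕ} (θ : Matrix (Fin d) (Fin d) ℝ) (φ : (Fin d → ℤ) → ℂ)
    (hφ : PolyGrowth φ) (k : ℕ) : ∃ (l : ℕ) (C : ℝ), ∀ x : Schwartz d,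
      (Schwartz.seminorm θ k (Schwartz.multiplier φ hφ x) : ℝ) ≤ C * Schwartz.seminorm θ l x := by
  obtain ⟨N, C, h⟩ := id hφ
  have S0 : 0 ≤ ∑' n : Fin d → ℤ, ∏ j, (1 + (n j : ℝ) ^ 2)⁻¹ :=
    tsum_nonneg fun n => Finset.prod_nonneg fun _ _ => by positivity
  set S := ∑' n : Fin d → ℤ, ∏ j, (1 + (n j : ℝ) ^ 2)⁻¹ with hS
  let K : ℝ := (2 * Real.pi) ^ k
  have K1 : 1 ≤ 2 * Real.pi := by nlinarith [Real.pi_gt_three]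
  refine ⟨2 * d + k + N, K * (|C| * 2 ^ (2 * d + k + N)) * S, fun x => ?_⟩
  set P : ℝ := (Schwartz.seminorm θ (2 * d + k + N) x : ℝ) with hP
  have P0 : 0 ≤ P := NNReal.coe_nonneg _
  have hsup : Schwartz.seminorm θ k (Schwartz.multiplier φ hφ x)
      ≤ Real.toNNReal (K * (|C| * 2 ^ (2 * d + k + N)) * S * P) := by
    refine Finset.sup_le fun m hm => ?_
    rw [mem_indicesUpTo] at hm
    rw [← NNReal.coe_le_coe, Real.coe_toNNReal _ (by positivity), coe_nnnorm]
    set y := Schwartz.multiplier (derivSymbol m) (polyGrowth_derivSymbol m)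
      (Schwartz.multiplier φ hφ x) with hy
    have hg : ∀ n : Fin d → ℤ, ‖derivSymbol m n‖ ≤ K * (1 + ‖n‖) ^ k := by
      intro n
      rw [norm_derivSymbol]
      calc ∏ j, (2 * Real.pi * ‖n j‖) ^ m j
          ≤ ∏ j, (2 * Real.pi * (1 + ‖n‖)) ^ m j := by
            refine Finset.prod_le_prod (fun _ _ => by positivity) fun j _ => ?_
            have := norm_le_pi_norm n j
            gcongr
            linarith
        _ = (2 * Real.pi * (1 + ‖n‖)) ^ (∑ j, m j) := Finset.prod_pow_eq_pow_sum _ _ _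
        _ ≤ (2 * Real.pi * (1 + ‖n‖)) ^ k := by
            refine pow_le_pow_right₀ ?_ hm
            nlinarith [norm_nonneg n]
        _ = _ := by rw [mul_pow]
    have hdec : ∀ n, (1 + ‖n‖) ^ (2 * d) * ‖y.1 n‖
        ≤ |K| * (|C| * (2 ^ (2 * d + k + N) * P)) :=
      PolyGrowth.decay hg (PolyGrowth.decay h fun n => decay_le_seminorm θ _ x n)
    have hbd : ∀ n, ‖y.1 n • monomial θ n‖
        ≤ |K| * (|C| * (2 ^ (2 * d + k + N) * P)) * ∏ j, (1 + (n j : ℝ) ^ 2)⁻¹ := by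
      intro n
      rw [norm_smul]
      calc ‖y.1 n‖ * ‖monomial θ n‖ ≤ ‖y.1 n‖ * 1 := by
            gcongr
            exact norm_monomial_le θ n
        _ ≤ _ := by rw [mul_one]; exact norm_le_of_decay hdec n
    have hle := tsum_of_norm_bounded
      ((summable_prod_inv d).mul_left (|K| * (|C| * (2 ^ (2 * d + k + N) * P)))).hasSum hbd
    rw [tsum_mul_left, ← hS, abs_of_nonneg (show 0 ≤ K by positivity)] at hle
    calc ‖Schwartz.toOp θ y‖ ≤ K * (|C| * (2 ^ (2 * d + k + N) * P)) * S := hle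
      _ = _ := by ring
  have := NNReal.coe_le_coe.mpr hsup
  rwa [Real.coe_toNNReal _ (by positivity)] at this

/-! ### Distributions -/

/-- The space `𝒮'(𝕋^d_θ)` of distributions: the linear functionals on `𝒮(𝕋^d_θ)` that are
continuous for the topology defined by the (increasing) norms `p_k`. -/
def Distribution {d : ℕ} (θ : Matrix (Fin d) (Fin d) ℝ) : Submodule ℂ (Schwartz d →ₗ[ℂ] ℂ) where
  carrier := {F | ∃ (k : ℕ) (C : ℝ), ∀ x, ‖F x‖ ≤ C * Schwartz.seminorm θ k x}
  zero_mem' := ⟨0, 0, fun _ => by simp⟩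
  add_mem' := by
    rintro F G ⟨k, C, hF⟩ ⟨l, D, hG⟩
    refine ⟨max k l, |C| + |D|, fun x => ?_⟩
    have hk : (Schwartz.seminorm θ k x : ℝ) ≤ Schwartz.seminorm θ (max k l) x :=
      seminorm_mono θ (le_max_left k l) x
    have hl : (Schwartz.seminorm θ l x : ℝ) ≤ Schwartz.seminorm θ (max k l) x :=
      seminorm_mono θ (le_max_right k l) x
    calc ‖(F + G) x‖ ≤ ‖F x‖ + ‖G x‖ := norm_add_le _ _
      _ ≤ |C| * Schwartz.seminorm θ k x + |D| * Schwartz.seminorm θ l x := by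
          refine add_le_add ((hF x).trans ?_) ((hG x).trans ?_)
          · gcongr
            exact le_abs_self C
          · gcongr
            exact le_abs_self D
      _ ≤ _ := by
          rw [add_mul]
          gcongr
  smul_mem' := by
    rintro c F ⟨k, C, hF⟩
    refine ⟨k, ‖c‖ * C, fun x => ?_⟩
    rw [LinearMap.smul_apply, norm_smul, mul_assoc]
    gcongr
    exact hF x

/-- The Fourier multiplier with symbol `φ` on distributions, so that `F = ∑ F̂(n) U^n` is mapped to
`∑ φ(n) F̂(n) U^n`. Since `F̂(n) = ⟨F, (U^n)^*⟩` and `(U^n)^*` is a multiple of `U^{-n}`, it is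
the transpose of the multiplier with symbol `φ(-n)` on `𝒮(𝕋^d_θ)`. -/
def multiplier {d : ℕ} (θ : Matrix (Fin d) (Fin d) ℝ) (φ : (Fin d → ℤ) → ℂ) (hφ : PolyGrowth φ) :
    Distribution θ →ₗ[ℂ] Distribution θ where
  toFun F := ⟨F.1 ∘ₗ Schwartz.multiplier (fun n => φ (-n)) hφ.reflect, by
    obtain ⟨k, C, hF⟩ := F.2
    obtain ⟨l, D, hD⟩ := seminorm_multiplier_le θ _ hφ.reflect k
    refine ⟨l, |C| * D, fun x => (hF _).trans ?_⟩
    rw [mul_assoc]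
    exact (mul_le_mul_of_nonneg_right (le_abs_self C) (NNReal.coe_nonneg _)).trans
      (mul_le_mul_of_nonneg_left (hD x) (abs_nonneg C))⟩
  map_add' _ _ := rfl
  map_smul' _ _ := rfl

/-- The partial derivation `D^m` on distributions. -/
def partialDeriv {d : ℕ} (θ : Matrix (Fin d) (Fin d) ℝ) (m : Fin d → ℕ) :
    Distribution θ →ₗ[ℂ] Distribution θ :=
  multiplier θ (derivSymbol m) (polyGrowth_derivSymbol m)

/-- The symbol `d_u(n) = e^{2πi u·n} - 1` of the difference operator by `u`. -/
def diffSymbol {d : ℕ} (u : EuclideanSpace ℝ (Fin d)) (n : Fin d → ℤ) : ℂ :=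
  Complex.exp (2 * Real.pi * Complex.I * (∑ j, u j * n j : ℝ)) - 1

theorem polyGrowth_diffSymbol {d : ℕ} (u : EuclideanSpace ℝ (Fin d)) :
    PolyGrowth (diffSymbol u) := by
  refine ⟨0, 2, fun n => ?_⟩
  rw [pow_zero, mul_one, diffSymbol]
  refine (norm_sub_le _ _).trans ?_
  rw [show 2 * (Real.pi : ℂ) * Complex.I * ((∑ j, u j * n j : ℝ) : ℂ)
    = ((2 * Real.pi * ∑ j, u j * n j : ℝ) : ℂ) * Complex.I by push_cast; ring,
    Complex.norm_exp_ofReal_mul_I, norm_one]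
  norm_num

/-- The difference operator `Δ_u = T_u - 1`, where `T_u U^n = e^{2πi u·n} U^n`. -/
def diff {d : ℕ} (θ : Matrix (Fin d) (Fin d) ℝ) (u : EuclideanSpace ℝ (Fin d)) :
    Distribution θ →ₗ[ℂ] Distribution θ :=
  multiplier θ (diffSymbol u) (polyGrowth_diffSymbol u)

/-- The distribution `x ↦ τ(a x)` given by a bounded operator `a`. -/
def ofOp {d : ℕ} (θ : Matrix (Fin d) (Fin d) ℝ) (a : HSpace d →L[ℂ] HSpace d) :
    Distribution θ :=
  ⟨{ toFun := fun x => trace (a * Schwartz.toOp θ x)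
     map_add' := fun x y => by simp [trace]
     map_smul' := fun c x => by simp [trace] }, by
    refine ⟨0, ‖a‖, fun x => ?_⟩
    have hb : ‖(basisVec 0 : HSpace d)‖ = 1 := by
      rw [basisVec, lp.norm_single (by norm_num), norm_one]
    calc ‖trace (a * Schwartz.toOp θ x)‖
        ≤ ‖(basisVec 0 : HSpace d)‖ * ‖(a * Schwartz.toOp θ x) (basisVec 0)‖ :=
          norm_inner_le_norm _ _
      _ ≤ ‖a * Schwartz.toOp θ x‖ := by
          have := (a * Schwartz.toOp θ x).le_opNorm (basisVec 0)
          rwa [hb, mul_one, ← one_mul ‖(a * Schwartz.toOp θ x) (basisVec 0)‖, ← hb] at this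
      _ ≤ ‖a‖ * ‖Schwartz.toOp θ x‖ := norm_mul_le _ _
      _ ≤ ‖a‖ * Schwartz.seminorm θ 0 x := by
          gcongr
          exact norm_toOp_le θ x 0⟩

/-! ### Noncommutative `L_p`-spaces as spaces of distributions -/

/-- `HasLpNorm θ p F r`: the distribution `F` is an element of `L_p(𝕋^d_θ)`, of norm `r`.
Here `L_p(𝕋^d_θ)`, the completion of `𝕋^d_θ` for the norm `‖·‖_p`, is realised inside
`𝒮'(𝕋^d_θ)` through the embedding `y ↦ (x ↦ τ(y x))`: its elements are the limits in `𝒮'(𝕋^d_θ)`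
of the `‖·‖_p`-Cauchy sequences of `𝕋^d_θ`, the norm being the limit of the norms.
For `p = ∞` the algebra is complete and `L_∞(𝕋^d_θ) = 𝕋^d_θ` with the operator norm. -/
def HasLpNorm {d : ℕ} (θ : Matrix (Fin d) (Fin d) ℝ) (p : ℝ≥0∞) (F : Distribution θ) (r : ℝ) :
    Prop :=
  if p = ∞ then ∃ a ∈ torusAlgebra θ, ofOp θ a = F ∧ ‖a‖ = r
  else ∃ a : ℕ → (HSpace d →L[ℂ] HSpace d), (∀ i, a i ∈ torusAlgebra θ) ∧
    (∀ ε > 0, ∃ N, ∀ i ≥ N, ∀ j ≥ N, opLpNorm p (a i - a j) < ε) ∧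
    (∀ x, Tendsto (fun i => (ofOp θ (a i)).1 x) atTop (𝓝 (F.1 x))) ∧
    Tendsto (fun i => opLpNorm p (a i)) atTop (𝓝 r)

/-- The distribution `F` belongs to `L_p(𝕋^d_θ)`. -/
def MemLp {d : ℕ} (θ : Matrix (Fin d) (Fin d) ℝ) (p : ℝ≥0∞) (F : Distribution θ) : Prop :=
  ∃ r, HasLpNorm θ p F r

/-- The norm `‖F‖_p ∈ [0, ∞]`, equal to `∞` if `F` is not in `L_p(𝕋^d_θ)`. -/
def lpNorm {d : ℕ} (θ : Matrix (Fin d) (Fin d) ℝ) (p : ℝ≥0∞) (F : Distribution θ) : ℝ≥0∞ :=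
  ⨅ (r : ℝ) (_ : HasLpNorm θ p F r), ENNReal.ofReal r

/-! ### Sobolev spaces, modulus of smoothness, Lipschitz classes -/

/-- The distribution `x` belongs to the Sobolev space `W^k_p(𝕋^d_θ)`. -/
def MemSobolev {d : ℕ} (θ : Matrix (Fin d) (Fin d) ℝ) (k : ℕ) (p : ℝ≥0∞) (x : Distribution θ) :
    Prop :=
  ∀ m ∈ indicesUpTo d k, MemLp θ p (partialDeriv θ m x)

/-- The homogeneous seminorm `|x|_{W^k_p} = (∑_{|m|₁ = k} ‖D^m x‖_p^p)^{1/p}`, with the usual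
convention for `p = ∞`. -/
def sobolevSeminorm {d : ℕ} (θ : Matrix (Fin d) (Fin d) ℝ) (k : ℕ) (p : ℝ≥0∞)
    (x : Distribution θ) : ℝ≥0∞ :=
  if p = ∞ then (indicesOfOrder d k).sup fun m => lpNorm θ p (partialDeriv θ m x)
  else (∑ m ∈ indicesOfOrder d k, lpNorm θ p (partialDeriv θ m x) ^ p.toReal) ^ (1 / p.toReal)

/-- The `k`th order modulus of `L_p`-smoothness
`ω^k_p(x, ε) = sup_{0 < |u| ≤ ε} ‖Δ_u^k x‖_p`. -/
def modulus {d : ℕ} (θ : Matrix (Fin d) (Fin d) ℝ) (k : ℕ) (p : ℝ≥0∞) (x : Distribution θ)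
    (ε : ℝ) : ℝ≥0∞ :=
  ⨆ (u : EuclideanSpace ℝ (Fin d)) (_ : 0 < ‖u‖ ∧ ‖u‖ ≤ ε), lpNorm θ p ((diff θ u)^[k] x)

/-- The quantity `sup_{ε > 0} ω^k_p(x, ε) / ε^k`. -/
def lipschitzSeminorm {d : ℕ} (θ : Matrix (Fin d) (Fin d) ℝ) (k : ℕ) (p : ℝ≥0∞)
    (x : Distribution θ) : ℝ≥0∞ :=
  ⨆ (ε : ℝ) (_ : 0 < ε), modulus θ k p x ε / ENNReal.ofReal (ε ^ k)

/-- The Lipschitz class of order `k`: the elements `x` of `L_∞(𝕋^d_θ) = 𝕋^d_θ` with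
`sup_{ε > 0} ω^k_∞(x, ε) / ε^k < ∞`. -/
def MemLipschitz {d : ℕ} (θ : Matrix (Fin d) (Fin d) ℝ) (k : ℕ) (x : Distribution θ) : Prop :=
  MemLp θ ∞ x ∧ lipschitzSeminorm θ k ∞ x < ∞

end QuantumTorus

end

/-! Everything is a comparison of Fourier symbols through averages of translates. With z = 2πi u·n,
the k-th derivative along u has symbol z^k and Δ_u^k has symbol (e^z - 1)^k.

Upper bound: (e^z - 1)/z is the integral of e^{tz} over [0,1], so Δ_u^k is a k-fold average of
translates applied to the k-th directional derivative. Translations are isometries of L_p, so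
averages are contractions (`lpNorm_iterate_diff_le`); the multinomial theorem then expands the
directional derivative into the D^m with |m|₁ = k, gaining a factor |u|^k.

Lower bound: the k-th derivative along v is the distributional limit of t^{-k} Δ_{tv}^k x, whose
norms are at most |v|^k times the Lipschitz seminorm (`exists_tendsto_dirDeriv`), and the L_p-norm
is lower semicontinuous (`lpNorm_le_of_tendsto`). Polarization recovers each D^m from finitely many
directional derivatives (`exists_partialDeriv_eq_sum_dirDeriv`). The vectors and coefficients depend
only on m and d, which makes the constants uniform in θ and p.

Semicontinuity for p < ∞ is duality with test functions. A trace form of Young's inequality yields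
Hölder's inequality and a nearly optimal dual element of the algebra
(`IsTracialVector.exists_dual`); a Fejér mean, again an average of translates, turns it into a test
function without increasing its dual norm (`exists_isDualTest`). For p = ∞ weak operator compactness
gives more: the limit is itself in the algebra (`lpNorm_top_le_of_tendsto`).

In (ii), Sobolev implies Lipschitz by the upper bound. Conversely compactness puts the derivatives
of order k in L_∞, and lower orders follow by inverting ∂_j on the frequencies n_j ≠ 0 with limits
of bounded combinations of translates (`memLp_partialDeriv_of_add_single`). -/

noncomputable section

namespace QuantumTorus

/-! ### Conjugation by unitaries -/

section Conjugation

variable {H : Type*} [NormedAddCommGroup H] [InnerProductSpace ℂ H]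

/-- A unitary of a Hilbert space as a bounded operator. -/
abbrev toOperator (e : H ≃ₗᵢ[ℂ] H) : H →L[ℂ] H :=
  (e.toContinuousLinearEquiv : H →L[ℂ] H)

theorem toOperator_mul_symm (e : H ≃ₗᵢ[ℂ] H) :
    toOperator e * toOperator e.symm = 1 := by
  ext1 f
  exact e.apply_symm_apply f

theorem toOperator_symm_mul (e : H ≃ₗᵢ[ℂ] H) :
    toOperator e.symm * toOperator e = 1 := by
  ext1 f
  exact e.symm_apply_apply f

variable [CompleteSpace H]

theorem star_toOperator (e : H ≃ₗᵢ[ℂ] H) :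
    star (toOperator e) = toOperator e.symm := by
  rw [ContinuousLinearMap.star_eq_adjoint]
  exact LinearIsometryEquiv.adjoint_eq_symm e

/-- Conjugation by a unitary, as an automorphism of the algebra of bounded operators. -/
def conjHom (e : H ≃ₗᵢ[ℂ] H) :
    (H →L[ℂ] H) →⋆ₐ[ℂ] (H →L[ℂ] H) where
  toFun a := toOperator e * a * toOperator e.symm
  map_one' := by rw [mul_one, toOperator_mul_symm]
  map_mul' a b := by
    rw [show toOperator e * a * toOperator e.symm * (toOperator e * b * toOperator e.symm)
      = toOperator e * a * (toOperator e.symm * toOperator e) * b * toOperator e.symm by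
        simp only [mul_assoc], toOperator_symm_mul, mul_one]
    simp only [mul_assoc]
  map_zero' := by simp
  map_add' a b := by rw [mul_add, add_mul]
  commutes' r := by
    rw [← Algebra.commutes, mul_assoc, toOperator_mul_symm, mul_one]
  map_star' a := by
    rw [star_mul, star_mul, star_toOperator, star_toOperator, mul_assoc]
    rfl

theorem continuous_conjHom (e : H ≃ₗᵢ[ℂ] H) : Continuous (conjHom e) :=
  ((continuous_const.mul continuous_id).mul continuous_const)

/-- Conjugation is a continuous *-homomorphism, so it preserves positive square roots by their
uniqueness and commutes with the continuous functional calculus. The sign of `r` makes the power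
function continuous at 0. -/
theorem absPow_conjHom (e : H ≃ₗᵢ[ℂ] H) (a : H →L[ℂ] H) {r : ℝ} (hr : 0 ≤ r) :
    absPow (conjHom e a) r = conjHom e (absPow a r) := by
  have hc := continuous_conjHom e
  have habs : CFC.abs (conjHom e a) = conjHom e (CFC.abs a) := by
    rw [CFC.abs, CFC.sqrt_eq_iff _ _ (star_mul_self_nonneg _)
      (map_nonneg (conjHom e) (CFC.abs_nonneg a)), ← map_mul, CFC.abs_mul_abs,
      map_mul, map_star]
  have h0 := CFC.abs_nonneg a
  have h1 : 0 ≤ conjHom e (CFC.abs a) := map_nonneg (conjHom e) h0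
  rw [absPow, absPow, habs, CFC.rpow_eq_cfc_real h0, CFC.rpow_eq_cfc_real h1]
  exact (StarAlgHomClass.map_cfc (S := ℂ) (R := ℝ) (conjHom e)
    (fun x : ℝ => x ^ r) (CFC.abs a) (Real.continuous_rpow_const hr).continuousOn hc
    h0.isSelfAdjoint h1.isSelfAdjoint).symm

end Conjugation

/-! ### Vector states, right multiplications and traciality -/

theorem inner_basisVec {d : ℕ} (n : Fin d → ℤ) (f : HSpace d) :
    inner ℂ (basisVec n) f = f n := by
  rw [basisVec, lp.inner_single_left]
  simp

theorem basisVec_apply {d : ℕ} (m n : Fin d → ℤ) :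
    (basisVec m : HSpace d) n = if n = m then 1 else 0 := by
  rw [basisVec, lp.coeFn_single, Pi.single_apply]

theorem norm_basisVec {d : ℕ} (n : Fin d → ℤ) : ‖(basisVec n : HSpace d)‖ = 1 := by
  rw [basisVec, lp.norm_single (by norm_num), norm_one]

theorem hasSum_inner {d : ℕ} (f g : HSpace d) :
    HasSum (fun n => (starRingEnd ℂ) (f n) * g n) (inner ℂ f g) := by
  have := lp.hasSum_inner (𝕜 := ℂ) f g
  simpa [mul_comm] using this

/-- The bicommutant in usable form: membership is commutation with everything that commutes with the
generators, a condition that is stable under weak limits. -/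
theorem mem_torusAlgebra_iff {d : ℕ} {θ : Matrix (Fin d) (Fin d) ℝ} {a : HSpace d →L[ℂ] HSpace d} :
    a ∈ torusAlgebra θ ↔ ∀ c : HSpace d →L[ℂ] HSpace d,
      (∀ j, Commute (toOperator (gen θ j)) c ∧ Commute (toOperator (gen θ j).symm) c) →
        c * a = a * c := by
  rw [torusAlgebra, VonNeumannAlgebra.mem_commutant_iff]
  refine forall_congr' fun c => ?_
  refine imp_congr ?_ Iff.rfl
  change c ∈ StarSubalgebra.centralizer ℂ _ ↔ _
  rw [StarSubalgebra.mem_centralizer_iff]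
  simp only [Set.mem_range, forall_exists_index, forall_apply_eq_imp_iff]
  refine forall_congr' fun j => ?_
  rw [show star (((gen θ j).toContinuousLinearEquiv : HSpace d →L[ℂ] HSpace d))
    = toOperator (gen θ j).symm from star_toOperator _]
  rfl

theorem commute_toOperator_symm {d : ℕ} {e : HSpace d ≃ₗᵢ[ℂ] HSpace d}
    {c : HSpace d →L[ℂ] HSpace d} (h : Commute (toOperator e) c) :
    Commute (toOperator e.symm) c := by
  ext1 f
  have := congrArg e.symm (DFunLike.congr_fun h.eq (e.symm f))
  simpa using this.symm

/-- The bilinear form `β(m, n) = ∑_{l < j} θ_{jl} m_j n_l`, for which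
`U^m U^n = exp(2πi β(m, n)) U^{m + n}`. -/
def mulForm {d : ℕ} (θ : Matrix (Fin d) (Fin d) ℝ) (m n : Fin d → ℤ) : ℝ :=
  ∑ j, ∑ l ∈ Finset.univ.filter (fun l => l < j), θ j l * m j * n l

theorem mulForm_add_left {d : ℕ} (θ : Matrix (Fin d) (Fin d) ℝ) (m m' n : Fin d → ℤ) :
    mulForm θ (m + m') n = mulForm θ m n + mulForm θ m' n := by
  simp [mulForm, mul_add, add_mul, Finset.sum_add_distrib]

theorem mulForm_add_right {d : ℕ} (θ : Matrix (Fin d) (Fin d) ℝ) (m n n' : Fin d → ℤ) :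
    mulForm θ m (n + n') = mulForm θ m n + mulForm θ m n' := by
  simp [mulForm, mul_add, Finset.sum_add_distrib]

theorem phase_eq_mulForm {d : ℕ} (θ : Matrix (Fin d) (Fin d) ℝ) (j : Fin d) (n : Fin d → ℤ) :
    phase θ j n = Circle.exp (2 * Real.pi * mulForm θ (Pi.single j 1) n) := by
  rw [phase, mulForm]
  congr 2
  symm
  rw [Finset.sum_eq_single j]
  · simp
  · intro i _ hi
    exact Finset.sum_eq_zero fun l _ => by simp [Pi.single_eq_of_ne hi]
  · exact fun h => absurd (Finset.mem_univ j) h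

/-- Right multiplication by `U^n`. -/
def rightMul {d : ℕ} (θ : Matrix (Fin d) (Fin d) ℝ) (n : Fin d → ℤ) :
    HSpace d ≃ₗᵢ[ℂ] HSpace d :=
  weightedPerm (Equiv.subRight n) fun m => Circle.exp (2 * Real.pi * mulForm θ (m - n) n)

/-- This is associativity, U_j (f U^n) = (U_j f) U^n; bilinearity of `mulForm` makes the two phases
agree. -/
theorem commute_gen_rightMul {d : ℕ} (θ : Matrix (Fin d) (Fin d) ℝ) (j : Fin d) (n : Fin d → ℤ) :
    Commute (toOperator (gen θ j)) (toOperator (rightMul θ n)) := by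
  ext f m
  change gen θ j (rightMul θ n f) m = rightMul θ n (gen θ j f) m
  simp only [gen, rightMul, weightedPerm_apply, Equiv.subRight_apply, phase_eq_mulForm]
  rw [← mul_assoc, ← mul_assoc, ← Circle.coe_mul, ← Circle.coe_mul, ← Circle.exp_add,
    ← Circle.exp_add, sub_right_comm]
  congr 3
  set p := m - n - Pi.single j 1 with hp
  rw [show m = p + n + Pi.single j 1 by rw [hp]; abel]
  simp only [add_sub_cancel_right, add_sub_right_comm, mulForm_add_left, mulForm_add_right]
  ring

theorem commute_rightMul {d : ℕ} {θ : Matrix (Fin d) (Fin d) ℝ} {a : HSpace d →L[ℂ] HSpace d}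
    (ha : a ∈ torusAlgebra θ) (n : Fin d → ℤ) : Commute (toOperator (rightMul θ n)) a :=
  mem_torusAlgebra_iff.mp ha _ fun j =>
    ⟨commute_gen_rightMul θ j n, commute_toOperator_symm (commute_gen_rightMul θ j n)⟩

theorem mulForm_zero_left {d : ℕ} (θ : Matrix (Fin d) (Fin d) ℝ) (n : Fin d → ℤ) :
    mulForm θ 0 n = 0 := by
  simp [mulForm]

/-- The vector δ_0 is thus cyclic for the commutant, and an element of the algebra is determined by
its coefficients, the coordinates of its value at δ_0. -/
theorem rightMul_basisVec_zero {d : ℕ} (θ : Matrix (Fin d) (Fin d) ℝ) (n : Fin d → ℤ) :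
    rightMul θ n (basisVec 0) = basisVec n := by
  ext m
  rw [rightMul, weightedPerm_apply, Equiv.subRight_apply, basisVec_apply, basisVec_apply]
  by_cases h : m = n
  · subst h
    simp [mulForm_zero_left]
  · simp [h, sub_eq_zero]

/-- The coefficients of `a^*` are the conjugates of those of `a`, reflected, up to a phase. -/
theorem star_apply_basisVec_zero {d : ℕ} {θ : Matrix (Fin d) (Fin d) ℝ}
    {a : HSpace d →L[ℂ] HSpace d} (ha : a ∈ torusAlgebra θ) (n : Fin d → ℤ) :
    (star a) (basisVec 0) n = (Circle.exp (-(2 * Real.pi * mulForm θ (-n) n)) : ℂ)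
      * (starRingEnd ℂ) (a (basisVec 0) (-n)) := by
  have h1 : a (basisVec n) = rightMul θ n (a (basisVec 0)) := by
    rw [← rightMul_basisVec_zero θ n]
    exact (DFunLike.congr_fun (commute_rightMul ha n).eq (basisVec 0)).symm
  rw [← inner_basisVec, ContinuousLinearMap.star_eq_adjoint,
    ContinuousLinearMap.adjoint_inner_right, h1, ← inner_conj_symm, inner_basisVec, rightMul,
    weightedPerm_apply, map_mul, Equiv.subRight_apply, zero_sub, ← Circle.coe_inv_eq_conj,
    ← Circle.exp_neg]

/-- The trace is tracial on the quantum torus. -/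
theorem trace_mul_comm {d : ℕ} {θ : Matrix (Fin d) (Fin d) ℝ} {a b : HSpace d →L[ℂ] HSpace d}
    (ha : a ∈ torusAlgebra θ) (hb : b ∈ torusAlgebra θ) : trace (a * b) = trace (b * a) := by
  have e : ∀ x y : HSpace d →L[ℂ] HSpace d,
      trace (x * y) = inner ℂ ((star x) (basisVec 0)) (y (basisVec 0)) := fun x y => by
    rw [trace, ContinuousLinearMap.star_eq_adjoint, ContinuousLinearMap.adjoint_inner_left]
    rfl
  rw [e, e]
  have h1 := hasSum_inner ((star a) (basisVec 0)) (b (basisVec 0))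
  have h2 := hasSum_inner ((star b) (basisVec 0)) (a (basisVec 0))
  -- Adjoints reflect frequencies, so the two series agree termwise after n ↦ -n; the phase meets
  -- its conjugate and cancels.
  rw [← (Equiv.neg (Fin d → ℤ)).hasSum_iff] at h2
  refine h1.unique ?_
  convert h2 using 2 with n
  have hb' : b (basisVec 0) n = (Circle.exp (-(2 * Real.pi * mulForm θ (-n) n)) : ℂ)
      * (starRingEnd ℂ) ((star b) (basisVec 0) (-n)) := by
    have := star_apply_basisVec_zero (star_mem hb) n
    rwa [star_star] at this
  rw [Function.comp_apply, star_apply_basisVec_zero ha, hb', map_mul, RingHomCompTriple.comp_apply,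
    RingHom.id_apply, ← Circle.coe_inv_eq_conj, Equiv.neg_apply]
  rw [mul_mul_mul_comm, ← Circle.coe_mul, inv_mul_cancel, Circle.coe_one, one_mul, mul_comm]

theorem Schwartz.toOp_basisVec_zero {d : ℕ} (θ : Matrix (Fin d) (Fin d) ℝ) (x : Schwartz d)
    (n : Fin d → ℤ) : (Schwartz.toOp θ x) (basisVec 0) n = x.1 n := by
  have h := (((innerSL ℂ (basisVec n : HSpace d)).comp
    (ContinuousLinearMap.apply ℂ (HSpace d) (basisVec 0 : HSpace d)))).map_tsum
    (summable_coeff θ x)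
  have e : ∀ a : HSpace d →L[ℂ] HSpace d, ((innerSL ℂ (basisVec n : HSpace d)).comp
      (ContinuousLinearMap.apply ℂ (HSpace d) (basisVec 0 : HSpace d))) a = a (basisVec 0) n :=
    fun a => inner_basisVec n _
  rw [e] at h
  refine h.trans ?_
  rw [tsum_eq_single n]
  · rw [e]
    change x.1 n * (monomial θ n (basisVec 0)) n = _
    rw [monomial_basisVec_zero, basisVec_apply, if_pos rfl, mul_one]
  · intro m hm
    rw [e]
    change x.1 m * (monomial θ m (basisVec 0)) n = _
    rw [monomial_basisVec_zero, basisVec_apply, if_neg hm.symm, mul_zero]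

theorem trace_mul {d : ℕ} (a b : HSpace d →L[ℂ] HSpace d) :
    trace (a * b) = inner ℂ ((star a) (basisVec 0)) (b (basisVec 0)) := by
  rw [trace, ContinuousLinearMap.star_eq_adjoint, ContinuousLinearMap.adjoint_inner_left]
  rfl

/-- Parseval's identity: the trace pairing becomes an absolutely convergent series in the
coefficients, on which Fourier multipliers act termwise. -/
theorem hasSum_trace_mul {d : ℕ} (a b : HSpace d →L[ℂ] HSpace d) :
    HasSum (fun n => (starRingEnd ℂ) ((star a) (basisVec 0) n) * b (basisVec 0) n)
      (trace (a * b)) := by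
  rw [trace_mul]
  exact hasSum_inner _ _

theorem trace_add {d : ℕ} (a b : HSpace d →L[ℂ] HSpace d) : trace (a + b) = trace a + trace b := by
  simp [trace]

theorem trace_sub {d : ℕ} (a b : HSpace d →L[ℂ] HSpace d) : trace (a - b) = trace a - trace b := by
  simp [trace]

theorem trace_smul {d : ℕ} (c : ℂ) (a : HSpace d →L[ℂ] HSpace d) :
    trace (c • a) = c * trace a := by
  simp [trace]

/-! ### Translations -/

/-- The character `n ↦ exp(2πi s·n)` of `ℤ^d`. -/
def character {d : ℕ} (s : Fin d → ℝ) (n : Fin d → ℤ) : Circle :=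
  Circle.exp (2 * Real.pi * ∑ j, s j * n j)

theorem character_neg {d : ℕ} (s : Fin d → ℝ) (n : Fin d → ℤ) :
    character s (-n) = (character s n)⁻¹ := by
  rw [character, character, ← Circle.exp_neg]
  congr 1
  simp

theorem character_add {d : ℕ} (s : Fin d → ℝ) (m n : Fin d → ℤ) :
    character s (m + n) = character s m * character s n := by
  rw [character, character, character, ← Circle.exp_add]
  congr 1
  simp [mul_add, Finset.sum_add_distrib]

/-- The diagonal unitary `δ_n ↦ exp(2πi s·n) δ_n`. -/
def diagUnitary {d : ℕ} (s : Fin d → ℝ) : HSpace d ≃ₗᵢ[ℂ] HSpace d :=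
  weightedPerm (Equiv.refl _) (character s)

theorem diagUnitary_apply {d : ℕ} (s : Fin d → ℝ) (f : HSpace d) (n : Fin d → ℤ) :
    diagUnitary s f n = (character s n : ℂ) * f n := rfl

theorem diagUnitary_basisVec_zero {d : ℕ} (s : Fin d → ℝ) :
    diagUnitary s (basisVec 0) = basisVec 0 := by
  ext n
  rw [diagUnitary_apply, basisVec_apply]
  split_ifs with h
  · subst h
    simp [character]
  · simp

theorem diagUnitary_symm_basisVec_zero {d : ℕ} (s : Fin d → ℝ) :
    (diagUnitary s).symm (basisVec 0) = basisVec 0 := by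
  rw [LinearIsometryEquiv.symm_apply_eq, diagUnitary_basisVec_zero]

/-- The translation `T_s`, implemented by the diagonal unitary. -/
def translate {d : ℕ} (s : Fin d → ℝ) (a : HSpace d →L[ℂ] HSpace d) : HSpace d →L[ℂ] HSpace d :=
  toOperator (diagUnitary s) * a * toOperator (diagUnitary s).symm

theorem norm_translate {d : ℕ} (s : Fin d → ℝ) (a : HSpace d →L[ℂ] HSpace d) :
    ‖translate s a‖ = ‖a‖ := by
  refine le_antisymm ?_ ?_
  · refine ContinuousLinearMap.opNorm_le_bound _ (norm_nonneg _) fun f => ?_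
    change ‖diagUnitary s (a ((diagUnitary s).symm f))‖ ≤ _
    rw [LinearIsometryEquiv.norm_map, ← LinearIsometryEquiv.norm_map (diagUnitary s).symm f]
    exact a.le_opNorm _
  · refine ContinuousLinearMap.opNorm_le_bound _ (norm_nonneg _) fun f => ?_
    have := (translate s a).le_opNorm (diagUnitary s f)
    change ‖diagUnitary s (a ((diagUnitary s).symm (diagUnitary s f)))‖ ≤ _ at this
    simpa using this

theorem trace_translate {d : ℕ} (s : Fin d → ℝ) (a : HSpace d →L[ℂ] HSpace d) :
    trace (translate s a) = trace a := by
  change inner ℂ _ (diagUnitary s (a ((diagUnitary s).symm (basisVec 0)))) = _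
  rw [diagUnitary_symm_basisVec_zero]
  nth_rewrite 1 [← diagUnitary_basisVec_zero s]
  rw [LinearIsometryEquiv.inner_map_map]
  rfl

theorem absPow_translate {d : ℕ} (s : Fin d → ℝ) (a : HSpace d →L[ℂ] HSpace d) {r : ℝ}
    (hr : 0 ≤ r) : absPow (translate s a) r = translate s (absPow a r) :=
  absPow_conjHom _ a hr

theorem opLpNorm_translate {d : ℕ} (p : ℝ≥0∞) (s : Fin d → ℝ) (a : HSpace d →L[ℂ] HSpace d) :
    opLpNorm p (translate s a) = opLpNorm p a := by
  unfold opLpNorm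
  split_ifs
  · exact norm_translate s a
  · rw [absPow_translate s a ENNReal.toReal_nonneg, trace_translate]

theorem translate_gen {d : ℕ} (θ : Matrix (Fin d) (Fin d) ℝ) (s : Fin d → ℝ) (j : Fin d)
    (f : HSpace d) : diagUnitary s (gen θ j f)
      = (character s (Pi.single j 1) : ℂ) • gen θ j (diagUnitary s f) := by
  ext n
  simp only [diagUnitary_apply, gen, weightedPerm_apply, lp.coeFn_smul, Pi.smul_apply, smul_eq_mul,
    Equiv.subRight_apply]
  have : character s n = character s (Pi.single j 1) * character s (n - Pi.single j 1) := by
    rw [← character_add, add_sub_cancel]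
  rw [this, Circle.coe_mul]
  ring

/-- Conjugating a generator by the diagonal unitary only multiplies it by a scalar, so the commutant
of the generators is invariant under the inverse conjugation. -/
theorem translate_mem {d : ℕ} {θ : Matrix (Fin d) (Fin d) ℝ} (s : Fin d → ℝ)
    {a : HSpace d →L[ℂ] HSpace d} (ha : a ∈ torusAlgebra θ) : translate s a ∈ torusAlgebra θ := by
  rw [mem_torusAlgebra_iff] at ha ⊢
  intro c hc
  have key : ∀ j, Commute (toOperator (gen θ j))
      (toOperator (diagUnitary s).symm * c * toOperator (diagUnitary s)) := by
    intro j
    ext1 f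
    change gen θ j ((diagUnitary s).symm (c (diagUnitary s f)))
      = (diagUnitary s).symm (c (diagUnitary s (gen θ j f)))
    rw [translate_gen, LinearIsometryEquiv.eq_symm_apply, translate_gen,
      LinearIsometryEquiv.apply_symm_apply, map_smul]
    congr 1
    exact DFunLike.congr_fun (hc j).1.eq _
  have h := ha _ fun j => ⟨key j, commute_toOperator_symm (key j)⟩
  have h' := congrArg
    (fun z => toOperator (diagUnitary s) * z * toOperator (diagUnitary s).symm) h
  have e1 := toOperator_mul_symm (diagUnitary s)
  simp only [mul_assoc, e1, mul_one] at h'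
  simp only [← mul_assoc, e1, one_mul] at h'
  simpa only [translate, mul_assoc] using h'

theorem translate_basisVec_zero {d : ℕ} (s : Fin d → ℝ) (a : HSpace d →L[ℂ] HSpace d)
    (n : Fin d → ℤ) : translate s a (basisVec 0) n = (character s n : ℂ) * a (basisVec 0) n := by
  change diagUnitary s (a ((diagUnitary s).symm (basisVec 0))) n = _
  rw [diagUnitary_symm_basisVec_zero, diagUnitary_apply]

theorem translate_sub {d : ℕ} (s : Fin d → ℝ) (a b : HSpace d →L[ℂ] HSpace d) :
    translate s (a - b) = translate s a - translate s b := map_sub (conjHom (diagUnitary s)) a b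

theorem translate_star {d : ℕ} (s : Fin d → ℝ) (a : HSpace d →L[ℂ] HSpace d) :
    translate s (star a) = star (translate s a) := map_star (conjHom (diagUnitary s)) a

theorem trace_translate_mul {d : ℕ} (s : Fin d → ℝ) (a b : HSpace d →L[ℂ] HSpace d) :
    HasSum (fun n => (character s (-n) : ℂ) *
      ((starRingEnd ℂ) ((star a) (basisVec 0) n) * b (basisVec 0) n))
      (trace (translate s a * b)) := by
  convert hasSum_trace_mul (translate s a) b using 2 with n
  rw [← translate_star, translate_basisVec_zero, map_mul, ← Circle.coe_inv_eq_conj,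
    ← character_neg, mul_assoc]

/-! ### Partitions of unity adapted to two functions -/

/-- On `[0, R]` two continuous functions are approximated by their values at finitely many points,
through a continuous partition of unity. -/
theorem exists_partition_approx {R ε : ℝ} (hR : 0 < R) (hε : 0 < ε) {f g : ℝ → ℝ}
    (hf : Continuous f) (hg : Continuous g) :
    ∃ (n : ℕ) (s : Fin n → ℝ) (h : Fin n → ℝ → ℝ), (∀ k, 0 ≤ s k) ∧ (∀ k, Continuous (h k)) ∧
      (∀ k, ∀ x ∈ Set.Icc 0 R, 0 ≤ h k x) ∧ (∀ x ∈ Set.Icc 0 R, ∑ k, h k x = 1) ∧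
      (∀ x ∈ Set.Icc 0 R, |∑ k, f (s k) * h k x - f x| ≤ ε) ∧
      (∀ x ∈ Set.Icc 0 R, |∑ k, g (s k) * h k x - g x| ≤ ε) := by
  -- Bernstein polynomials rescaled to [0, R] form the partition of unity; eventual approximation
  -- allows one degree to serve both functions.
  have approx : ∀ {φ : ℝ → ℝ} (hφ : Continuous φ), ∀ᶠ n : ℕ in atTop, ∀ x : unitInterval,
      |∑ k : Fin (n + 1), φ (R * (bernstein.z k : unitInterval)) * bernstein n k x
        - φ (R * x)| ≤ ε := by
    intro φ hφ
    let Φ : C(unitInterval, ℝ) := ⟨fun x => φ (R * x), by fun_prop⟩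
    have := (Metric.tendsto_nhds.mp (bernsteinApproximation_uniform Φ)) ε hε
    filter_upwards [this] with n hn x
    have h1 := (ContinuousMap.dist_apply_le_dist x).trans hn.le
    rw [Real.dist_eq, bernsteinApproximation.apply] at h1
    simpa [Φ, mul_comm] using h1
  obtain ⟨n, hn1, hn2⟩ := ((approx hf).and (approx hg)).exists
  have key : ∀ x ∈ Set.Icc 0 R, ∃ y : unitInterval, x / R = y ∧ x = R * y := fun x hx =>
    ⟨⟨x / R, div_nonneg hx.1 hR.le, (div_le_one hR).mpr hx.2⟩, rfl, by
      field_simp⟩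
  have ev : ∀ (k : Fin (n + 1)) (y : unitInterval),
      (bernsteinPolynomial ℝ n k).eval (y : ℝ) = bernstein n k y := fun k y => rfl
  refine ⟨n + 1, fun k => R * (bernstein.z k : unitInterval),
    fun k x => (bernsteinPolynomial ℝ n k).eval (x / R), fun k => ?_, fun k => ?_, ?_, ?_, ?_, ?_⟩
  · exact mul_nonneg hR.le (bernstein.z k).2.1
  · exact (Polynomial.continuous _).comp (continuous_id.div_const R)
  all_goals
    intros
    rename_i x hx
    obtain ⟨y, hy, hy'⟩ := key x hx
    simp only [hy, ev]
  · exact bernstein_nonneg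
  · exact bernstein.probability n y
  · rw [hy']
    exact hn1 y
  · rw [hy']
    exact hn2 y

section TracialState

variable {H : Type*} [NormedAddCommGroup H] [InnerProductSpace ℂ H] {ω : H}

/-- The vector functional `a ↦ ⟨ω, a ω⟩`. -/
def vecState (ω : H) (a : H →L[ℂ] H) : ℂ := inner ℂ ω (a ω)

theorem vecState_add (a b : H →L[ℂ] H) : vecState ω (a + b) = vecState ω a + vecState ω b := by
  simp [vecState]

theorem vecState_sub (a b : H →L[ℂ] H) : vecState ω (a - b) = vecState ω a - vecState ω b := by
  simp [vecState]

theorem vecState_smul (c : ℂ) (a : H →L[ℂ] H) : vecState ω (c • a) = c * vecState ω a := by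
  simp [vecState]

theorem vecState_real_smul (c : ℝ) (a : H →L[ℂ] H) :
    (vecState ω (c • a)).re = c * (vecState ω a).re := by
  rw [show c • a = (c : ℂ) • a from (Complex.coe_smul c a).symm, vecState_smul]
  simp

theorem vecState_sum {ι : Type*} (s : Finset ι) (a : ι → H →L[ℂ] H) :
    vecState ω (∑ i ∈ s, a i) = ∑ i ∈ s, vecState ω (a i) := by
  simp [vecState]

theorem norm_vecState_le (hω : ‖ω‖ = 1) (a : H →L[ℂ] H) : ‖vecState ω a‖ ≤ ‖a‖ := by
  refine (norm_inner_le_norm _ _).trans ?_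
  have := a.le_opNorm ω
  rw [hω] at this ⊢
  linarith

theorem re_vecState_le (hω : ‖ω‖ = 1) (a : H →L[ℂ] H) : (vecState ω a).re ≤ ‖a‖ :=
  ((Complex.re_le_norm _).trans (norm_vecState_le hω a))

theorem re_vecState_nonneg {a : H →L[ℂ] H} (ha : 0 ≤ a) : 0 ≤ (vecState ω a).re :=
  ((ContinuousLinearMap.nonneg_iff_isPositive a).mp ha).re_inner_nonneg_right ω

variable [CompleteSpace H]

/-! ### Von Neumann algebras with a tracial vector state -/

/-- By the bicommutant property, anything built from `a` and its adjoint so naturally that it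
inherits their commutation relations stays in `M`. Functional calculus, absolute values and roots
are all of this kind. -/
theorem mem_of_commute {M : VonNeumannAlgebra H} {a b : H →L[ℂ] H} (ha : a ∈ M)
    (h : ∀ c : H →L[ℂ] H, Commute a c → Commute (star a) c → Commute b c) : b ∈ M := by
  rw [← VonNeumannAlgebra.commutant_commutant M, VonNeumannAlgebra.mem_commutant_iff]
  intro c hc
  rw [VonNeumannAlgebra.mem_commutant_iff] at hc
  exact (h c (hc a ha) (hc _ (star_mem ha))).eq.symm

theorem cfc_mem_vonNeumann {M : VonNeumannAlgebra H} {a : H →L[ℂ] H} (ha : a ∈ M) (f : ℝ → ℝ) :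
    cfc f a ∈ M :=
  mem_of_commute ha fun _ h _ => h.cfc_real f

theorem abs_mem_vonNeumann {M : VonNeumannAlgebra H} {a : H →L[ℂ] H} (ha : a ∈ M) :
    CFC.abs a ∈ M :=
  mem_of_commute ha fun _ h h' => h.cfcAbs_left (commute_star_comm.mp h')

theorem sqrt_mem_vonNeumann {M : VonNeumannAlgebra H} {a : H →L[ℂ] H} (ha : a ∈ M)
    (h0 : 0 ≤ a) : CFC.sqrt a ∈ M := by
  rw [CFC.sqrt_eq_real_sqrt a h0, cfcₙ_eq_cfc]
  exact cfc_mem_vonNeumann ha _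

theorem smul_mem_vonNeumann {M : VonNeumannAlgebra H} {a : H →L[ℂ] H} (c : ℂ) (ha : a ∈ M) :
    c • a ∈ M :=
  M.toStarSubalgebra.smul_mem ha c

theorem vecState_mul (a b : H →L[ℂ] H) :
    vecState ω (a * b) = inner ℂ ((star a) ω) (b ω) := by
  rw [vecState, ContinuousLinearMap.star_eq_adjoint, ContinuousLinearMap.adjoint_inner_left]
  rfl

variable {M : VonNeumannAlgebra H}

/-- The vector `ω` is a unit vector whose vector functional is tracial on `M`. -/
structure IsTracialVector (M : VonNeumannAlgebra H) (ω : H) : Prop where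
  norm_eq_one : ‖ω‖ = 1
  mul_comm : ∀ a ∈ M, ∀ b ∈ M, vecState ω (a * b) = vecState ω (b * a)



end TracialState

/-! ### Young's inequality and duality for the trace -/

section TracialState

variable {H : Type*} [NormedAddCommGroup H] [InnerProductSpace ℂ H] [CompleteSpace H] {ω : H}
  {M : VonNeumannAlgebra H}

/-- By traciality τ(ha) = τ(√h a √h), the trace of a positive operator, although `h * a` itself need
not be positive. -/
theorem IsTracialVector.re_mul_nonneg (hω : IsTracialVector M ω) {h a : H →L[ℂ] H} (hM : h ∈ M)
    (aM : a ∈ M) (h0 : 0 ≤ h) (a0 : 0 ≤ a) : 0 ≤ (vecState ω (h * a)).re := by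
  have sM := sqrt_mem_vonNeumann hM h0
  have s0 := CFC.sqrt_nonneg h
  rw [← CFC.sqrt_mul_sqrt_self h h0, mul_assoc, hω.mul_comm _ sM _ (mul_mem sM aM)]
  exact re_vecState_nonneg (conjugate_nonneg_of_nonneg a0 s0)

theorem IsTracialVector.re_mul_mono (hω : IsTracialVector M ω) {h a b : H →L[ℂ] H} (hM : h ∈ M)
    (aM : a ∈ M) (bM : b ∈ M) (h0 : 0 ≤ h) (hab : a ≤ b) :
    (vecState ω (h * a)).re ≤ (vecState ω (h * b)).re := by
  have := hω.re_mul_nonneg hM (sub_mem bM aM) h0 (sub_nonneg.mpr hab)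
  rwa [mul_sub, vecState_sub, Complex.sub_re, sub_nonneg] at this

theorem star_mul_self_le_one {u : H →L[ℂ] H} (hu : ‖u‖ ≤ 1) : star u * u ≤ 1 := by
  refine (CStarAlgebra.norm_le_one_iff_of_nonneg _ (star_mul_self_nonneg u)).mp ?_
  rw [CStarRing.norm_star_mul_self]
  nlinarith [norm_nonneg u]

theorem mul_star_self_le_one {u : H →L[ℂ] H} (hu : ‖u‖ ≤ 1) : u * star u ≤ 1 := by
  have := star_mul_self_le_one (u := star u) (by rwa [norm_star])
  rwa [star_star] at this

/-- The Cauchy–Schwarz inequality in the form `|τ(a u b)| ≤ (τ(a b) + τ(a u b u^*)) / 2`. -/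
theorem IsTracialVector.norm_mul_mul_le (hω : IsTracialVector M ω) {a u b : H →L[ℂ] H} (aM : a ∈ M)
    (uM : u ∈ M) (bM : b ∈ M) (a0 : 0 ≤ a) (b0 : 0 ≤ b) :
    ‖vecState ω (a * u * b)‖
      ≤ ((vecState ω (a * b)).re + (vecState ω (a * (u * b * star u))).re) / 2 := by
  set r := CFC.sqrt a with hr
  set s := CFC.sqrt b with hs
  have rM : r ∈ M := sqrt_mem_vonNeumann aM a0
  have sM : s ∈ M := sqrt_mem_vonNeumann bM b0
  have rr : r * r = a := CFC.sqrt_mul_sqrt_self a a0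
  have ss : s * s = b := CFC.sqrt_mul_sqrt_self b b0
  have rs : star r = r := (CFC.sqrt_nonneg a).isSelfAdjoint
  have sst : star s = s := (CFC.sqrt_nonneg b).isSelfAdjoint
  have nsq : ∀ x : H →L[ℂ] H, ‖x ω‖ ^ 2 = (vecState ω (star x * x)).re := fun x => by
    rw [vecState_mul, star_star, inner_self_eq_norm_sq_to_K]
    norm_cast
  -- With r = √a and s = √b, moving one factor s cyclically gives τ(a u b) = ⟨(rs)ω, (rus)ω⟩.
  -- Cauchy–Schwarz and 2xy ≤ x² + y² then finish.
  have e1 : vecState ω (a * u * b) = inner ℂ ((r * s) ω) ((r * u * s) ω) := by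
    rw [← rr, ← ss, ← mul_assoc, hω.mul_comm (r * r * u * s) (by
      exact mul_mem (mul_mem (mul_mem rM rM) uM) sM) s sM,
      show s * (r * r * u * s) = (s * r) * (r * u * s) by simp only [mul_assoc], vecState_mul,
      star_mul, rs, sst]
  have e2 : ‖(r * s) ω‖ ^ 2 = (vecState ω (a * b)).re := by
    rw [nsq, star_mul, rs, sst, show s * r * (r * s) = s * (r * r * s) by simp only [mul_assoc],
      rr, hω.mul_comm s sM _ (mul_mem aM sM), mul_assoc, ss]
  have e3 : ‖(r * u * s) ω‖ ^ 2 = (vecState ω (a * (u * b * star u))).re := by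
    rw [nsq, star_mul, star_mul, rs, sst,
      show s * (star u * r) * (r * u * s) = (s * star u) * (r * r * u * s) by
        simp only [mul_assoc], rr,
      hω.mul_comm _ (mul_mem sM (star_mem uM)) _ (mul_mem (mul_mem aM uM) sM), ← ss]
    simp only [mul_assoc]
  rw [e1, ← e2, ← e3]
  refine (norm_inner_le_norm _ _).trans ?_
  nlinarith [sq_nonneg (‖(r * s) ω‖ - ‖(r * u * s) ω‖)]

theorem spectrum_subset_Icc {A : H →L[ℂ] H} (hA : 0 ≤ A) {R : ℝ} (hR : ‖A‖ ≤ R) :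
    ∀ x ∈ spectrum ℝ A, x ∈ Set.Icc 0 R := fun x hx =>
  ⟨spectrum_nonneg_of_nonneg hA hx, (le_abs_self x).trans (by
    have h1 := spectrum.norm_le_norm_mul_of_mem hx
    have h2 : ‖(1 : H →L[ℂ] H)‖ ≤ 1 := ContinuousLinearMap.norm_id_le
    rw [Real.norm_eq_abs] at h1
    nlinarith [norm_nonneg A])⟩

/-- The scalar inequality of Young in the form `s^{p-1} t ≤ ((p - 1) s^p + t^p) / p`. -/
theorem rpow_sub_one_mul_le {p s t : ℝ} (hp : 1 ≤ p) (hs : 0 ≤ s) (ht : 0 ≤ t) :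
    s ^ (p - 1) * t ≤ ((p - 1) * s ^ p + t ^ p) / p := by
  rcases eq_or_lt_of_le hp with rfl | hp'
  · simp
  · have hq : (p / (p - 1)).HolderConjugate p := (Real.HolderConjugate.conjExponent hp').symm
    have h := Real.young_inequality_of_nonneg (Real.rpow_nonneg hs (p - 1)) ht hq
    rw [← Real.rpow_mul hs, mul_div_cancel₀ _ (by linarith : p - 1 ≠ 0)] at h
    refine h.trans (le_of_eq ?_)
    have : p - 1 ≠ 0 := by linarith
    field_simp

theorem real_smul_mem_vonNeumann {a : H →L[ℂ] H} (c : ℝ) (ha : a ∈ M) : c • a ∈ M := by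
  rw [← Complex.coe_smul]
  exact smul_mem_vonNeumann _ ha

/-- The operator form of Young's inequality with a scalar, conjugated by a contraction. -/
theorem rpow_smul_conj_le {p s : ℝ} (hp : 1 ≤ p) (hs : 0 ≤ s) {B u : H →L[ℂ] H} (B0 : 0 ≤ B)
    (hu : ‖u‖ ≤ 1) : s ^ (p - 1) • (u * B * star u)
      ≤ ((p - 1) / p * s ^ p) • (1 : H →L[ℂ] H)
        + (1 / p) • (u * cfc (fun x : ℝ => x ^ p) B * star u) := by
  have p0 : 0 < p := by linarith
  have cg : Continuous fun x : ℝ => x ^ p := Real.continuous_rpow_const p0.le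
  have hle : s ^ (p - 1) • B ≤ ((p - 1) / p * s ^ p) • (1 : H →L[ℂ] H)
      + (1 / p) • cfc (fun x : ℝ => x ^ p) B := by
    have e1 : s ^ (p - 1) • B = cfc (fun x : ℝ => s ^ (p - 1) * x) B :=
      (cfc_const_mul_id _ _ B0.isSelfAdjoint).symm
    have e2 : ((p - 1) / p * s ^ p) • (1 : H →L[ℂ] H) + (1 / p) • cfc (fun x : ℝ => x ^ p) B
        = cfc (fun x : ℝ => (p - 1) / p * s ^ p + 1 / p * x ^ p) B := by
      rw [cfc_const_add ((p - 1) / p * s ^ p) (fun x : ℝ => 1 / p * x ^ p) B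
        (continuous_const.mul cg).continuousOn B0.isSelfAdjoint,
        cfc_const_mul _ _ _ cg.continuousOn, Algebra.algebraMap_eq_smul_one]
    rw [e1, e2]
    refine cfc_mono (fun x hx => ?_) (continuous_const.mul continuous_id).continuousOn
      (continuous_const.add (continuous_const.mul cg)).continuousOn
    refine (rpow_sub_one_mul_le hp hs (spectrum_nonneg_of_nonneg B0 hx)).trans (le_of_eq ?_)
    field_simp
  have h2 := star_right_conjugate_le_conjugate hle u
  -- Conjugating the scalar term leaves a nonnegative multiple of u u^*, which is at most 1.
  have h3 : ((p - 1) / p * s ^ p) • (u * star u) ≤ ((p - 1) / p * s ^ p) • (1 : H →L[ℂ] H) :=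
    smul_le_smul_of_nonneg_left (mul_star_self_le_one hu)
      (mul_nonneg (div_nonneg (by linarith) p0.le) (Real.rpow_nonneg hs p))
  rw [mul_smul_comm, smul_mul_assoc, mul_add, add_mul, mul_smul_comm, smul_mul_assoc, mul_one,
    mul_smul_comm, smul_mul_assoc] at h2
  exact h2.trans (add_le_add_left h3 _)

theorem norm_sum_smul_cfc_sub_le {R ε : ℝ} (hε : 0 ≤ ε) {A : H →L[ℂ] H}
    (spec : ∀ x ∈ spectrum ℝ A, x ∈ Set.Icc 0 R) {n : ℕ} {c : Fin n → ℝ} {h : Fin n → ℝ → ℝ}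
    (hc : ∀ k, Continuous (h k)) {φ : ℝ → ℝ} (hφ : Continuous φ)
    (happ : ∀ x ∈ Set.Icc 0 R, |∑ k, c k * h k x - φ x| ≤ ε) :
    ‖(∑ k, c k • cfc (h k) A) - cfc φ A‖ ≤ ε := by
  have e : (∑ k, c k • cfc (h k) A) - cfc φ A
      = cfc (fun x => ∑ k, c k * h k x - φ x) A := by
    rw [cfc_sub (fun x => ∑ k, c k * h k x) φ A
      (continuous_finsetSum _ fun k _ => continuous_const.mul (hc k)).continuousOn
      hφ.continuousOn]
    congr 1
    have := cfc_sum_univ (fun k x => c k * h k x) A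
      fun k => (continuous_const.mul (hc k)).continuousOn
    rw [show (fun x => ∑ k, c k * h k x) = ∑ k, fun x => c k * h k x by
      ext x; simp, this]
    refine Finset.sum_congr rfl fun k _ => ?_
    rw [cfc_const_mul _ _ _ (hc k).continuousOn]
  rw [e]
  exact norm_cfc_le hε fun x hx => happ x (spec x hx)

/-- The trace form of Young's inequality for positive operators, with a contraction. -/
theorem IsTracialVector.re_rpow_mul_conj_le (hω : IsTracialVector M ω) {p : ℝ} (hp : 1 ≤ p)
    {A B u : H →L[ℂ] H} (AM : A ∈ M) (BM : B ∈ M) (uM : u ∈ M) (A0 : 0 ≤ A) (B0 : 0 ≤ B)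
    (hu : ‖u‖ ≤ 1) :
    (vecState ω (cfc (fun x : ℝ => x ^ (p - 1)) A * (u * B * star u))).re
      ≤ ((p - 1) * (vecState ω (cfc (fun x : ℝ => x ^ p) A)).re
        + (vecState ω (cfc (fun x : ℝ => x ^ p) B)).re) / p := by
  have p0 : 0 < p := by linarith
  have cf : Continuous fun x : ℝ => x ^ (p - 1) := Real.continuous_rpow_const (by linarith)
  have cg : Continuous fun x : ℝ => x ^ p := Real.continuous_rpow_const p0.le
  set X := u * B * star u with hX
  set R : ℝ := ‖A‖ + 1 with hR
  have spec := spectrum_subset_Icc A0 (show ‖A‖ ≤ R by linarith)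
  have specB := fun x hx => (spectrum_subset_Icc B0 le_rfl x hx).1
  have suM := star_mem uM
  have XM : X ∈ M := mul_mem (mul_mem uM BM) suM
  have BpM : cfc (fun x : ℝ => x ^ p) B ∈ M := cfc_mem_vonNeumann BM _
  have Bp0 : 0 ≤ cfc (fun x : ℝ => x ^ p) B :=
    cfc_nonneg fun x hx => Real.rpow_nonneg (specB x hx) p
  refine le_of_forall_pos_le_add fun η hη => ?_
  -- The two approximation errors are at most ε‖X‖ and pε, which add up to η.
  set ε := η / (‖X‖ + p) with hε
  have ε0 : 0 < ε := div_pos hη (by positivity)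
  -- `A` and `B` need not commute, so `A` is replaced by the scalars s_k weighted by positive
  -- operators h_k(A) of sum 1. Young's inequality is then needed only between a scalar and `B`.
  obtain ⟨n, s, h, s0, hc, h0, h1, hf, hg⟩ := exists_partition_approx (by positivity : 0 < R)
    ε0 cf cg
  set h' : Fin n → H →L[ℂ] H := fun k => cfc (h k) A with hh'
  have hM : ∀ k, h' k ∈ M := fun k => cfc_mem_vonNeumann AM _
  have h'0 : ∀ k, 0 ≤ h' k := fun k => cfc_nonneg fun x hx => h0 k x (spec x hx)
  have hsum : ∑ k, h' k = 1 := by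
    rw [← cfc_sum_univ h A fun k => (hc k).continuousOn, ← cfc_one ℝ A]
    refine cfc_congr fun x hx => ?_
    rw [Finset.sum_apply]
    exact h1 x (spec x hx)
  have nf := norm_sum_smul_cfc_sub_le ε0.le spec hc cf hf
  have ng := norm_sum_smul_cfc_sub_le ε0.le spec hc cg hg
  have term : ∀ k, s k ^ (p - 1) * (vecState ω (h' k * X)).re
      ≤ (p - 1) / p * (s k ^ p * (vecState ω (h' k)).re)
        + 1 / p * (vecState ω (h' k * (u * cfc (fun x : ℝ => x ^ p) B * star u))).re := by
    intro k
    have := hω.re_mul_mono (hM k) (real_smul_mem_vonNeumann (s k ^ (p - 1)) XM)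
      (add_mem (real_smul_mem_vonNeumann ((p - 1) / p * s k ^ p) (one_mem M))
        (real_smul_mem_vonNeumann (1 / p) (mul_mem (mul_mem uM BpM) suM)))
      (h'0 k) (rpow_smul_conj_le hp (s0 k) B0 hu)
    rw [mul_add, mul_smul_comm, mul_smul_comm, mul_smul_comm, mul_one, vecState_add,
      Complex.add_re, vecState_real_smul, vecState_real_smul, vecState_real_smul] at this
    linarith
  have total := Finset.sum_le_sum fun k (_ : k ∈ Finset.univ) => term k
  rw [Finset.sum_add_distrib, ← Finset.mul_sum, ← Finset.mul_sum, ← Complex.re_sum, ← vecState_sum,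
    ← Finset.sum_mul, hsum, one_mul] at total
  have t1 : ∑ k, s k ^ (p - 1) * (vecState ω (h' k * X)).re
      = (vecState ω ((∑ k, s k ^ (p - 1) • h' k) * X)).re := by
    rw [Finset.sum_mul, vecState_sum, Complex.re_sum]
    refine Finset.sum_congr rfl fun k _ => ?_
    rw [smul_mul_assoc, vecState_real_smul]
  have t2 : ∑ k, s k ^ p * (vecState ω (h' k)).re
      = (vecState ω (∑ k, s k ^ p • h' k)).re := by
    rw [vecState_sum, Complex.re_sum]
    refine Finset.sum_congr rfl fun k _ => ?_
    rw [vecState_real_smul]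
  rw [t1, t2] at total
  have b1 : (vecState ω (cfc (fun x : ℝ => x ^ (p - 1)) A * X)).re
      - (vecState ω ((∑ k, s k ^ (p - 1) • h' k) * X)).re ≤ ε * ‖X‖ := by
    rw [← Complex.sub_re, ← vecState_sub, ← sub_mul]
    refine (re_vecState_le hω.norm_eq_one _).trans ((norm_mul_le _ _).trans ?_)
    rw [norm_sub_rev]
    gcongr
  have b2 : (vecState ω (∑ k, s k ^ p • h' k)).re
      - (vecState ω (cfc (fun x : ℝ => x ^ p) A)).re ≤ ε := by
    rw [← Complex.sub_re, ← vecState_sub]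
    exact (re_vecState_le hω.norm_eq_one _).trans ng
  -- By traciality τ(u B^p u^*) = τ(B^p u^* u), and u^* u ≤ 1.
  have b3 : (vecState ω (u * cfc (fun x : ℝ => x ^ p) B * star u)).re
      ≤ (vecState ω (cfc (fun x : ℝ => x ^ p) B)).re := by
    rw [mul_assoc, hω.mul_comm u uM _ (mul_mem BpM suM), mul_assoc]
    have := hω.re_mul_mono BpM (mul_mem suM uM) (one_mem M) Bp0 (star_mul_self_le_one hu)
    rwa [mul_one] at this
  have b4 : (p - 1) / p * ε ≤ p * ε :=
    mul_le_mul_of_nonneg_right ((div_le_self (by linarith) hp).trans (by linarith)) ε0.le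
  have b5 : ε * ‖X‖ + p * ε = η := by
    rw [hε]
    field_simp
  have b6 : (p - 1) / p * (vecState ω (∑ k, s k ^ p • h' k)).re
      ≤ (p - 1) / p * ((vecState ω (cfc (fun x : ℝ => x ^ p) A)).re + ε) :=
    mul_le_mul_of_nonneg_left (by linarith) (div_nonneg (by linarith) p0.le)
  have b7 := mul_le_mul_of_nonneg_left b3 (show 0 ≤ 1 / p by positivity)
  have b8 : ((p - 1) * (vecState ω (cfc (fun x : ℝ => x ^ p) A)).re
        + (vecState ω (cfc (fun x : ℝ => x ^ p) B)).re) / p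
      = (p - 1) / p * (vecState ω (cfc (fun x : ℝ => x ^ p) A)).re
        + 1 / p * (vecState ω (cfc (fun x : ℝ => x ^ p) B)).re := by ring
  rw [b8]
  linarith

/-- Young's inequality for the trace: `|τ(A^{p-1} u B)| ≤ ((p - 1) τ(A^p) + τ(B^p)) / p`. -/
theorem IsTracialVector.norm_rpow_mul_le (hω : IsTracialVector M ω) {p : ℝ} (hp : 1 ≤ p)
    {A B u : H →L[ℂ] H} (AM : A ∈ M) (BM : B ∈ M) (uM : u ∈ M) (A0 : 0 ≤ A) (B0 : 0 ≤ B)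
    (hu : ‖u‖ ≤ 1) :
    ‖vecState ω (cfc (fun x : ℝ => x ^ (p - 1)) A * u * B)‖
      ≤ ((p - 1) * (vecState ω (cfc (fun x : ℝ => x ^ p) A)).re
        + (vecState ω (cfc (fun x : ℝ => x ^ p) B)).re) / p := by
  have A'0 : 0 ≤ cfc (fun x : ℝ => x ^ (p - 1)) A :=
    cfc_nonneg fun x hx => Real.rpow_nonneg (spectrum_nonneg_of_nonneg A0 hx) _
  -- The Cauchy–Schwarz bound is the mean of the quantities belonging to the contractions 1 and `u`;
  -- both have the same Young bound.
  have h1 := hω.norm_mul_mul_le (cfc_mem_vonNeumann AM fun x : ℝ => x ^ (p - 1)) uM BM A'0 B0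
  have h2 := hω.re_rpow_mul_conj_le hp AM BM uM A0 B0 hu
  have h3 := hω.re_rpow_mul_conj_le hp AM BM (one_mem M) A0 B0 ContinuousLinearMap.norm_id_le
  rw [star_one, one_mul, mul_one] at h3
  linarith

end TracialState

/-! ### Approximate polar decomposition, Hölder duality and Minkowski's inequality. -/

section TracialState

variable {H : Type*} [NormedAddCommGroup H] [InnerProductSpace ℂ H] [CompleteSpace H] {ω : H}
  {M : VonNeumannAlgebra H}

theorem absPow_eq_cfc (a : H →L[ℂ] H) (p : ℝ) :
    absPow a p = cfc (fun x : ℝ => x ^ p) (CFC.abs a) := CFC.rpow_eq_cfc_real (CFC.abs_nonneg a)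

theorem absPow_nonneg (a : H →L[ℂ] H) (p : ℝ) : 0 ≤ absPow a p := CFC.rpow_nonneg

theorem absPow_smul (c : ℂ) (a : H →L[ℂ] H) {p : ℝ} (hp : 0 ≤ p) :
    absPow (c • a) p = (‖c‖ ^ p) • absPow a p := by
  have cp : Continuous fun x : ℝ => x ^ p := Real.continuous_rpow_const hp
  have h0 := CFC.abs_nonneg a
  rw [absPow_eq_cfc, absPow_eq_cfc, CFC.abs_smul, ← cfc_const_mul _ _ _ cp.continuousOn,
    ← cfc_const_mul_id ‖c‖ (CFC.abs a) h0.isSelfAdjoint,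
    ← cfc_comp' (fun x : ℝ => x ^ p) (fun x => ‖c‖ * x) (CFC.abs a) cp.continuousOn
      (continuous_const.mul continuous_id).continuousOn h0.isSelfAdjoint]
  refine cfc_congr fun x hx => ?_
  exact Real.mul_rpow (norm_nonneg c) (spectrum_nonneg_of_nonneg h0 hx)

/-- The C*-identity sees only (ac)^*(ac) = c^*|a|²c. Norm estimates with `b` thereby reduce to
functional calculus of |b|. -/
theorem norm_mul_eq_norm_abs_mul (a c : H →L[ℂ] H) : ‖a * c‖ = ‖CFC.abs a * c‖ := by
  have h : star (a * c) * (a * c) = star (CFC.abs a * c) * (CFC.abs a * c) := by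
    rw [star_mul, star_mul, (CFC.abs_nonneg a).isSelfAdjoint.star_eq,
      show star c * CFC.abs a * (CFC.abs a * c) = star c * (CFC.abs a * CFC.abs a) * c by
        simp only [mul_assoc], CFC.abs_mul_abs]
    simp only [mul_assoc]
  have h1 := CStarRing.norm_star_mul_self (x := a * c)
  have h2 := CStarRing.norm_star_mul_self (x := CFC.abs a * c)
  rw [h] at h1
  nlinarith [norm_nonneg (a * c), norm_nonneg (CFC.abs a * c)]

/-- An approximate polar decomposition inside the von Neumann algebra. -/
theorem exists_approx_polar {b : H →L[ℂ] H} (bM : b ∈ M) {δ : ℝ} (hδ : 0 < δ) :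
    ∃ w ∈ M, ‖w‖ ≤ 1 ∧ ‖w * CFC.abs b - b‖ ≤ δ ∧ ‖star w * b - CFC.abs b‖ ≤ δ := by
  set B := CFC.abs b with hB
  have B0 : 0 ≤ B := CFC.abs_nonneg b
  have spec : ∀ x ∈ spectrum ℝ B, 0 ≤ x := fun x hx => spectrum_nonneg_of_nonneg B0 hx
  -- The approximate polar part is b(|b| + δ)^{-1}. Its defect is governed by xδ/(x + δ) ≤ δ on the
  -- spectrum; the absolute value makes `g` continuous on the whole line.
  set g : ℝ → ℝ := fun x => (|x| + δ)⁻¹ with hg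
  have pos : ∀ x : ℝ, 0 < |x| + δ := fun x => by positivity
  have cg : Continuous g := (continuous_abs.add continuous_const).inv₀ fun x => (pos x).ne'
  have c1 : Continuous fun x : ℝ => x * g x := continuous_id.mul cg
  have gs : star (cfc g B) = cfc g B := (cfc_predicate g B : IsSelfAdjoint _).star_eq
  have idB : cfc (fun x : ℝ => x) B = B := cfc_id' ℝ B B0.isSelfAdjoint
  have gB : cfc (fun x : ℝ => g x * x) B = cfc g B * B := by
    rw [cfc_mul g (fun x => x) B cg.continuousOn continuous_id.continuousOn, idB]
  have Bg : cfc (fun x : ℝ => x * g x) B = B * cfc g B := by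
    rw [cfc_mul (fun x => x) g B continuous_id.continuousOn cg.continuousOn, idB]
  have key : ∀ x ∈ spectrum ℝ B, 0 ≤ x * (1 - g x * x) ∧ x * (1 - g x * x) ≤ δ := by
    intro x hx
    have hx0 := spec x hx
    have e : x * (1 - g x * x) = δ * (x / (x + δ)) := by
      have : x + δ ≠ 0 := by positivity
      simp only [hg, abs_of_nonneg hx0]
      field_simp
      ring
    rw [e]
    have : x / (x + δ) ≤ 1 := (div_le_one (by positivity)).mpr (by linarith)
    exact ⟨by positivity, by nlinarith⟩
  have c2 : Continuous fun x : ℝ => g x * x := cg.mul continuous_id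
  refine ⟨b * cfc g B, mul_mem bM (cfc_mem_vonNeumann (abs_mem_vonNeumann bM) g), ?_, ?_, ?_⟩
  · rw [norm_mul_eq_norm_abs_mul, ← hB, ← Bg]
    refine norm_cfc_le zero_le_one fun x hx => ?_
    rw [Real.norm_eq_abs, abs_of_nonneg (mul_nonneg (spec x hx) (inv_nonneg.mpr (pos x).le))]
    simp only [abs_of_nonneg (spec x hx)]
    rw [← div_eq_mul_inv]
    exact (div_le_one (by linarith [spec x hx])).mpr (by linarith)
  · have e : b * cfc g B * B - b = b * -(cfc (fun x : ℝ => 1 - g x * x) B) := by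
      rw [cfc_sub (fun _ : ℝ => (1 : ℝ)) (fun x => g x * x) B continuous_const.continuousOn
        c2.continuousOn, cfc_const_one ℝ B, gB]
      noncomm_ring
    rw [e, norm_mul_eq_norm_abs_mul, ← hB, mul_neg, norm_neg]
    have e2 : B * cfc (fun x : ℝ => 1 - g x * x) B = cfc (fun x : ℝ => x * (1 - g x * x)) B := by
      rw [cfc_mul (fun x => x) (fun x : ℝ => 1 - g x * x) B continuous_id.continuousOn
        (continuous_const.sub c2).continuousOn, idB]
    rw [e2]
    refine norm_cfc_le hδ.le fun x hx => ?_
    rw [Real.norm_eq_abs, abs_of_nonneg (key x hx).1]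
    exact (key x hx).2
  · have e : star (b * cfc g B) * b - B = -cfc (fun x : ℝ => x * (1 - g x * x)) B := by
      rw [star_mul, gs, mul_assoc, ← CFC.abs_mul_abs, ← hB, ← mul_assoc, ← gB]
      have : cfc (fun x : ℝ => x * (1 - g x * x)) B
          = cfc (fun x : ℝ => x) B - cfc (fun x : ℝ => g x * x * x) B := by
        rw [← cfc_sub (fun x : ℝ => x) (fun x : ℝ => g x * x * x) B continuous_id.continuousOn
          (c2.mul continuous_id).continuousOn]
        refine cfc_congr fun x _ => ?_
        ring
      rw [this, idB, cfc_mul (fun x => g x * x) (fun x => x) B c2.continuousOn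
        continuous_id.continuousOn, idB]
      abel
    rw [e, norm_neg]
    refine norm_cfc_le hδ.le fun x hx => ?_
    rw [Real.norm_eq_abs, abs_of_nonneg (key x hx).1]
    exact (key x hx).2

/-- The norm `τ(|a|^p)^{1/p}` for the vector functional of `ω`. -/
def vecNorm (ω : H) (p : ℝ) (a : H →L[ℂ] H) : ℝ := (vecState ω (absPow a p)).re ^ (1 / p)

theorem vecNorm_nonneg (ω : H) (p : ℝ) (a : H →L[ℂ] H) : 0 ≤ vecNorm ω p a :=
  Real.rpow_nonneg (re_vecState_nonneg (absPow_nonneg a p)) _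

theorem vecNorm_smul (ω : H) {p : ℝ} (hp : 1 ≤ p) (c : ℂ) (a : H →L[ℂ] H) :
    vecNorm ω p (c • a) = ‖c‖ * vecNorm ω p a := by
  have p0 : 0 < p := by linarith
  rw [vecNorm, absPow_smul c a p0.le, vecState_real_smul, Real.mul_rpow (by positivity)
    (re_vecState_nonneg (absPow_nonneg a p)), one_div, Real.rpow_rpow_inv (norm_nonneg c) p0.ne',
    vecNorm, one_div]

/-- Hölder's inequality, in additive form, for the element `|a|^{p-1} v`. -/
theorem IsTracialVector.norm_rpow_mul_star_mul_le (hω : IsTracialVector M ω) {p : ℝ} (hp : 1 ≤ p)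
    {A b v : H →L[ℂ] H} (AM : A ∈ M) (A0 : 0 ≤ A) (bM : b ∈ M) (vM : v ∈ M) (hv : ‖v‖ ≤ 1) :
    ‖vecState ω (cfc (fun x : ℝ => x ^ (p - 1)) A * v * b)‖
      ≤ ((p - 1) * (vecState ω (cfc (fun x : ℝ => x ^ p) A)).re
        + (vecState ω (absPow b p)).re) / p := by
  refine le_of_forall_pos_le_add fun η hη => ?_
  set Q := cfc (fun x : ℝ => x ^ (p - 1)) A with hQ
  obtain ⟨w, wM, hw, hw1, -⟩ := exists_approx_polar bM
    (show 0 < η / (‖Q * v‖ + 1) by positivity)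
  have h1 := hω.norm_rpow_mul_le hp AM (abs_mem_vonNeumann bM) (mul_mem vM wM) A0
    (CFC.abs_nonneg b) ((norm_mul_le _ _).trans (mul_le_one₀ hv (norm_nonneg _) hw))
  rw [← absPow_eq_cfc, ← hQ] at h1
  have e : Q * v * b = Q * (v * w) * CFC.abs b - Q * v * (w * CFC.abs b - b) := by
    noncomm_ring
  rw [e, vecState_sub]
  refine (norm_sub_le _ _).trans (add_le_add h1 ?_)
  refine (norm_vecState_le hω.norm_eq_one _).trans ((norm_mul_le _ _).trans ?_)
  calc ‖Q * v‖ * ‖w * CFC.abs b - b‖ ≤ (‖Q * v‖ + 1) * (η / (‖Q * v‖ + 1)) := by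
        gcongr
        linarith
    _ = η := by field_simp

/-- The norm `‖a‖_p` is attained, up to `ε`, by pairing with an element of the algebra of dual norm
at most one. -/
theorem IsTracialVector.exists_dual (hω : IsTracialVector M ω) {p : ℝ} (hp : 1 ≤ p)
    {a : H →L[ℂ] H} (aM : a ∈ M) {ε : ℝ} (hε : 0 < ε) :
    ∃ y ∈ M, (∀ b ∈ M, ‖vecState ω (y * b)‖ ≤ vecNorm ω p b) ∧
      vecNorm ω p a - ε ≤ ‖vecState ω (y * a)‖ := by
  have p0 : 0 < p := by linarith
  set A := CFC.abs a with hA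
  have A0 : 0 ≤ A := CFC.abs_nonneg a
  have AM : A ∈ M := abs_mem_vonNeumann aM
  set α := (vecState ω (absPow a p)).re with hα
  have α0 : 0 ≤ α := re_vecState_nonneg (absPow_nonneg a p)
  -- If τ(|a|^p) = 0 there is nothing to normalise and y = 0 serves.
  rcases eq_or_lt_of_le α0 with hz | αpos
  · refine ⟨0, zero_mem M, fun b _ => ?_, ?_⟩
    · rw [zero_mul]
      simpa [vecState] using vecNorm_nonneg ω p b
    · rw [vecNorm, ← hα, ← hz, Real.zero_rpow (by positivity)]
      linarith [norm_nonneg (vecState ω (0 * a))]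
  set Q := cfc (fun x : ℝ => x ^ (p - 1)) A with hQ
  -- κ = ‖a‖_p^{p-1} normalises |a|^{p-1} in the dual norm, so y = κ^{-1}|a|^{p-1}w^* with w an
  -- approximate polar part of `a`.
  set κ := α ^ (1 - 1 / p) with hκ
  have κ0 : 0 < κ := Real.rpow_pos_of_pos αpos _
  have QM : Q ∈ M := cfc_mem_vonNeumann AM _
  obtain ⟨w, wM, hw, -, hw2⟩ := exists_approx_polar aM
    (show 0 < ε * κ / (‖Q‖ + 1) by positivity)
  have κα : κ * α ^ (1 / p) = α := by
    rw [hκ, ← Real.rpow_add αpos, sub_add_cancel, Real.rpow_one]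
  have swM := star_mem wM
  refine ⟨((κ⁻¹ : ℝ) : ℂ) • (Q * star w), smul_mem_vonNeumann _ (mul_mem QM swM),
    fun b bM => ?_, ?_⟩
  · rw [smul_mul_assoc, vecState_smul, norm_mul, Complex.norm_real, Real.norm_of_nonneg
      (by positivity), inv_mul_le_iff₀ κ0]
    set β := (vecState ω (absPow b p)).re with hβ
    have β0 : 0 ≤ β := re_vecState_nonneg (absPow_nonneg b p)
    -- Scaling b by c with c^p = α/γ balances the two terms of Young's inequality and makes it
    -- multiplicative. Taking γ > β avoids division by zero when β = 0; afterwards γ decreases to β.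
    have bound : ∀ γ > β, ‖vecState ω (Q * star w * b)‖ ≤ κ * γ ^ (1 / p) := by
      intro γ hγ
      have γ0 : 0 < γ := β0.trans_lt hγ
      set c : ℝ := (α / γ) ^ (1 / p) with hc
      have c0 : 0 < c := Real.rpow_pos_of_pos (by positivity) _
      have cp : c ^ p = α / γ := by
        rw [hc, one_div, Real.rpow_inv_rpow (by positivity) p0.ne']
      have h := hω.norm_rpow_mul_star_mul_le hp AM A0 (smul_mem_vonNeumann (c : ℂ) bM) swM
        (by rwa [norm_star])
      rw [absPow_smul _ _ p0.le, Complex.norm_real, Real.norm_of_nonneg c0.le, cp,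
        vecState_real_smul, mul_smul_comm, vecState_smul, norm_mul, Complex.norm_real,
        Real.norm_of_nonneg c0.le, ← hQ,
        ← absPow_eq_cfc, ← hα, ← hβ] at h
      have h2 : α / γ * β ≤ α := by
        rw [div_mul_eq_mul_div, div_le_iff₀ γ0]
        gcongr
      have h3 : c * ‖vecState ω (Q * star w * b)‖ ≤ α := by
        refine h.trans ?_
        rw [div_le_iff₀ p0]
        linarith
      have h4 : c * γ ^ (1 / p) = α ^ (1 / p) := by
        rw [hc, Real.div_rpow α0 γ0.le, div_mul_cancel₀]
        positivity
      have h5 : c * (κ * γ ^ (1 / p)) = α := by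
        rw [mul_left_comm, h4, κα]
      exact le_of_mul_le_mul_left (h3.trans h5.ge) c0
    have lim : Tendsto (fun γ : ℝ => κ * γ ^ (1 / p)) (𝓝[>] β) (𝓝 (κ * β ^ (1 / p))) :=
      ((continuous_const.mul (Real.continuous_rpow_const (by positivity))).tendsto β).mono_left
        nhdsWithin_le_nhds
    exact ge_of_tendsto lim (eventually_nhdsWithin_of_forall bound)
  · rw [smul_mul_assoc, vecState_smul, norm_mul, Complex.norm_real, Real.norm_of_nonneg
      (by positivity), vecNorm, ← hα, le_inv_mul_iff₀ κ0, mul_sub, κα]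
    have e : Q * star w * a = absPow a p + Q * (star w * a - A) := by
      have hc : Continuous fun x : ℝ => x ^ (p - 1) := Real.continuous_rpow_const (by linarith)
      have e1 : absPow a p = Q * A := by
        rw [absPow_eq_cfc, ← hA, hQ]
        nth_rewrite 3 [← cfc_id' ℝ A A0.isSelfAdjoint]
        rw [← cfc_mul (fun x : ℝ => x ^ (p - 1)) (fun x => x) A hc.continuousOn continuous_id.continuousOn]
        refine cfc_congr fun x hx => ?_
        have hx0 : 0 ≤ x := spectrum_nonneg_of_nonneg A0 hx
        rcases eq_or_lt_of_le hx0 with rfl | hx1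
        · simp [Real.zero_rpow p0.ne']
        · rw [← Real.rpow_add_one hx1.ne', sub_add_cancel]
      rw [e1]
      noncomm_ring
    have h1 : ‖vecState ω (Q * (star w * a - A))‖ ≤ κ * ε := by
      refine (norm_vecState_le hω.norm_eq_one _).trans ((norm_mul_le _ _).trans ?_)
      calc ‖Q‖ * ‖star w * a - A‖ ≤ (‖Q‖ + 1) * (ε * κ / (‖Q‖ + 1)) := by
            gcongr
            linarith
        _ = κ * ε := by field_simp
    rw [e, vecState_add]
    have h2 : α ≤ ‖vecState ω (absPow a p)‖ := Complex.re_le_norm _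
    have h3 := norm_sub_le (vecState ω (absPow a p) + vecState ω (Q * (star w * a - A)))
      (vecState ω (Q * (star w * a - A)))
    rw [add_sub_cancel_right] at h3
    linarith

/-- Minkowski's inequality for the trace. -/
theorem IsTracialVector.vecNorm_add_le (hω : IsTracialVector M ω) {p : ℝ} (hp : 1 ≤ p)
    {a b : H →L[ℂ] H} (aM : a ∈ M) (bM : b ∈ M) :
    vecNorm ω p (a + b) ≤ vecNorm ω p a + vecNorm ω p b := by
  refine le_of_forall_pos_le_add fun ε hε => ?_
  obtain ⟨y, -, hy, hy'⟩ := hω.exists_dual hp (add_mem aM bM) hε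
  rw [mul_add, vecState_add] at hy'
  linarith [norm_add_le (vecState ω (y * a)) (vecState ω (y * b)), hy a aM, hy b bM]

end TracialState

/-! ### Averaging symbols and the Fejér kernel -/

/-- A bounded function on `ℤ^d` whose pairing with an absolutely convergent Fourier series is
bounded by the supremum of the series. -/
def IsAveraging {d : ℕ} (φ : (Fin d → ℤ) → ℂ) : Prop :=
  (∀ n, ‖φ n‖ ≤ 1) ∧ ∀ c : (Fin d → ℤ) → ℂ, (Summable fun n => ‖c n‖) → ∀ C : ℝ,
    (∀ s, ‖∑' n, (character s n : ℂ) * c n‖ ≤ C) → ‖∑' n, φ n * c n‖ ≤ C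

theorem summable_bounded_mul {ι : Type*} {φ c : ι → ℂ} {B : ℝ} (h : ∀ n, ‖φ n‖ ≤ B)
    (hc : Summable fun n => ‖c n‖) : Summable fun n => φ n * c n :=
  Summable.of_norm_bounded (hc.mul_left B) fun n => by
    rw [norm_mul]
    exact mul_le_mul_of_nonneg_right (h n) (norm_nonneg _)

theorem character_add_left {d : ℕ} (s t : Fin d → ℝ) (n : Fin d → ℤ) :
    character (s + t) n = character s n * character t n := by
  rw [character, character, character, ← Circle.exp_add]
  congr 1
  simp [add_mul, mul_add, Finset.sum_add_distrib]

theorem isAveraging_one {d : ℕ} : IsAveraging (1 : (Fin d → ℤ) → ℂ) := by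
  refine ⟨fun n => by simp, fun c _ C h => ?_⟩
  simpa [character] using h 0

/-- This corresponds to convolution of kernels: the bound holds for all translates, and a translate
of a translate is a translate, so two averages may be applied in succession. -/
theorem IsAveraging.mul {d : ℕ} {φ ψ : (Fin d → ℤ) → ℂ} (hφ : IsAveraging φ)
    (hψ : IsAveraging ψ) : IsAveraging (φ * ψ) := by
  refine ⟨fun n => ?_, fun c hc C h => ?_⟩
  · rw [Pi.mul_apply, norm_mul]
    exact mul_le_one₀ (hφ.1 n) (norm_nonneg _) (hψ.1 n)
  · have hs : Summable fun n => ‖ψ n * c n‖ := (summable_bounded_mul hψ.1 hc).norm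
    have := hφ.2 (fun n => ψ n * c n) hs C fun s => ?_
    · simpa only [Pi.mul_apply, mul_assoc] using this
    · have h1 := hψ.2 (fun n => (character s n : ℂ) * c n)
        (by simpa only [norm_mul, Circle.norm_coe, one_mul] using hc) C fun t => ?_
      · simpa only [mul_left_comm] using h1
      · have := h (t + s)
        simpa only [character_add_left, Circle.coe_mul, mul_assoc] using this

theorem IsAveraging.prod {d : ℕ} {ι : Type*} (s : Finset ι) {φ : ι → (Fin d → ℤ) → ℂ}
    (h : ∀ i, IsAveraging (φ i)) : IsAveraging (∏ i ∈ s, φ i) := by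
  classical
  induction s using Finset.induction_on with
  | empty => exact isAveraging_one
  | insert i s hi ih => rw [Finset.prod_insert hi]; exact (h i).mul ih

/-- Dominated convergence; it lets limits of discrete averages replace integration over the torus.
-/
theorem IsAveraging.of_tendsto {d : ℕ} {φ : ℕ → (Fin d → ℤ) → ℂ} {ψ : (Fin d → ℤ) → ℂ}
    (h : ∀ i, IsAveraging (φ i)) (hl : ∀ n, Tendsto (fun i => φ i n) atTop (𝓝 (ψ n))) :
    IsAveraging ψ := by
  refine ⟨fun n => le_of_tendsto (hl n).norm (Eventually.of_forall fun i => (h i).1 n),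
    fun c hc C hC => ?_⟩
  have := tendsto_tsum_of_dominated_convergence (f := fun i n => φ i n * c n)
    (g := fun n => ψ n * c n) (𝓕 := atTop) hc (fun n => (hl n).mul_const _)
    (Eventually.of_forall fun i n => by
      rw [norm_mul]
      exact mul_le_of_le_one_left (norm_nonneg _) ((h i).1 n))
  exact le_of_tendsto this.norm (Eventually.of_forall fun i => (h i).2 c hc C hC)

theorem isAveraging_convex {d : ℕ} {ι : Type*} (T : Finset ι) (w : ι → ℝ) (s : ι → Fin d → ℝ)
    (w0 : ∀ i ∈ T, 0 ≤ w i) (w1 : ∑ i ∈ T, w i = 1) :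
    IsAveraging fun n => ∑ i ∈ T, (w i : ℂ) * (character (s i) n : ℂ) := by
  refine ⟨fun n => ?_, fun c hc C h => ?_⟩
  · refine (norm_sum_le _ _).trans (le_of_eq ?_)
    rw [← w1]
    refine Finset.sum_congr rfl fun i hi => ?_
    rw [norm_mul, Circle.norm_coe, mul_one, Complex.norm_real, Real.norm_of_nonneg (w0 i hi)]
  · have e : ∑' n, (∑ i ∈ T, (w i : ℂ) * (character (s i) n : ℂ)) * c n
        = ∑ i ∈ T, (w i : ℂ) * ∑' n, (character (s i) n : ℂ) * c n := by
      simp_rw [Finset.sum_mul, mul_assoc]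
      rw [Summable.tsum_finsetSum]
      · exact Finset.sum_congr rfl fun i _ => tsum_mul_left
      · exact fun i _ => (summable_bounded_mul (B := 1) (fun n => (Circle.norm_coe _).le) hc).mul_left _
    rw [e]
    refine (norm_sum_le _ _).trans ?_
    calc ∑ i ∈ T, ‖(w i : ℂ) * ∑' n, (character (s i) n : ℂ) * c n‖ ≤ ∑ i ∈ T, w i * C := by
          refine Finset.sum_le_sum fun i hi => ?_
          rw [norm_mul, Complex.norm_real, Real.norm_of_nonneg (w0 i hi)]
          exact mul_le_mul_of_nonneg_left (h _) (w0 i hi)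
      _ = C := by rw [← Finset.sum_mul, w1, one_mul]

theorem sum_primitiveRoot_zpow {ζ : ℂ} {N : ℕ} (h : IsPrimitiveRoot ζ N) {j : ℤ}
    (hj : |j| < N) : ∑ l ∈ Finset.range N, (ζ ^ j) ^ l = if j = 0 then (N : ℂ) else 0 := by
  split_ifs with h0
  · simp [h0]
  · have hne : ζ ^ j ≠ 1 := fun e => h0 (Int.eq_zero_of_abs_lt_dvd ((h.zpow_eq_one_iff_dvd j).mp e) hj)
    have hN : (ζ ^ j) ^ N = 1 := by
      rw [← zpow_natCast, zpow_comm, zpow_natCast, h.pow_eq_one, one_zpow]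
    have := geom_sum_mul (ζ ^ j) N
    rw [hN, sub_self] at this
    exact (mul_eq_zero.mp this).resolve_right (sub_ne_zero.mpr hne)

/-- The Fejér coefficients `max (0, 1 - |k| / M)`, as the autocorrelation of an interval. -/
def fejer (M : ℕ) (k : ℤ) : ℂ :=
  (M : ℂ)⁻¹ * ∑ a ∈ Finset.range M, ∑ b ∈ Finset.range M, if (a : ℤ) - b + k = 0 then 1 else 0

/-- For each a at most one b contributes, so the double sum counts an interval; truncated
subtraction of naturals supplies the maximum with 0. -/
theorem fejer_eq {M : ℕ} (k : ℤ) : fejer M k = (M : ℂ)⁻¹ * ((M - k.natAbs : ℕ) : ℂ) := by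
  rw [fejer]
  congr 1
  have e : ∀ a ∈ Finset.range M, (∑ b ∈ Finset.range M, if (a : ℤ) - b + k = 0 then (1 : ℂ) else 0)
      = if 0 ≤ (a : ℤ) + k ∧ (a : ℤ) + k < M then 1 else 0 := by
    intro a _
    split_ifs with h
    · rw [Finset.sum_eq_single ((a : ℤ) + k).toNat]
      · rw [if_pos (by omega)]
      · intro b _ hb
        rw [if_neg (by omega)]
      · intro hb
        rw [Finset.mem_range] at hb
        omega
    · refine Finset.sum_eq_zero fun b hb => if_neg ?_
      rw [Finset.mem_range] at hb
      omega
  rw [Finset.sum_congr rfl e, Finset.sum_boole]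
  congr 1
  rcases le_total 0 k with hk | hk
  · rw [show (Finset.range M).filter (fun a : ℕ => 0 ≤ (a : ℤ) + k ∧ (a : ℤ) + k < M)
      = Finset.range (M - k.natAbs) by ext a; simp; omega, Finset.card_range]
  · rw [show (Finset.range M).filter (fun a : ℕ => 0 ≤ (a : ℤ) + k ∧ (a : ℤ) + k < M)
      = Finset.Ico k.natAbs M by ext a; simp; omega, Nat.card_Ico]

theorem fejer_zero_of_le {M : ℕ} {k : ℤ} (h : M ≤ k.natAbs) : fejer M k = 0 := by
  rw [fejer_eq, Nat.sub_eq_zero_of_le h]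
  simp

theorem tendsto_fejer (k : ℤ) : Tendsto (fun M => fejer M k) atTop (𝓝 1) := by
  have h : Tendsto (fun M : ℕ => (1 : ℂ) - (k.natAbs : ℂ) * (M : ℂ)⁻¹) atTop (𝓝 (1 - _ * 0)) :=
    tendsto_const_nhds.sub (tendsto_const_nhds.mul (tendsto_inv_atTop_nhds_zero_nat (𝕜 := ℂ)))
  rw [mul_zero, sub_zero] at h
  refine h.congr' ?_
  filter_upwards [eventually_ge_atTop (k.natAbs + 1)] with M hM
  have : (M : ℂ) ≠ 0 := Nat.cast_ne_zero.mpr (by omega)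
  rw [fejer_eq, Nat.cast_sub (by omega)]
  field_simp

theorem character_single {d : ℕ} (j : Fin d) (N l : ℕ) (n : Fin d → ℤ) :
    (character (Pi.single j ((l : ℝ) / N)) n : ℂ)
      = (Complex.exp (2 * Real.pi * Complex.I / N) ^ n j) ^ l := by
  rw [character, Circle.coe_exp, ← Complex.exp_int_mul, ← Complex.exp_nat_mul]
  congr 1
  rw [Finset.sum_eq_single j]
  · push_cast
    simp only [Pi.single_eq_same]
    push_cast
    ring
  · intro i _ hi
    simp [hi]
  · simp

theorem isAveraging_fejer {d : ℕ} (j : Fin d) {M : ℕ} (hM : 0 < M) :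
    IsAveraging fun n : Fin d → ℤ => fejer M (n j) := by
  have M0 : (M : ℂ) ≠ 0 := Nat.cast_ne_zero.mpr hM.ne'
  let ζ : ℕ → ℂ := fun N => Complex.exp (2 * Real.pi * Complex.I / N)
  -- The weights sample the Fejér kernel at the N-th roots of unity; as squared moduli of Dirichlet
  -- sums they are nonnegative.
  let w : ℕ → ℕ → ℝ := fun N l => ((N : ℝ) * M)⁻¹ * ‖∑ a ∈ Finset.range M, (ζ N ^ a) ^ l‖ ^ 2
  have w0 : ∀ N l, 0 ≤ w N l := fun N l => by positivity
  -- All frequencies a - b + k have absolute value below N, so orthogonality of the roots of unity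
  -- produces no aliasing and the discrete sum is exactly the Fejér coefficient. The case k = 0
  -- gives total mass 1.
  have hsum : ∀ (N : ℕ) (k : ℤ), M + k.natAbs ≤ N →
      ∑ l ∈ Finset.range N, (w N l : ℂ) * (ζ N ^ k) ^ l = fejer M k := by
    intro N k hN
    have N0 : N ≠ 0 := by omega
    have hζ : IsPrimitiveRoot (ζ N) N := Complex.isPrimitiveRoot_exp N N0
    have ζ0 : ζ N ≠ 0 := Complex.exp_ne_zero _
    have hconj : (starRingEnd ℂ) (ζ N) = (ζ N)⁻¹ := by
      have : ‖ζ N‖ = 1 := hζ.norm'_eq_one N0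
      rw [Complex.inv_def, Complex.normSq_eq_norm_sq, this]
      simp
    have hw : ∀ l, (w N l : ℂ) * (ζ N ^ k) ^ l = ((N : ℂ) * M)⁻¹ *
        ∑ a ∈ Finset.range M, ∑ b ∈ Finset.range M, (ζ N ^ ((a : ℤ) - b + k)) ^ l := by
      intro l
      have : ((‖∑ a ∈ Finset.range M, (ζ N ^ a) ^ l‖ ^ 2 : ℝ) : ℂ)
          = (∑ a ∈ Finset.range M, (ζ N ^ a) ^ l)
            * ∑ b ∈ Finset.range M, ((ζ N)⁻¹ ^ b) ^ l := by
        rw [Complex.ofReal_pow, ← Complex.mul_conj', map_sum]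
        simp only [map_pow, hconj]
      simp only [w]
      rw [Complex.ofReal_mul, this, Finset.sum_mul_sum, mul_assoc, Finset.sum_mul]
      push_cast
      congr 1
      refine Finset.sum_congr rfl fun a _ => ?_
      rw [Finset.sum_mul]
      refine Finset.sum_congr rfl fun b _ => ?_
      rw [zpow_add₀ ζ0, zpow_sub₀ ζ0, zpow_natCast, zpow_natCast, div_eq_mul_inv, inv_pow,
        mul_pow, mul_pow]
    rw [Finset.sum_congr rfl fun l _ => hw l, ← Finset.mul_sum, Finset.sum_comm, fejer, mul_inv,
      mul_comm (N : ℂ)⁻¹, mul_assoc]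
    congr 1
    rw [Finset.mul_sum]
    refine Finset.sum_congr rfl fun a ha => ?_
    rw [Finset.sum_comm, Finset.mul_sum]
    refine Finset.sum_congr rfl fun b hb => ?_
    rw [Finset.mem_range] at ha hb
    rw [sum_primitiveRoot_zpow hζ (by rw [abs_lt]; omega)]
    split_ifs
    · rw [inv_mul_cancel₀ (Nat.cast_ne_zero.mpr N0)]
    · rw [mul_zero]
  have w1 : ∀ N, M ≤ N → ∑ l ∈ Finset.range N, w N l = 1 := by
    intro N hN
    have := hsum N 0 (by simpa using hN)
    rw [fejer_eq, Int.natAbs_zero, Nat.sub_zero, inv_mul_cancel₀ M0] at this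
    simp only [zpow_zero, one_pow, mul_one] at this
    exact_mod_cast this
  -- Sampling at M + i points makes the weights sum to 1 for every i, and for each n the sequence is
  -- eventually constant.
  refine IsAveraging.of_tendsto (φ := fun i n => ∑ l ∈ Finset.range (M + i), (w (M + i) l : ℂ)
    * (character (Pi.single j ((l : ℝ) / (M + i : ℕ))) n : ℂ)) (fun i => ?_) fun n => ?_
  · exact isAveraging_convex _ _ _ (fun l _ => w0 _ l) (w1 _ (by omega))
  · refine tendsto_const_nhds.congr' ?_
    filter_upwards [eventually_ge_atTop (n j).natAbs] with i hi
    rw [← hsum (M + i) (n j) (by omega)]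
    refine Finset.sum_congr rfl fun l _ => ?_
    rw [character_single]

/-- The Fejér symbol on `ℤ^d`. -/
def fejerSymbol {d : ℕ} (M : ℕ) (n : Fin d → ℤ) : ℂ := ∏ j, fejer M (n j)

theorem isAveraging_fejerSymbol {d : ℕ} {M : ℕ} (hM : 0 < M) :
    IsAveraging (fejerSymbol M : (Fin d → ℤ) → ℂ) := by
  have := IsAveraging.prod Finset.univ fun j : Fin d => isAveraging_fejer j hM
  convert this using 1
  ext n
  rw [fejerSymbol, Finset.prod_apply]

theorem tendsto_fejerSymbol {d : ℕ} (n : Fin d → ℤ) :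
    Tendsto (fun M => fejerSymbol M n) atTop (𝓝 1) := by
  have := tendsto_finsetProd Finset.univ fun j (_ : j ∈ Finset.univ) => tendsto_fejer (n j)
  rw [Finset.prod_const_one] at this
  exact this

/-- The Fejér symbol vanishes as soon as some |n_j| ≥ M, so any bounded family of coefficients
becomes finitely supported. -/
theorem fejerSymbol_mul_mem {d : ℕ} {M : ℕ} (hM : 0 < M) {f : (Fin d → ℤ) → ℂ}
    {B : ℝ} (hf : ∀ n, ‖f n‖ ≤ B) :
    (fun n => fejerSymbol M n * f n) ∈ Schwartz d := by
  intro N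
  have B0 : 0 ≤ B := (norm_nonneg _).trans (hf 0)
  refine ⟨(1 + M) ^ N * B, fun n => ?_⟩
  by_cases h : ∃ j, M ≤ (n j).natAbs
  · obtain ⟨j, hj⟩ := h
    have h0 : fejerSymbol M n = 0 :=
      Finset.prod_eq_zero (Finset.mem_univ j) (fejer_zero_of_le hj)
    simp only [h0]
    simp only [zero_mul, norm_zero, mul_zero]
    positivity
  · push Not at h
    have hn : ‖n‖ ≤ M := by
      refine (pi_norm_le_iff_of_nonneg (Nat.cast_nonneg M)).mpr fun j => ?_
      rw [Int.norm_eq_abs, ← Int.cast_abs, Int.abs_eq_natAbs]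
      exact_mod_cast (h j).le
    rw [norm_mul]
    gcongr
    calc ‖fejerSymbol M n‖ * ‖f n‖ ≤ 1 * B := by
          gcongr
          · exact (isAveraging_fejerSymbol hM).1 n
          · exact hf n
      _ = B := one_mul B

/-! ### The noncommutative `L_p`-norms on the quantum torus -/

section

variable {d : ℕ} {θ : Matrix (Fin d) (Fin d) ℝ} {p : ℝ≥0∞}

theorem isTracialVector_torusAlgebra (θ : Matrix (Fin d) (Fin d) ℝ) :
    IsTracialVector (torusAlgebra θ) (basisVec 0) :=
  ⟨norm_basisVec 0, fun _ ha _ hb => trace_mul_comm ha hb⟩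

theorem opLpNorm_eq_vecNorm (hp : p ≠ ∞) (a : HSpace d →L[ℂ] HSpace d) :
    opLpNorm p a = vecNorm (basisVec 0) p.toReal a := if_neg hp

theorem one_le_toReal (h1 : 1 ≤ p) (hp : p ≠ ∞) : 1 ≤ p.toReal := by
  rw [← ENNReal.toReal_one]
  exact (ENNReal.toReal_le_toReal ENNReal.one_ne_top hp).mpr h1

theorem opLpNorm_add_le (h1 : 1 ≤ p) (hp : p ≠ ∞) {a b : HSpace d →L[ℂ] HSpace d}
    (ha : a ∈ torusAlgebra θ) (hb : b ∈ torusAlgebra θ) :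
    opLpNorm p (a + b) ≤ opLpNorm p a + opLpNorm p b := by
  simp only [opLpNorm_eq_vecNorm hp]
  exact (isTracialVector_torusAlgebra θ).vecNorm_add_le (one_le_toReal h1 hp) ha hb

theorem opLpNorm_smul (h1 : 1 ≤ p) (hp : p ≠ ∞) (c : ℂ) (a : HSpace d →L[ℂ] HSpace d) :
    opLpNorm p (c • a) = ‖c‖ * opLpNorm p a := by
  simp only [opLpNorm_eq_vecNorm hp]
  exact vecNorm_smul _ (one_le_toReal h1 hp) c a

theorem opLpNorm_nonneg (hp : p ≠ ∞) (a : HSpace d →L[ℂ] HSpace d) : 0 ≤ opLpNorm p a := by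
  rw [opLpNorm_eq_vecNorm hp]
  exact vecNorm_nonneg _ _ _

theorem opLpNorm_sub_comm (h1 : 1 ≤ p) (hp : p ≠ ∞) (a b : HSpace d →L[ℂ] HSpace d) :
    opLpNorm p (a - b) = opLpNorm p (b - a) := by
  have := opLpNorm_smul h1 hp (-1) (a - b)
  rw [neg_one_smul, neg_sub, norm_neg, norm_one, one_mul] at this
  exact this.symm

theorem abs_opLpNorm_sub_le (h1 : 1 ≤ p) (hp : p ≠ ∞) {a b : HSpace d →L[ℂ] HSpace d}
    (ha : a ∈ torusAlgebra θ) (hb : b ∈ torusAlgebra θ) :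
    |opLpNorm p a - opLpNorm p b| ≤ opLpNorm p (a - b) := by
  have e1 := opLpNorm_add_le h1 hp (sub_mem ha hb) hb
  have e2 := opLpNorm_add_le h1 hp (sub_mem hb ha) ha
  rw [sub_add_cancel] at e1 e2
  rw [abs_le]
  constructor <;> linarith [opLpNorm_sub_comm h1 hp a b]

/-- Needed because `HasLpNorm` records a limit of norms, which must be produced whenever a new
Cauchy sequence is formed. -/
theorem exists_tendsto_opLpNorm (h1 : 1 ≤ p) (hp : p ≠ ∞) {a : ℕ → HSpace d →L[ℂ] HSpace d}
    (ha : ∀ i, a i ∈ torusAlgebra θ)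
    (hc : ∀ ε > 0, ∃ N, ∀ i ≥ N, ∀ j ≥ N, opLpNorm p (a i - a j) < ε) :
    ∃ r, Tendsto (fun i => opLpNorm p (a i)) atTop (𝓝 r) := by
  refine cauchySeq_tendsto_of_complete (Metric.cauchySeq_iff.mpr fun ε hε => ?_)
  obtain ⟨N, hN⟩ := hc ε hε
  exact ⟨N, fun i hi j hj => (abs_opLpNorm_sub_le h1 hp (ha i) (ha j)).trans_lt (hN i hi j hj)⟩

/-! ### Linear structure and translation invariance of the L_p-norms on distributions. -/

theorem ofOp_add (θ : Matrix (Fin d) (Fin d) ℝ) (a b : HSpace d →L[ℂ] HSpace d) :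
    ofOp θ (a + b) = ofOp θ a + ofOp θ b := by
  refine Subtype.ext (LinearMap.ext fun x => ?_)
  change trace ((a + b) * _) = trace (a * _) + trace (b * _)
  rw [add_mul, trace_add]

theorem ofOp_smul (θ : Matrix (Fin d) (Fin d) ℝ) (c : ℂ) (a : HSpace d →L[ℂ] HSpace d) :
    ofOp θ (c • a) = c • ofOp θ a := by
  refine Subtype.ext (LinearMap.ext fun x => ?_)
  change trace ((c • a) * _) = c * trace (a * _)
  rw [smul_mul_assoc, trace_smul]

theorem HasLpNorm.nonneg {F : Distribution θ} {r : ℝ} (h : HasLpNorm θ p F r) : 0 ≤ r := by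
  by_cases hp : p = ∞
  · simp only [HasLpNorm, hp, if_true] at h
    obtain ⟨a, -, -, rfl⟩ := h
    exact norm_nonneg a
  · simp only [HasLpNorm, hp, if_false] at h
    obtain ⟨a, -, -, -, h⟩ := h
    exact ge_of_tendsto' h fun i => opLpNorm_nonneg hp (a i)

theorem HasLpNorm.add (h1 : 1 ≤ p) {F G : Distribution θ} {r s : ℝ} (hF : HasLpNorm θ p F r)
    (hG : HasLpNorm θ p G s) : ∃ t ≤ r + s, HasLpNorm θ p (F + G) t := by
  by_cases hp : p = ∞
  · simp only [HasLpNorm, hp, if_true] at hF hG ⊢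
    obtain ⟨a, ha, rfl, rfl⟩ := hF
    obtain ⟨b, hb, rfl, rfl⟩ := hG
    exact ⟨‖a + b‖, norm_add_le a b, a + b, add_mem ha hb, ofOp_add θ a b, rfl⟩
  · simp only [HasLpNorm, hp, if_false] at hF hG ⊢
    obtain ⟨a, ha, hac, hal, har⟩ := hF
    obtain ⟨b, hb, hbc, hbl, hbs⟩ := hG
    have hm : ∀ i, a i + b i ∈ torusAlgebra θ := fun i => add_mem (ha i) (hb i)
    have hc : ∀ ε > 0, ∃ N, ∀ i ≥ N, ∀ j ≥ N, opLpNorm p ((a i + b i) - (a j + b j)) < ε := by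
      intro ε hε
      obtain ⟨N, hN⟩ := hac (ε / 2) (by positivity)
      obtain ⟨K, hK⟩ := hbc (ε / 2) (by positivity)
      refine ⟨max N K, fun i hi j hj => ?_⟩
      rw [add_sub_add_comm]
      have := opLpNorm_add_le h1 hp (sub_mem (ha i) (ha j)) (sub_mem (hb i) (hb j))
      linarith [hN i (le_of_max_le_left hi) j (le_of_max_le_left hj),
        hK i (le_of_max_le_right hi) j (le_of_max_le_right hj)]
    obtain ⟨t, ht⟩ := exists_tendsto_opLpNorm h1 hp hm hc
    refine ⟨t, le_of_tendsto_of_tendsto' ht (har.add hbs) fun i =>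
      opLpNorm_add_le h1 hp (ha i) (hb i), fun i => a i + b i, hm, hc, fun x => ?_, ht⟩
    simp only [ofOp_add]
    exact (hal x).add (hbl x)

theorem HasLpNorm.smul (h1 : 1 ≤ p) (c : ℂ) {F : Distribution θ} {r : ℝ}
    (hF : HasLpNorm θ p F r) : HasLpNorm θ p (c • F) (‖c‖ * r) := by
  by_cases hp : p = ∞
  · simp only [HasLpNorm, hp, if_true] at hF ⊢
    obtain ⟨a, ha, rfl, rfl⟩ := hF
    exact ⟨c • a, smul_mem_vonNeumann c ha, ofOp_smul θ c a, norm_smul c a⟩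
  · simp only [HasLpNorm, hp, if_false] at hF ⊢
    obtain ⟨a, ha, hac, hal, har⟩ := hF
    refine ⟨fun i => c • a i, fun i => smul_mem_vonNeumann c (ha i), fun ε hε => ?_, fun x => ?_, ?_⟩
    · obtain ⟨N, hN⟩ := hac (ε / (‖c‖ + 1)) (by positivity)
      refine ⟨N, fun i hi j hj => ?_⟩
      rw [← smul_sub, opLpNorm_smul h1 hp]
      have h := hN i hi j hj
      rw [lt_div_iff₀ (by positivity)] at h
      nlinarith [opLpNorm_nonneg hp (a i - a j)]
    · simp only [ofOp_smul]
      exact (hal x).const_smul c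
    · simp only [opLpNorm_smul h1 hp]
      exact har.const_mul _

theorem polyGrowth_of_norm_le {φ : (Fin d → ℤ) → ℂ} {B : ℝ} (h : ∀ n, ‖φ n‖ ≤ B) : PolyGrowth φ :=
  ⟨0, B, fun n => by simpa using h n⟩

theorem polyGrowth_character (s : Fin d → ℝ) : PolyGrowth fun n => (character s n : ℂ) :=
  polyGrowth_of_norm_le (B := 1) fun _ => (Circle.norm_coe _).le

/-- Identifies the unitary conjugation, visibly isometric, with the Fourier multiplier by a
character; every multiplier bound below rests on this. -/
theorem ofOp_translate (θ : Matrix (Fin d) (Fin d) ℝ) (s : Fin d → ℝ)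
    (a : HSpace d →L[ℂ] HSpace d) :
    ofOp θ (translate s a) = multiplier θ (fun n => (character s n : ℂ)) (polyGrowth_character s)
      (ofOp θ a) := by
  refine Subtype.ext (LinearMap.ext fun x => ?_)
  refine (trace_translate_mul s a (Schwartz.toOp θ x)).unique ?_
  change HasSum _ (trace (a * Schwartz.toOp θ (Schwartz.multiplier _ _ x)))
  convert hasSum_trace_mul a _ using 2 with n
  rw [Schwartz.toOp_basisVec_zero, Schwartz.toOp_basisVec_zero, mul_left_comm]
  rfl

theorem HasLpNorm.translate {F : Distribution θ} {r : ℝ} (s : Fin d → ℝ)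
    (hF : HasLpNorm θ p F r) : HasLpNorm θ p
      (multiplier θ (fun n => (character s n : ℂ)) (polyGrowth_character s) F) r := by
  by_cases hp : p = ∞
  · simp only [HasLpNorm, hp, if_true] at hF ⊢
    obtain ⟨a, ha, rfl, rfl⟩ := hF
    exact ⟨_, translate_mem s ha, ofOp_translate θ s a, norm_translate s a⟩
  · simp only [HasLpNorm, hp, if_false] at hF ⊢
    obtain ⟨a, ha, hac, hal, har⟩ := hF
    refine ⟨fun i => QuantumTorus.translate s (a i), fun i => translate_mem s (ha i), ?_,
      fun x => ?_, ?_⟩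
    · simpa only [← translate_sub, opLpNorm_translate] using hac
    · simp only [ofOp_translate]
      exact hal _
    · simpa only [opLpNorm_translate] using har

theorem MemLp.add (h1 : 1 ≤ p) {F G : Distribution θ} (hF : MemLp θ p F) (hG : MemLp θ p G) :
    MemLp θ p (F + G) := by
  obtain ⟨r, hr⟩ := hF
  obtain ⟨s, hs⟩ := hG
  obtain ⟨t, -, ht⟩ := hr.add h1 hs
  exact ⟨t, ht⟩

theorem MemLp.smul (h1 : 1 ≤ p) (c : ℂ) {F : Distribution θ} (hF : MemLp θ p F) :
    MemLp θ p (c • F) := by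
  obtain ⟨r, hr⟩ := hF
  exact ⟨_, hr.smul h1 c⟩

theorem MemLp.translate (s : Fin d → ℝ) {F : Distribution θ} (hF : MemLp θ p F) :
    MemLp θ p (multiplier θ (fun n => (character s n : ℂ)) (polyGrowth_character s) F) := by
  obtain ⟨r, hr⟩ := hF
  exact ⟨r, hr.translate s⟩

theorem HasLpNorm.lpNorm_le {F : Distribution θ} {r : ℝ} (h : HasLpNorm θ p F r) :
    lpNorm θ p F ≤ ENNReal.ofReal r := iInf₂_le r h

theorem exists_hasLpNorm_of_lpNorm_lt {F : Distribution θ} {C : ℝ≥0∞} (h : lpNorm θ p F < C) :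
    ∃ r, HasLpNorm θ p F r ∧ ENNReal.ofReal r < C := by
  simp only [lpNorm, iInf_lt_iff] at h
  obtain ⟨r, hr, h⟩ := h
  exact ⟨r, hr, h⟩

theorem MemLp.lpNorm_lt_top {F : Distribution θ} (h : MemLp θ p F) : lpNorm θ p F < ∞ := by
  obtain ⟨r, hr⟩ := h
  exact hr.lpNorm_le.trans_lt ENNReal.ofReal_lt_top

theorem lpNorm_add_le (h1 : 1 ≤ p) (F G : Distribution θ) :
    lpNorm θ p (F + G) ≤ lpNorm θ p F + lpNorm θ p G := by
  refine ENNReal.le_iInf₂_add_iInf₂ fun r hr s hs => ?_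
  obtain ⟨t, ht, h⟩ := hr.add h1 hs
  rw [← ENNReal.ofReal_add hr.nonneg hs.nonneg]
  exact h.lpNorm_le.trans (ENNReal.ofReal_le_ofReal ht)

theorem lpNorm_smul_le (h1 : 1 ≤ p) (c : ℂ) {F : Distribution θ} (hF : MemLp θ p F) :
    lpNorm θ p (c • F) ≤ ‖c‖ₑ * lpNorm θ p F := by
  refine ENNReal.le_of_forall_pos_le_add fun ε hε _ => ?_
  -- The infimum defining `lpNorm` is approached only within an error; the summand 1 in the
  -- denominator covers c = 0.
  have hlt : lpNorm θ p F < lpNorm θ p F + ε / (‖c‖ₑ + 1) :=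
    ENNReal.lt_add_right hF.lpNorm_lt_top.ne (by simp [hε.ne'])
  obtain ⟨r, hr, h⟩ := exists_hasLpNorm_of_lpNorm_lt hlt
  refine (hr.smul h1 c).lpNorm_le.trans ?_
  rw [ENNReal.ofReal_mul (norm_nonneg c), ofReal_norm]
  calc ‖c‖ₑ * ENNReal.ofReal r ≤ ‖c‖ₑ * (lpNorm θ p F + ε / (‖c‖ₑ + 1)) := by gcongr
    _ ≤ ‖c‖ₑ * lpNorm θ p F + (‖c‖ₑ + 1) * (ε / (‖c‖ₑ + 1)) := by
        rw [mul_add]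
        gcongr
        exact le_self_add
    _ = ‖c‖ₑ * lpNorm θ p F + ε := by
        rw [ENNReal.mul_div_cancel (by simp) (by simp)]

theorem lpNorm_translate_le (s : Fin d → ℝ) (F : Distribution θ) :
    lpNorm θ p (multiplier θ (fun n => (character s n : ℂ)) (polyGrowth_character s) F)
      ≤ lpNorm θ p F :=
  le_iInf₂ fun _ hr => (hr.translate s).lpNorm_le

end

/-! ### Weak operator limits -/

section WeakLimit

variable {H : Type*} [NormedAddCommGroup H] [InnerProductSpace ℂ H] [CompleteSpace H]

/-- A bounded sequence of operators converges in the weak operator topology along an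
ultrafilter. -/
theorem exists_weak_limit (U : Ultrafilter ℕ) {b : ℕ → H →L[ℂ] H} {K : ℝ} (hb : ∀ j, ‖b j‖ ≤ K) :
    ∃ a : H →L[ℂ] H, ‖a‖ ≤ K ∧
      ∀ v w, Tendsto (fun j => inner ℂ w (b j v)) U (𝓝 (inner ℂ w (a v))) := by
  have K0 : 0 ≤ K := (norm_nonneg _).trans (hb 0)
  have bd : ∀ v w j, ‖inner ℂ (b j v) w‖ ≤ K * ‖v‖ * ‖w‖ := fun v w j =>
    (norm_inner_le_norm _ _).trans (mul_le_mul_of_nonneg_right ((b j).le_of_opNorm_le (hb j) v)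
      (norm_nonneg w))
  have ex : ∀ v w, ∃ z : ℂ, ‖z‖ ≤ K * ‖v‖ * ‖w‖ ∧
      Tendsto (fun j => inner ℂ (b j v) w) U (𝓝 z) := by
    intro v w
    obtain ⟨z, hz, hle⟩ := (isCompact_closedBall (0 : ℂ) (K * ‖v‖ * ‖w‖)).ultrafilter_le_nhds'
      (U.map fun j => inner ℂ (b j v) w)
      (Filter.mem_map.mpr (Eventually.of_forall fun j => by simpa using bd v w j))
    exact ⟨z, by simpa using hz, hle⟩
  choose B hB hlim using ex
  -- Uniqueness of limits along the ultrafilter makes the limit form sesquilinear; being bounded, it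
  -- is represented by an operator.
  let L : H →ₗ⋆[ℂ] H →ₗ[ℂ] ℂ := LinearMap.mk₂'ₛₗ (starRingEnd ℂ) (RingHom.id ℂ) B
    (fun v v' w => tendsto_nhds_unique (hlim (v + v') w) (by
      simpa only [map_add, inner_add_left] using (hlim v w).add (hlim v' w)))
    (fun c v w => tendsto_nhds_unique (hlim (c • v) w) (by
      simpa only [map_smul, inner_smul_left, smul_eq_mul] using
        (hlim v w).const_mul ((starRingEnd ℂ) c)))
    (fun v w w' => tendsto_nhds_unique (hlim v (w + w')) (by
      simpa only [inner_add_right] using (hlim v w).add (hlim v w')))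
    (fun c v w => tendsto_nhds_unique (hlim v (c • w)) (by
      simpa only [inner_smul_right, RingHom.id_apply, smul_eq_mul] using
        (hlim v w).const_mul c))
  let T : H →L⋆[ℂ] H →L[ℂ] ℂ := L.mkContinuous₂ K hB
  have hT : ∀ v w, inner ℂ (InnerProductSpace.continuousLinearMapOfBilin T v) w = B v w :=
    fun v w => InnerProductSpace.continuousLinearMapOfBilin_apply T v w
  refine ⟨InnerProductSpace.continuousLinearMapOfBilin T, ?_, fun v w => ?_⟩
  · refine ContinuousLinearMap.opNorm_le_bound _ K0 fun v => ?_
    set y := InnerProductSpace.continuousLinearMapOfBilin T v with hy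
    have h1 : ‖y‖ * ‖y‖ ≤ K * ‖v‖ * ‖y‖ := by
      have := hB v y
      rw [← hT, ← hy, inner_self_eq_norm_sq_to_K] at this
      simpa [sq] using this
    rcases eq_or_lt_of_le (norm_nonneg y) with h0 | h0
    · rw [← h0]
      positivity
    · exact le_of_mul_le_mul_right h1 h0
  · rw [← inner_conj_symm, hT]
    have := (Complex.continuous_conj.tendsto _).comp (hlim v w)
    simpa only [Function.comp_def, inner_conj_symm] using this

end WeakLimit

section

variable {d : ℕ} {θ : Matrix (Fin d) (Fin d) ℝ} {p : ℝ≥0∞}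

/-- The unit ball of `L_∞` is closed under convergence in the sense of distributions. -/
theorem lpNorm_top_le_of_tendsto {G : ℕ → Distribution θ} {F : Distribution θ} {C : ℝ≥0∞}
    (hC : C ≠ ∞) (hG : ∀ j, lpNorm θ ∞ (G j) ≤ C)
    (hlim : ∀ x, Tendsto (fun j => (G j).1 x) atTop (𝓝 (F.1 x))) :
    MemLp θ ∞ F ∧ lpNorm θ ∞ F ≤ C := by
  -- The slack ε supplies actual operators representing the G_j, with a common norm bound.
  have key : ∀ ε : ℝ≥0, 0 < ε → ∃ r, HasLpNorm θ ∞ F r ∧ ENNReal.ofReal r ≤ C + ε := by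
    intro ε hε
    have hlt : ∀ j, lpNorm θ ∞ (G j) < C + ε := fun j =>
      (hG j).trans_lt (ENNReal.lt_add_right hC (by simpa using hε.ne'))
    have ex : ∀ j, ∃ b ∈ torusAlgebra θ, ofOp θ b = G j ∧ ‖b‖ ≤ (C + ε).toReal := by
      intro j
      obtain ⟨r, hr, hlt'⟩ := exists_hasLpNorm_of_lpNorm_lt (hlt j)
      simp only [HasLpNorm, if_true] at hr
      obtain ⟨b, hb, hbG, rfl⟩ := hr
      exact ⟨b, hb, hbG, (ENNReal.ofReal_le_iff_le_toReal (by simp [hC])).mp hlt'.le⟩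
    choose b hb hbG hbn using ex
    obtain ⟨a, ha, hal⟩ := exists_weak_limit (hyperfilter ℕ) hbn
    have hU : (hyperfilter ℕ : Filter ℕ) ≤ atTop := Nat.hyperfilter_le_atTop
    refine ⟨‖a‖, ?_, (ENNReal.ofReal_le_iff_le_toReal (by simp [hC])).mpr ha⟩
    simp only [HasLpNorm, if_true]
    refine ⟨a, ?_, Subtype.ext (LinearMap.ext fun x => ?_), rfl⟩
    -- Commutation with a fixed `c` survives weak limits once `c` is moved to the other side of the
    -- inner product as its adjoint.
    · rw [mem_torusAlgebra_iff]
      intro c hc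
      ext1 v
      refine ext_inner_left ℂ fun w => ?_
      have h1 := hal v (ContinuousLinearMap.adjoint c w)
      have h2 := hal (c v) w
      simp only [ContinuousLinearMap.adjoint_inner_left] at h1
      refine tendsto_nhds_unique h1 (h2.congr fun j => ?_)
      have := DFunLike.congr_fun (mem_torusAlgebra_iff.mp (hb j) c hc) v
      exact congrArg _ this.symm
    · refine tendsto_nhds_unique (f := fun j => (G j).1 x) ?_ ((hlim x).mono_left hU)
      have := hal (Schwartz.toOp θ x (basisVec 0)) (basisVec 0)
      refine this.congr fun j => ?_
      rw [← hbG j]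
      rfl
  refine ⟨?_, ENNReal.le_of_forall_pos_le_add fun ε hε _ => ?_⟩
  · obtain ⟨r, hr, -⟩ := key 1 one_pos
    exact ⟨r, hr⟩
  · obtain ⟨r, hr, hle⟩ := key ε hε
    exact hr.lpNorm_le.trans hle

/-! ### Lower semicontinuity for finite exponents -/

/-- A test function of dual norm at most one. -/
def IsDualTest (θ : Matrix (Fin d) (Fin d) ℝ) (p : ℝ≥0∞) (x : Schwartz d) : Prop :=
  ∀ b ∈ torusAlgebra θ, ‖trace (b * Schwartz.toOp θ x)‖ ≤ opLpNorm p b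

theorem HasLpNorm.norm_apply_le (hp : p ≠ ∞) {F : Distribution θ} {r : ℝ} (h : HasLpNorm θ p F r)
    {x : Schwartz d} (hx : IsDualTest θ p x) : ‖F.1 x‖ ≤ r := by
  simp only [HasLpNorm, hp, if_false] at h
  obtain ⟨a, ha, -, hal, har⟩ := h
  exact le_of_tendsto_of_tendsto' (hal x).norm har fun i => hx _ (ha i)

theorem norm_apply_le_lpNorm (hp : p ≠ ∞) (F : Distribution θ) {x : Schwartz d}
    (hx : IsDualTest θ p x) : ENNReal.ofReal ‖F.1 x‖ ≤ lpNorm θ p F :=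
  le_iInf₂ fun _ hr => ENNReal.ofReal_le_ofReal (hr.norm_apply_le hp hx)

/-- The norm `‖a‖_p` is attained, up to `ε`, on test functions of dual norm at most one. -/
theorem exists_isDualTest (h1 : 1 ≤ p) (hp : p ≠ ∞) {a : HSpace d →L[ℂ] HSpace d}
    (ha : a ∈ torusAlgebra θ) {ε : ℝ} (hε : 0 < ε) :
    ∃ x : Schwartz d, IsDualTest θ p x ∧
      opLpNorm p a - ε ≤ ‖trace (a * Schwartz.toOp θ x)‖ := by
  obtain ⟨y, hy, hyb, hya⟩ := (isTracialVector_torusAlgebra θ).exists_dual (one_le_toReal h1 hp) ha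
    (half_pos hε)
  simp only [← opLpNorm_eq_vecNorm hp] at hyb hya
  have hyb' : ∀ b ∈ torusAlgebra θ, ‖trace (b * y)‖ ≤ opLpNorm p b := fun b hb => by
    rw [trace_mul_comm hb hy]
    exact hyb b hb
  have hya' : opLpNorm p a - ε / 2 ≤ ‖trace (a * y)‖ := by
    rw [trace_mul_comm ha hy]
    exact hya
  -- The dual element y is in general no test function; its Fejér means are, having finitely many
  -- coefficients, and they converge to it in the pairing with `a`.
  set f : HSpace d := y (basisVec 0) with hf
  let X : ∀ M : ℕ, 0 < M → Schwartz d := fun M hM => ⟨fun n => fejerSymbol M n * f n,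
    fejerSymbol_mul_mem hM fun n => lp.norm_apply_le_norm (by norm_num) f n⟩
  let c : (HSpace d →L[ℂ] HSpace d) → (Fin d → ℤ) → ℂ := fun b n =>
    (starRingEnd ℂ) ((star b) (basisVec 0) n) * f n
  have hc : ∀ b, Summable fun n => ‖c b n‖ := fun b => (hasSum_trace_mul b y).summable.norm
  have hX : ∀ M (hM : 0 < M) b, trace (b * Schwartz.toOp θ (X M hM))
      = ∑' n, fejerSymbol M n * c b n := by
    intro M hM b
    rw [← (hasSum_trace_mul b _).tsum_eq]
    refine tsum_congr fun n => ?_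
    rw [Schwartz.toOp_basisVec_zero, mul_left_comm]
  have hlim : Tendsto (fun M => ∑' n, fejerSymbol (M + 1) n * c a n) atTop
      (𝓝 (trace (a * y))) := by
    have := tendsto_tsum_of_dominated_convergence (𝓕 := atTop)
      (f := fun M n => fejerSymbol (M + 1) n * c a n) (g := fun n => 1 * c a n) (hc a)
      (fun n => ((tendsto_fejerSymbol n).comp (tendsto_add_atTop_nat 1)).mul_const _)
      (Eventually.of_forall fun M n => by
        rw [norm_mul]
        exact mul_le_of_le_one_left (norm_nonneg _)
          ((isAveraging_fejerSymbol M.succ_pos).1 n))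
    simp only [one_mul] at this
    rwa [(hasSum_trace_mul a y).tsum_eq] at this
  obtain ⟨M, hM⟩ := (hlim.norm.eventually (lt_mem_nhds
    (show opLpNorm p a - ε < ‖trace (a * y)‖ by linarith))).exists
  refine ⟨X (M + 1) M.succ_pos, fun b hb => ?_, ?_⟩
  · rw [hX _ M.succ_pos]
    -- Averaging costs nothing: each translate of the pairing is the pairing of y with a translate
    -- of b, which has the same norm. The translation is by -s because b enters with reflected
    -- frequencies.
    refine (isAveraging_fejerSymbol M.succ_pos).2 (c b) (hc b) _ fun s => ?_
    have h := trace_translate_mul (-s) b y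
    have e : ∀ n, character (-s) (-n) = character s n := fun n => by
      simp [character]
    simp only [e] at h
    rw [h.tsum_eq, ← opLpNorm_translate p (-s) b]
    exact hyb' _ (translate_mem _ hb)
  · rw [hX _ M.succ_pos]
    exact hM.le

/-- The norm of `L_p` is lower semicontinuous for convergence in the sense of distributions. -/
theorem lpNorm_le_of_tendsto (h1 : 1 ≤ p) {G : ℕ → Distribution θ}
    {F : Distribution θ} (hF : MemLp θ p F) {C : ℝ≥0∞} (hG : ∀ j, lpNorm θ p (G j) ≤ C)
    (hlim : ∀ x, Tendsto (fun j => (G j).1 x) atTop (𝓝 (F.1 x))) : lpNorm θ p F ≤ C := by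
  rcases eq_or_ne C ∞ with rfl | hC
  · exact le_top
  by_cases hp : p = ∞
  · subst hp
    exact (lpNorm_top_le_of_tendsto hC hG hlim).2
  obtain ⟨r, hr⟩ := hF
  refine hr.lpNorm_le.trans ((ENNReal.ofReal_le_iff_le_toReal hC).mpr ?_)
  simp only [HasLpNorm, hp, if_false] at hr
  obtain ⟨a, ha, hac, hal, har⟩ := hr
  refine le_of_forall_pos_le_add fun ε hε => ?_
  -- Pairings pass to the limit, so `F` obeys the bound on every dual test. It remains to transfer
  -- this to a late member a_i of its Cauchy sequence, which costs ε/2 for the sequence and ε/2 for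
  -- the choice of test.
  have bound : ∀ x : Schwartz d, IsDualTest θ p x → ‖F.1 x‖ ≤ C.toReal := fun x hx =>
    le_of_tendsto' (hlim x).norm fun j => (ENNReal.ofReal_le_iff_le_toReal hC).mp
      ((norm_apply_le_lpNorm hp (G j) hx).trans (hG j))
  obtain ⟨N, hN⟩ := hac (ε / 2) (half_pos hε)
  refine le_of_tendsto har ?_
  filter_upwards [eventually_ge_atTop N] with i hi
  obtain ⟨x, hx, hxa⟩ := exists_isDualTest h1 hp (ha i) (half_pos hε)
  have h2 : ‖trace (a i * Schwartz.toOp θ x) - F.1 x‖ ≤ ε / 2 := by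
    refine le_of_tendsto ((hal x).const_sub _).norm ?_
    filter_upwards [eventually_ge_atTop N] with j hj
    change ‖trace (a i * Schwartz.toOp θ x) - trace (a j * Schwartz.toOp θ x)‖ ≤ _
    rw [← trace_sub, ← sub_mul]
    exact (hx _ (sub_mem (ha i) (ha j))).trans (hN i hi j hj).le
  have h3 := norm_sub_norm_le (trace (a i * Schwartz.toOp θ x)) (F.1 x)
  linarith [bound x hx]

end

/-! ### Fourier multipliers on distributions -/

section

variable {d : ℕ} {θ : Matrix (Fin d) (Fin d) ℝ} {p : ℝ≥0∞}

theorem PolyGrowth.mul {φ ψ : (Fin d → ℤ) → ℂ} (hφ : PolyGrowth φ) (hψ : PolyGrowth ψ) :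
    PolyGrowth (φ * ψ) := by
  obtain ⟨N, C, hC⟩ := hφ
  obtain ⟨M, D, hD⟩ := hψ
  refine ⟨N + M, C * D, fun n => ?_⟩
  rw [Pi.mul_apply, norm_mul, pow_add, mul_mul_mul_comm]
  exact mul_le_mul (hC n) (hD n) (norm_nonneg _) ((norm_nonneg _).trans (hC n))

theorem PolyGrowth.pow {φ : (Fin d → ℤ) → ℂ} (hφ : PolyGrowth φ) (k : ℕ) :
    PolyGrowth (φ ^ k) := by
  induction k with
  | zero => exact polyGrowth_of_norm_le (B := 1) fun n => by simp
  | succ k ih => rw [pow_succ]; exact ih.mul hφ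

theorem PolyGrowth.mono {φ χ : (Fin d → ℤ) → ℂ} (hχ : PolyGrowth χ) (h : ∀ n, ‖φ n‖ ≤ ‖χ n‖) :
    PolyGrowth φ := by
  obtain ⟨N, C, hC⟩ := hχ
  exact ⟨N, C, fun n => (h n).trans (hC n)⟩

theorem multiplier_congr {φ ψ : (Fin d → ℤ) → ℂ} (h : φ = ψ) (hφ : PolyGrowth φ)
    (hψ : PolyGrowth ψ) (F : Distribution θ) : multiplier θ φ hφ F = multiplier θ ψ hψ F := by
  subst h
  rfl

theorem multiplier_multiplier {φ ψ : (Fin d → ℤ) → ℂ} (hφ : PolyGrowth φ) (hψ : PolyGrowth ψ)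
    (F : Distribution θ) :
    multiplier θ φ hφ (multiplier θ ψ hψ F) = multiplier θ (φ * ψ) (hφ.mul hψ) F := by
  refine Subtype.ext (LinearMap.ext fun x => ?_)
  refine congrArg F.1 (Subtype.ext (funext fun n => ?_))
  change ψ (-n) * (φ (-n) * x.1 n) = (φ (-n) * ψ (-n)) * x.1 n
  ring

theorem multiplier_one (F : Distribution θ) (h : PolyGrowth (1 : (Fin d → ℤ) → ℂ)) :
    multiplier θ 1 h F = F := by
  refine Subtype.ext (LinearMap.ext fun x => ?_)
  exact congrArg F.1 (Subtype.ext (funext fun n => one_mul _))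

theorem multiplier_iterate {φ : (Fin d → ℤ) → ℂ} (hφ : PolyGrowth φ) (k : ℕ)
    (F : Distribution θ) : (multiplier θ φ hφ)^[k] F = multiplier θ (φ ^ k) (hφ.pow k) F := by
  induction k with
  | zero =>
    rw [Function.iterate_zero_apply]
    exact (multiplier_one F _).symm
  | succ k ih =>
    rw [Function.iterate_succ_apply', ih, multiplier_multiplier]
    exact multiplier_congr (pow_succ' φ k).symm _ _ F

theorem multiplier_sum {ι : Type*} (T : Finset ι) (c : ι → ℂ) {φ : ι → (Fin d → ℤ) → ℂ}
    (hφ : ∀ i, PolyGrowth (φ i)) {ψ : (Fin d → ℤ) → ℂ} (hψ : PolyGrowth ψ)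
    (h : ∀ n, ψ n = ∑ i ∈ T, c i * φ i n) (F : Distribution θ) :
    multiplier θ ψ hψ F = ∑ i ∈ T, c i • multiplier θ (φ i) (hφ i) F := by
  refine Subtype.ext (LinearMap.ext fun x => ?_)
  have e : Schwartz.multiplier (fun n => ψ (-n)) hψ.reflect x
      = ∑ i ∈ T, c i • Schwartz.multiplier (fun n => φ i (-n)) (hφ i).reflect x := by
    refine Subtype.ext (funext fun n => ?_)
    rw [Submodule.coe_sum, Finset.sum_apply]
    change ψ (-n) * x.1 n = ∑ i ∈ T, c i * (φ i (-n) * x.1 n)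
    rw [h, Finset.sum_mul]
    exact Finset.sum_congr rfl fun i _ => mul_assoc _ _ _
  change F.1 (Schwartz.multiplier (fun n => ψ (-n)) hψ.reflect x) = _
  rw [e, map_sum, Submodule.coe_sum, LinearMap.sum_apply]
  refine Finset.sum_congr rfl fun i _ => ?_
  rw [map_smul]
  rfl

theorem norm_derivSymbol_le {k : ℕ} {m : Fin d → ℕ} (hm : ∑ j, m j ≤ k) (n : Fin d → ℤ) :
    ‖derivSymbol m n‖ ≤ (2 * Real.pi) ^ k * (1 + ‖n‖) ^ k := by
  have K1 : 1 ≤ 2 * Real.pi := by nlinarith [Real.pi_gt_three]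
  rw [norm_derivSymbol]
  calc ∏ j, (2 * Real.pi * ‖n j‖) ^ m j ≤ ∏ j, (2 * Real.pi * (1 + ‖n‖)) ^ m j := by
        refine Finset.prod_le_prod (fun _ _ => by positivity) fun j _ => ?_
        have := norm_le_pi_norm n j
        gcongr
        linarith
    _ = (2 * Real.pi * (1 + ‖n‖)) ^ (∑ j, m j) := Finset.prod_pow_eq_pow_sum _ _ _
    _ ≤ (2 * Real.pi * (1 + ‖n‖)) ^ k := by
        refine pow_le_pow_right₀ ?_ hm
        nlinarith [norm_nonneg n]
    _ = _ := by rw [mul_pow]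

theorem Schwartz.summable_weighted (x : Schwartz d) (N : ℕ) :
    Summable fun n => (1 + ‖n‖) ^ N * ‖x.1 n‖ := by
  obtain ⟨C, hC⟩ := x.2 (2 * d + N)
  refine Summable.of_nonneg_of_le (fun n => by positivity) (fun n => ?_)
    ((summable_prod_inv d).mul_left C)
  have := norm_le_of_decay (a := fun n => (((1 + ‖n‖) ^ N : ℝ) : ℂ) * x.1 n) (C := C)
    (fun n => by
      rw [norm_mul, Complex.norm_real, Real.norm_of_nonneg (by positivity), ← mul_assoc, ← pow_add]
      exact hC n) n
  rwa [norm_mul, Complex.norm_real, Real.norm_of_nonneg (by positivity)] at this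

/-- Dominates the topology of test functions by weighted sums of coefficients, where dominated
convergence applies. -/
theorem seminorm_le_tsum (θ : Matrix (Fin d) (Fin d) ℝ) (k : ℕ) (x : Schwartz d) :
    (Schwartz.seminorm θ k x : ℝ)
      ≤ (2 * Real.pi) ^ k * ∑' n, (1 + ‖n‖) ^ k * ‖x.1 n‖ := by
  have S0 : 0 ≤ ∑' n, (1 + ‖n‖) ^ k * ‖x.1 n‖ := tsum_nonneg fun n => by positivity
  have R0 : 0 ≤ (2 * Real.pi) ^ k * ∑' n, (1 + ‖n‖) ^ k * ‖x.1 n‖ := by positivity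
  have : Schwartz.seminorm θ k x
      ≤ Real.toNNReal ((2 * Real.pi) ^ k * ∑' n, (1 + ‖n‖) ^ k * ‖x.1 n‖) := by
    refine Finset.sup_le fun m hm => ?_
    rw [mem_indicesUpTo] at hm
    rw [← NNReal.coe_le_coe, Real.coe_toNNReal _ R0, coe_nnnorm]
    refine tsum_of_norm_bounded ((Schwartz.summable_weighted x k).mul_left _).hasSum (fun n => ?_)
      |>.trans (le_of_eq tsum_mul_left)
    rw [norm_smul]
    change ‖derivSymbol m n * x.1 n‖ * ‖monomial θ n‖ ≤ _
    rw [norm_mul, ← mul_assoc]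
    refine (mul_le_of_le_one_right (by positivity) (norm_monomial_le θ n)).trans ?_
    exact mul_le_mul_of_nonneg_right (norm_derivSymbol_le hm n) (norm_nonneg _)
  have h := NNReal.coe_le_coe.mpr this
  rwa [Real.coe_toNNReal _ R0] at h

/-- Multipliers whose symbols converge pointwise, dominated by a symbol of polynomial growth,
converge in the sense of distributions. -/
theorem tendsto_multiplier {φ : ℕ → (Fin d → ℤ) → ℂ} {ψ χ : (Fin d → ℤ) → ℂ}
    (hφ : ∀ i, PolyGrowth (φ i)) (hψ : PolyGrowth ψ) (hχ : PolyGrowth χ)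
    (hb : ∀ i n, ‖φ i n‖ ≤ ‖χ n‖) (hl : ∀ n, Tendsto (fun i => φ i n) atTop (𝓝 (ψ n)))
    (F : Distribution θ) (x : Schwartz d) :
    Tendsto (fun i => (multiplier θ (φ i) (hφ i) F).1 x) atTop
      (𝓝 ((multiplier θ ψ hψ F).1 x)) := by
  obtain ⟨k, C, hF⟩ := F.2
  obtain ⟨N, D, hD⟩ := hχ
  let y : ℕ → Schwartz d := fun i => Schwartz.multiplier (fun n => φ i (-n)) (hφ i).reflect x
    - Schwartz.multiplier (fun n => ψ (-n)) hψ.reflect x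
  have hy : ∀ i n, (y i).1 n = (φ i (-n) - ψ (-n)) * x.1 n := fun i n => (sub_mul _ _ _).symm
  have hψ' : ∀ n, ‖ψ n‖ ≤ ‖χ n‖ := fun n =>
    le_of_tendsto (hl n).norm (Eventually.of_forall fun i => hb i n)
  have hbd : ∀ i n, ‖(y i).1 n‖ ≤ 2 * (D * (1 + ‖n‖) ^ N) * ‖x.1 n‖ := by
    intro i n
    rw [hy, norm_mul]
    refine mul_le_mul_of_nonneg_right ((norm_sub_le _ _).trans ?_) (norm_nonneg _)
    have := hD (-n)
    rw [norm_neg] at this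
    linarith [hb i (-n), hψ' (-n)]
  -- Dominated convergence: the growth N of the dominating symbol is absorbed by raising the weight
  -- on `x` from k to k + N.
  have hsum : Tendsto (fun i => ∑' n, (1 + ‖n‖) ^ k * ‖(y i).1 n‖) atTop (𝓝 0) := by
    have := tendsto_tsum_of_dominated_convergence (𝓕 := atTop)
      (f := fun i n => (1 + ‖n‖) ^ k * ‖(y i).1 n‖) (g := fun _ => (0 : ℝ))
      ((Schwartz.summable_weighted x (k + N)).mul_left (2 * D)) (fun n => ?_)
      (Eventually.of_forall fun i n => ?_)
    · simpa using this
    · have h1 : Tendsto (fun i => (1 + ‖n‖) ^ k * ‖(φ i (-n) - ψ (-n)) * x.1 n‖) atTop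
          (𝓝 ((1 + ‖n‖) ^ k * ‖(ψ (-n) - ψ (-n)) * x.1 n‖)) :=
        ((((hl (-n)).sub_const _).mul_const _).norm).const_mul _
      rw [sub_self, zero_mul, norm_zero, mul_zero] at h1
      simpa only [hy] using h1
    · rw [Real.norm_of_nonneg (by positivity)]
      calc (1 + ‖n‖) ^ k * ‖(y i).1 n‖
          ≤ (1 + ‖n‖) ^ k * (2 * (D * (1 + ‖n‖) ^ N) * ‖x.1 n‖) := by
            gcongr
            exact hbd i n
        _ = 2 * D * ((1 + ‖n‖) ^ (k + N) * ‖x.1 n‖) := by rw [pow_add]; ring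
  rw [tendsto_iff_norm_sub_tendsto_zero]
  refine squeeze_zero (g := fun i => |C| * ((2 * Real.pi) ^ k
    * ∑' n, (1 + ‖n‖) ^ k * ‖(y i).1 n‖)) (fun _ => norm_nonneg _) (fun i => ?_) ?_
  · have e : (multiplier θ (φ i) (hφ i) F).1 x - (multiplier θ ψ hψ F).1 x = F.1 (y i) :=
      (map_sub F.1 _ _).symm
    rw [e]
    refine (hF (y i)).trans ?_
    calc C * (Schwartz.seminorm θ k (y i) : ℝ) ≤ |C| * (Schwartz.seminorm θ k (y i) : ℝ) := by
          gcongr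
          exact le_abs_self C
      _ ≤ _ := by
          gcongr
          exact seminorm_le_tsum θ k (y i)
  · have := (hsum.const_mul ((2 * Real.pi) ^ k)).const_mul |C|
    simpa using this

/-! ### Linear combinations and averages of translates -/

theorem hasLpNorm_zero (h1 : 1 ≤ p) : HasLpNorm θ p 0 0 := by
  have hz : ofOp θ 0 = 0 := by simpa using ofOp_smul θ 0 0
  by_cases hp : p = ∞
  · simp only [HasLpNorm, hp, if_true]
    exact ⟨0, zero_mem _, hz, norm_zero⟩
  · simp only [HasLpNorm, hp, if_false]
    have h0 : opLpNorm p (0 : HSpace d →L[ℂ] HSpace d) = 0 := by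
      simpa using opLpNorm_smul h1 hp 0 (0 : HSpace d →L[ℂ] HSpace d)
    refine ⟨fun _ => 0, fun _ => zero_mem _, fun ε hε => ⟨0, fun i _ j _ => ?_⟩, fun x => ?_, ?_⟩
    · rwa [sub_self, h0]
    · simp only [hz]
      exact tendsto_const_nhds
    · simp only [h0]
      exact tendsto_const_nhds

theorem memLp_sum_smul (h1 : 1 ≤ p) {ι : Type*} (T : Finset ι) (c : ι → ℂ)
    {F : ι → Distribution θ} (hF : ∀ i ∈ T, MemLp θ p (F i)) :
    MemLp θ p (∑ i ∈ T, c i • F i) ∧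
      lpNorm θ p (∑ i ∈ T, c i • F i) ≤ ∑ i ∈ T, ‖c i‖ₑ * lpNorm θ p (F i) := by
  classical
  induction T using Finset.induction_on with
  | empty =>
    refine ⟨⟨0, hasLpNorm_zero h1⟩, ?_⟩
    simpa using (hasLpNorm_zero (θ := θ) h1).lpNorm_le
  | insert i T hi ih =>
    obtain ⟨ih1, ih2⟩ := ih fun j hj => hF j (Finset.mem_insert_of_mem hj)
    have hi' := hF i (Finset.mem_insert_self i T)
    rw [Finset.sum_insert hi, Finset.sum_insert hi]
    exact ⟨(hi'.smul h1 _).add h1 ih1,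
      (lpNorm_add_le h1 _ _).trans (add_le_add (lpNorm_smul_le h1 _ hi') ih2)⟩

/-- Finite linear combinations of translations, as Fourier multipliers on `L_p`. -/
theorem memLp_multiplier_character (h1 : 1 ≤ p) {ι : Type*} (T : Finset ι) (c : ι → ℂ)
    (s : ι → Fin d → ℝ) {ψ : (Fin d → ℤ) → ℂ} (hψ : PolyGrowth ψ)
    (h : ∀ n, ψ n = ∑ i ∈ T, c i * (character (s i) n : ℂ)) {F : Distribution θ}
    (hF : MemLp θ p F) :
    MemLp θ p (multiplier θ ψ hψ F) ∧
      lpNorm θ p (multiplier θ ψ hψ F) ≤ (∑ i ∈ T, ‖c i‖ₑ) * lpNorm θ p F := by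
  rw [multiplier_sum T c (fun i => polyGrowth_character (s i)) hψ h F]
  obtain ⟨h2, h3⟩ := memLp_sum_smul h1 T c fun i (_ : i ∈ T) => hF.translate (s i)
  refine ⟨h2, h3.trans ?_⟩
  rw [Finset.sum_mul]
  gcongr with i _
  exact lpNorm_translate_le (s i) F

end

/-! ### Directional derivatives and difference operators -/

section

variable {d : ℕ} {θ : Matrix (Fin d) (Fin d) ℝ} {p : ℝ≥0∞}

/-- The symbol `2πi v·n` of the directional derivative along `v`. -/
def dirSymbol (v : EuclideanSpace ℝ (Fin d)) (n : Fin d → ℤ) : ℂ :=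
  2 * Real.pi * Complex.I * (∑ j, v j * n j : ℝ)

theorem dirSymbol_eq_sum (v : EuclideanSpace ℝ (Fin d)) (n : Fin d → ℤ) :
    dirSymbol v n = ∑ j, (v j : ℂ) * (2 * Real.pi * Complex.I * (n j : ℂ)) := by
  rw [dirSymbol]
  push_cast
  rw [Finset.mul_sum]
  exact Finset.sum_congr rfl fun j _ => by ring

theorem diffSymbol_eq (u : EuclideanSpace ℝ (Fin d)) (n : Fin d → ℤ) :
    diffSymbol u n = Complex.exp (dirSymbol u n) - 1 := rfl

theorem dirSymbol_eq_I_mul (v : EuclideanSpace ℝ (Fin d)) (n : Fin d → ℤ) :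
    dirSymbol v n = Complex.I * ((2 * Real.pi * ∑ j, v j * n j : ℝ) : ℂ) := by
  rw [dirSymbol]
  push_cast
  ring

theorem dirSymbol_pow (k : ℕ) (v : EuclideanSpace ℝ (Fin d)) (n : Fin d → ℤ) :
    dirSymbol v n ^ k = ∑ m ∈ indicesOfOrder d k,
      ((Nat.multinomial Finset.univ m : ℂ) * ∏ j, (v j : ℂ) ^ m j) * derivSymbol m n := by
  rw [dirSymbol_eq_sum, Finset.sum_pow_eq_sum_piAntidiag]
  refine Finset.sum_congr rfl fun m _ => ?_
  rw [derivSymbol, Finset.prod_congr rfl fun j _ => mul_pow (v j : ℂ) _ _, Finset.prod_mul_distrib]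
  exact (mul_assoc _ _ _).symm

theorem polyGrowth_dirSymbol_pow (k : ℕ) (v : EuclideanSpace ℝ (Fin d)) :
    PolyGrowth (dirSymbol v ^ k) := by
  refine PolyGrowth.pow ?_ k
  refine ⟨1, ∑ j, |v j| * (2 * Real.pi), fun n => ?_⟩
  rw [dirSymbol_eq_sum, Finset.sum_mul]
  refine (norm_sum_le _ _).trans ?_
  refine Finset.sum_le_sum fun j _ => ?_
  have h := norm_le_pi_norm n j
  rw [norm_mul, Complex.norm_real, Real.norm_eq_abs, pow_one, mul_assoc |v j|]
  refine mul_le_mul_of_nonneg_left ?_ (abs_nonneg (v j))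
  rw [norm_mul, norm_mul, norm_mul, Complex.norm_I, mul_one, Complex.norm_real,
    Real.norm_of_nonneg Real.pi_pos.le, Complex.norm_two, Complex.norm_intCast,
    ← Int.norm_eq_abs]
  nlinarith [Real.pi_pos]

/-- The `k`-th directional derivative along `v`. -/
def dirDeriv (θ : Matrix (Fin d) (Fin d) ℝ) (k : ℕ) (v : EuclideanSpace ℝ (Fin d)) :
    Distribution θ →ₗ[ℂ] Distribution θ :=
  multiplier θ (dirSymbol v ^ k) (polyGrowth_dirSymbol_pow k v)

theorem dirDeriv_eq_sum (k : ℕ) (v : EuclideanSpace ℝ (Fin d)) (x : Distribution θ) :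
    dirDeriv θ k v x = ∑ m ∈ indicesOfOrder d k,
      ((Nat.multinomial Finset.univ m : ℂ) * ∏ j, (v j : ℂ) ^ m j) • partialDeriv θ m x :=
  multiplier_sum _ _ polyGrowth_derivSymbol _ (fun n => dirSymbol_pow k v n) x

theorem tendsto_mul_exp_div_sub_one (z : ℂ) :
    Tendsto (fun j : ℕ => ((j : ℂ) + 1) * (Complex.exp (z / (j + 1)) - 1)) atTop (𝓝 z) := by
  have h : HasDerivAt (fun t : ℂ => Complex.exp (t * z)) z 0 := by
    have := ((hasDerivAt_id (0 : ℂ)).mul_const z).cexp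
    simpa using this
  have hs := h.tendsto_slope_zero
  have ht : Tendsto (fun j : ℕ => ((j : ℂ) + 1)⁻¹) atTop (𝓝[≠] 0) := by
    refine tendsto_nhdsWithin_iff.mpr ⟨?_, Eventually.of_forall fun j => ?_⟩
    · simpa [one_div] using tendsto_one_div_add_atTop_nhds_zero_nat (𝕜 := ℂ)
    · exact inv_ne_zero (Nat.cast_add_one_ne_zero j)
  refine (hs.comp ht).congr fun j => ?_
  simp only [Function.comp_apply, inv_inv, zero_add, zero_mul, Complex.exp_zero, smul_eq_mul]
  rw [div_eq_inv_mul]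

/-- The Riemann sums of `∫₀¹ exp(t z) dt`. -/
def riemannSum (j : ℕ) (z : ℂ) : ℂ :=
  ∑ l ∈ Finset.range (j + 1), ((j : ℂ) + 1)⁻¹ * Complex.exp (z / (j + 1)) ^ l

theorem riemannSum_mul (j : ℕ) (z : ℂ) :
    riemannSum j z * (((j : ℂ) + 1) * (Complex.exp (z / (j + 1)) - 1)) = Complex.exp z - 1 := by
  have h0 : (j : ℂ) + 1 ≠ 0 := Nat.cast_add_one_ne_zero j
  rw [riemannSum, ← Finset.mul_sum, mul_mul_mul_comm, inv_mul_cancel₀ h0, one_mul, geom_sum_mul,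
    ← Complex.exp_nat_mul]
  congr 2
  push_cast
  field_simp

theorem norm_exp_div_eq_one (t : ℝ) (j : ℕ) :
    ‖Complex.exp (Complex.I * t / ((j : ℂ) + 1))‖ = 1 := by
  rw [show Complex.I * t / ((j : ℂ) + 1) = ((t / (j + 1) : ℝ) : ℂ) * Complex.I by
    push_cast; ring, Complex.norm_exp_ofReal_mul_I]

theorem norm_riemannSum_le (t : ℝ) (j : ℕ) : ‖riemannSum j (Complex.I * t)‖ ≤ 1 := by
  refine (norm_sum_le _ _).trans (le_of_eq ?_)
  have h : ∀ l ∈ Finset.range (j + 1),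
      ‖((j : ℂ) + 1)⁻¹ * Complex.exp (Complex.I * t / (j + 1)) ^ l‖ = ((j : ℝ) + 1)⁻¹ := by
    intro l _
    rw [norm_mul, norm_pow, norm_exp_div_eq_one, one_pow, mul_one, norm_inv]
    congr 1
    exact_mod_cast Complex.norm_natCast (j + 1)
  rw [Finset.sum_congr rfl h, Finset.sum_const, Finset.card_range, nsmul_eq_mul]
  push_cast
  exact mul_inv_cancel₀ (by positivity)

/-- With N = j + 1, the Riemann sum times N(e^{z/N} - 1) is exactly e^z - 1, by the geometric sum.
Replacing that factor by its limit z costs nothing asymptotically, the sums being bounded by 1 for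
imaginary z. -/
theorem tendsto_riemannSum_mul (t : ℝ) :
    Tendsto (fun j => riemannSum j (Complex.I * t) * (Complex.I * t)) atTop
      (𝓝 (Complex.exp (Complex.I * t) - 1)) := by
  set z : ℂ := Complex.I * t with hz
  have h0 : Tendsto (fun j : ℕ => riemannSum j z
      * (z - ((j : ℂ) + 1) * (Complex.exp (z / (j + 1)) - 1))) atTop (𝓝 0) := by
    have h1 := (tendsto_mul_exp_div_sub_one z).const_sub z
    rw [sub_self] at h1
    refine squeeze_zero_norm (fun j => ?_) (tendsto_zero_iff_norm_tendsto_zero.mp h1)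
    rw [norm_mul]
    exact mul_le_of_le_one_left (norm_nonneg _) (norm_riemannSum_le t j)
  have h2 := h0.const_add (Complex.exp z - 1)
  rw [add_zero] at h2
  refine h2.congr fun j => ?_
  rw [mul_sub, riemannSum_mul]
  ring

theorem character_riemann (u : EuclideanSpace ℝ (Fin d)) (j l : ℕ) (n : Fin d → ℤ) :
    Complex.exp (dirSymbol u n / (j + 1)) ^ l
      = (character (fun i => (l : ℝ) / (j + 1) * u i) n : ℂ) := by
  rw [character, Circle.coe_exp, ← Complex.exp_nat_mul, dirSymbol]
  congr 1
  simp only [mul_assoc, ← Finset.mul_sum]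
  push_cast
  ring

theorem iterate_diff_eq (k : ℕ) (u : EuclideanSpace ℝ (Fin d)) (x : Distribution θ) :
    (diff θ u)^[k] x
      = multiplier θ (diffSymbol u ^ k) ((polyGrowth_diffSymbol u).pow k) x :=
  multiplier_iterate _ k x

theorem MemLp.iterate_diff (h1 : 1 ≤ p) {x : Distribution θ} (hx : MemLp θ p x) (k : ℕ)
    (u : EuclideanSpace ℝ (Fin d)) : MemLp θ p ((diff θ u)^[k] x) := by
  induction k with
  | zero => exact hx
  | succ k ih =>
    rw [Function.iterate_succ_apply']
    refine (memLp_multiplier_character h1 (Finset.univ : Finset Bool) (fun b => if b then 1 else -1)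
      (fun b => if b then fun i => u i else 0) (polyGrowth_diffSymbol u) (fun n => ?_) ih).1
    have h := character_riemann u 0 1 n
    simp only [Nat.cast_zero, zero_add, Nat.cast_one, div_one, pow_one, one_mul] at h
    rw [diffSymbol_eq, h]
    simp [character, sub_eq_add_neg]

/-- The difference operator is bounded by the directional derivative. -/
theorem lpNorm_iterate_diff_le (h1 : 1 ≤ p) {x : Distribution θ} (hx : MemLp θ p x) (k : ℕ)
    (u : EuclideanSpace ℝ (Fin d)) (hu : MemLp θ p (dirDeriv θ k u x)) :
    lpNorm θ p ((diff θ u)^[k] x) ≤ lpNorm θ p (dirDeriv θ k u x) := by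
  -- Each R_j is an average of j + 1 translations, hence a contraction of L_p. Its k-th power
  -- composed with the directional derivative tends to Δ_u^k.
  let R : ℕ → (Fin d → ℤ) → ℂ := fun j n => riemannSum j (dirSymbol u n)
  have R1 : ∀ j n, ‖R j n‖ ≤ 1 := fun j n => by
    simp only [R, dirSymbol_eq_I_mul]
    exact norm_riemannSum_le _ j
  have Rp : ∀ j, PolyGrowth (R j) := fun j => polyGrowth_of_norm_le (R1 j)
  have step : ∀ j (F : Distribution θ), MemLp θ p F →
      MemLp θ p (multiplier θ (R j) (Rp j) F) ∧
        lpNorm θ p (multiplier θ (R j) (Rp j) F) ≤ lpNorm θ p F := by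
    intro j F hF
    obtain ⟨h2, h3⟩ := memLp_multiplier_character h1 (Finset.range (j + 1))
      (fun _ => ((j : ℂ) + 1)⁻¹) (fun l i => (l : ℝ) / (j + 1) * u i) (Rp j) (fun n => by
        simp only [R, riemannSum, character_riemann]) hF
    refine ⟨h2, h3.trans (le_of_eq ?_)⟩
    have e : ‖((j : ℂ) + 1)⁻¹‖ₑ = ((j + 1 : ℕ) : ℝ≥0∞)⁻¹ := by
      rw [enorm_inv (Nat.cast_add_one_ne_zero j)]
      congr 1
      rw [← ofReal_norm, show ((j : ℂ) + 1) = ((j + 1 : ℕ) : ℂ) by push_cast; rfl,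
        Complex.norm_natCast, ENNReal.ofReal_natCast]
    rw [Finset.sum_const, Finset.card_range, nsmul_eq_mul, e,
      ENNReal.mul_inv_cancel (by simp) (ENNReal.natCast_ne_top _), one_mul]
  have iter : ∀ j i, MemLp θ p ((multiplier θ (R j) (Rp j))^[i] (dirDeriv θ k u x)) ∧
      lpNorm θ p ((multiplier θ (R j) (Rp j))^[i] (dirDeriv θ k u x))
        ≤ lpNorm θ p (dirDeriv θ k u x) := by
    intro j i
    induction i with
    | zero => exact ⟨hu, le_rfl⟩
    | succ i ih =>
      rw [Function.iterate_succ_apply']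
      obtain ⟨h2, h3⟩ := step j _ ih.1
      exact ⟨h2, h3.trans ih.2⟩
  refine lpNorm_le_of_tendsto h1 (hx.iterate_diff h1 k u) (fun j => (iter j k).2) fun y => ?_
  simp only [multiplier_iterate, dirDeriv, multiplier_multiplier]
  rw [iterate_diff_eq]
  refine tendsto_multiplier _ _ (polyGrowth_dirSymbol_pow k u) (fun j n => ?_) (fun n => ?_) x y
  · rw [Pi.mul_apply, norm_mul, Pi.pow_apply, norm_pow]
    exact mul_le_of_le_one_left (norm_nonneg _) (pow_le_one₀ (norm_nonneg _) (R1 j n))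
  · simp only [Pi.mul_apply, Pi.pow_apply, ← mul_pow]
    refine Tendsto.pow ?_ k
    simp only [R, diffSymbol_eq, dirSymbol_eq_I_mul]
    exact tendsto_riemannSum_mul _

theorem abs_coord_le_norm (v : EuclideanSpace ℝ (Fin d)) (j : Fin d) : |v j| ≤ ‖v‖ := by
  rw [← Real.norm_eq_abs]
  exact PiLp.norm_apply_le v j

theorem lpNorm_dirDeriv_le (h1 : 1 ≤ p) {k : ℕ} {x : Distribution θ}
    (hx : ∀ m ∈ indicesOfOrder d k, MemLp θ p (partialDeriv θ m x))
    (v : EuclideanSpace ℝ (Fin d)) :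
    MemLp θ p (dirDeriv θ k v x) ∧ lpNorm θ p (dirDeriv θ k v x)
      ≤ ENNReal.ofReal (‖v‖ ^ k) * ∑ m ∈ indicesOfOrder d k,
        (Nat.multinomial Finset.univ m : ℝ≥0∞) * lpNorm θ p (partialDeriv θ m x) := by
  rw [dirDeriv_eq_sum]
  obtain ⟨h2, h3⟩ := memLp_sum_smul h1 (indicesOfOrder d k)
    (fun m => (Nat.multinomial Finset.univ m : ℂ) * ∏ j, (v j : ℂ) ^ m j) hx
  refine ⟨h2, h3.trans ?_⟩
  rw [Finset.mul_sum]
  refine Finset.sum_le_sum fun m hm => ?_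
  rw [← mul_assoc]
  refine mul_le_mul_left ?_ _
  have hk : ∑ j, m j = k := by simpa [indicesOfOrder] using hm
  rw [← ofReal_norm, norm_mul, Complex.norm_natCast, ENNReal.ofReal_mul (Nat.cast_nonneg _),
    ENNReal.ofReal_natCast, mul_comm]
  refine mul_le_mul_left (ENNReal.ofReal_le_ofReal ?_) _
  rw [norm_prod, ← hk, ← Finset.prod_pow_eq_pow_sum]
  refine Finset.prod_le_prod (fun _ _ => norm_nonneg _) fun j _ => ?_
  rw [norm_pow, Complex.norm_real, Real.norm_eq_abs]
  exact pow_le_pow_left₀ (abs_nonneg _) (abs_coord_le_norm v j) _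

theorem lpNorm_iterate_diff_le_lipschitz {k : ℕ} (x : Distribution θ)
    {u : EuclideanSpace ℝ (Fin d)} (hu : u ≠ 0) :
    lpNorm θ p ((diff θ u)^[k] x)
      ≤ lipschitzSeminorm θ k p x * ENNReal.ofReal (‖u‖ ^ k) := by
  have h0 : 0 < ‖u‖ := norm_pos_iff.mpr hu
  have h1 : modulus θ k p x ‖u‖ / ENNReal.ofReal (‖u‖ ^ k) ≤ lipschitzSeminorm θ k p x :=
    le_iSup₂ (f := fun (ε : ℝ) (_ : 0 < ε) => modulus θ k p x ε / ENNReal.ofReal (ε ^ k)) ‖u‖ h0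
  have h2 : lpNorm θ p ((diff θ u)^[k] x) ≤ modulus θ k p x ‖u‖ :=
    le_iSup₂ (f := fun (u : EuclideanSpace ℝ (Fin d)) (_ : 0 < ‖u‖ ∧ ‖u‖ ≤ _) =>
      lpNorm θ p ((diff θ u)^[k] x)) u ⟨h0, le_rfl⟩
  rw [ENNReal.div_le_iff (ENNReal.ofReal_pos.mpr (pow_pos h0 k)).ne' ENNReal.ofReal_ne_top] at h1
  exact h2.trans h1

/-- Directional derivatives are limits of difference quotients whose norms are controlled by the
Lipschitz seminorm. -/
theorem exists_tendsto_dirDeriv (h1 : 1 ≤ p) {k : ℕ} (hk : 1 ≤ k) {x : Distribution θ}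
    (hx : MemLp θ p x) (v : EuclideanSpace ℝ (Fin d)) :
    ∃ G : ℕ → Distribution θ,
      (∀ j, lpNorm θ p (G j) ≤ lipschitzSeminorm θ k p x * ENNReal.ofReal (‖v‖ ^ k)) ∧
      ∀ y, Tendsto (fun j => (G j).1 y) atTop (𝓝 ((dirDeriv θ k v x).1 y)) := by
  let t : ℕ → ℝ := fun j => ((j : ℝ) + 1)⁻¹
  have t0 : ∀ j, 0 < t j := fun j => by positivity
  have hsym : ∀ j n, dirSymbol (t j • v) n = dirSymbol v n / ((j : ℂ) + 1) := fun j n => by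
    simp only [dirSymbol, t, PiLp.smul_apply, smul_eq_mul, mul_assoc, ← Finset.mul_sum]
    push_cast
    ring
  let c : ℕ → ℂ := fun j => ((j : ℂ) + 1) ^ k
  have hc : ∀ j, ‖c j‖ₑ = ENNReal.ofReal ((t j)⁻¹ ^ k) := fun j => by
    rw [← ofReal_norm]
    congr 1
    simp only [c, t, inv_inv, norm_pow]
    congr 1
    exact_mod_cast Complex.norm_natCast (j + 1)
  refine ⟨fun j => c j • (diff θ (t j • v))^[k] x, fun j => ?_, fun y => ?_⟩
  · refine (lpNorm_smul_le h1 _ (hx.iterate_diff h1 k _)).trans ?_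
    -- The modulus excludes u = 0, so the zero direction is separate: there Δ^k vanishes because k ≠
    -- 0.
    rcases eq_or_ne v 0 with rfl | hv
    · have hz : (diff θ (t j • (0 : EuclideanSpace ℝ (Fin d))))^[k] x = (0 : ℂ) • x := by
        rw [iterate_diff_eq]
        refine Subtype.ext (LinearMap.ext fun y => ?_)
        have e : Schwartz.multiplier (fun n => (diffSymbol (t j • (0 : EuclideanSpace ℝ (Fin d))) ^ k)
            (-n)) ((polyGrowth_diffSymbol _).pow k).reflect y = 0 := by
          refine Subtype.ext (funext fun n => ?_)
          change (diffSymbol _ (-n)) ^ k * y.1 n = 0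
          rw [diffSymbol_eq, hsym]
          simp [dirSymbol, show k ≠ 0 by omega]
        change x.1 (Schwartz.multiplier _ _ y) = (0 : ℂ) * x.1 y
        rw [e, map_zero, zero_mul]
      rw [hz]
      refine (mul_le_mul_right (lpNorm_smul_le h1 0 hx) _).trans ?_
      simp
    · refine (mul_le_mul_right (lpNorm_iterate_diff_le_lipschitz x
        (smul_ne_zero (t0 j).ne' hv)) _).trans (le_of_eq ?_)
      rw [hc, mul_left_comm, ← ENNReal.ofReal_mul (by positivity), ← mul_pow, norm_smul,
        Real.norm_of_nonneg (t0 j).le, inv_mul_cancel_left₀ (t0 j).ne']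
  · let φ : ℕ → (Fin d → ℤ) → ℂ := fun j n =>
      (((j : ℂ) + 1) * (Complex.exp (dirSymbol v n / (j + 1)) - 1)) ^ k
    -- From |e^{is} - 1| ≤ |s|: the difference quotients are dominated by the symbol of their limit.
    have hb : ∀ j n, ‖φ j n‖ ≤ ‖(dirSymbol v ^ k) n‖ := by
      intro j n
      rw [Pi.pow_apply, norm_pow, norm_pow]
      refine pow_le_pow_left₀ (norm_nonneg _) ?_ k
      have hj : ‖(j : ℂ) + 1‖ = (j : ℝ) + 1 := by exact_mod_cast Complex.norm_natCast (j + 1)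
      set s : ℝ := 2 * Real.pi * ∑ i, v i * n i with hs
      rw [dirSymbol_eq_I_mul, ← hs, norm_mul, hj,
        show Complex.I * (s : ℂ) / ((j : ℂ) + 1) = Complex.I * ((s / (j + 1) : ℝ) : ℂ) by
          push_cast; ring]
      have h2 := Real.norm_exp_I_mul_ofReal_sub_one_le (x := s / (j + 1))
      rw [norm_div, Real.norm_of_nonneg (show (0 : ℝ) ≤ j + 1 by positivity),
        le_div_iff₀ (by positivity)] at h2
      rw [norm_mul, Complex.norm_I, one_mul, Complex.norm_real]
      linarith
    have hφ : ∀ j, PolyGrowth (φ j) := fun j => (polyGrowth_dirSymbol_pow k v).mono (hb j)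
    have he : ∀ j, c j • (diff θ (t j • v))^[k] x = multiplier θ (φ j) (hφ j) x := by
      intro j
      rw [iterate_diff_eq]
      have := multiplier_sum (θ := θ) (Finset.univ : Finset Unit) (fun _ => c j)
        (fun _ => (polyGrowth_diffSymbol (t j • v)).pow k) (hφ j) (fun n => by
          simp only [φ, c, Finset.univ_unique, Finset.sum_singleton, Pi.pow_apply, mul_pow,
            diffSymbol_eq, hsym]) x
      simpa using this.symm
    simp only [he]
    refine tendsto_multiplier hφ _ (polyGrowth_dirSymbol_pow k v) hb (fun n => ?_) x y
    exact (tendsto_mul_exp_div_sub_one _).pow k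

end

/-! ### Polarization -/

section

variable {d : ℕ} {θ : Matrix (Fin d) (Fin d) ℝ} {p : ℝ≥0∞}

/-- Inclusion–exclusion: the sum is the expansion of a product over i of factors -1 (i in R) and 0
(i outside R). -/
theorem sum_neg_one_pow_card_of_subset {ι : Type*} [Fintype ι] [DecidableEq ι] (R : Finset ι) :
    ∑ S : Finset ι, (-1 : ℂ) ^ S.card * (if R ⊆ S then 1 else 0)
      = if R = Finset.univ then (-1) ^ Fintype.card ι else 0 := by
  have h := Finset.prod_add (fun _ : ι => (-1 : ℂ)) (fun i => if i ∉ R then 1 else 0) Finset.univ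
  have h2 : ∀ i : ι, ((-1 : ℂ) + if i ∉ R then 1 else 0) = if i ∈ R then -1 else 0 := by
    intro i
    by_cases hi : i ∈ R <;> simp [hi]
  simp only [h2, Finset.prod_ite_zero, Finset.prod_const, Finset.powerset_univ,
    Finset.card_univ, one_pow, Finset.mem_univ, true_imp_iff,
    Finset.mem_sdiff, true_and] at h
  simp only [Finset.eq_univ_iff_forall, h, Finset.subset_iff, not_imp_not]

/-- A product is a linear combination of powers of sums of its factors. -/
theorem exists_prod_eq_sum_pow (ι : Type*) [Fintype ι] [DecidableEq ι] :
    ∃ c : Finset ι → ℂ, ∀ y : ι → ℂ,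
      ∏ i, y i = ∑ S, c S * (∑ i ∈ S, y i) ^ Fintype.card ι := by
  -- Expanding the powers gives monomials indexed by maps ι → ι; the signed sum over S keeps only
  -- the surjective ones, that is the permutations, each contributing the full product.
  let B : Finset (ι → ι) := Finset.univ.filter fun f => Finset.univ.image f = Finset.univ
  let K : ℂ := (-1) ^ Fintype.card ι * B.card
  have hK : K ≠ 0 := mul_ne_zero (pow_ne_zero _ (by norm_num))
    (Nat.cast_ne_zero.mpr (Finset.card_ne_zero.mpr ⟨id, by simp [B]⟩))
  refine ⟨fun S => K⁻¹ * (-1) ^ S.card, fun y => ?_⟩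
  have hS : ∀ S : Finset ι, (∑ i ∈ S, y i) ^ Fintype.card ι
      = ∑ f : ι → ι, (if Finset.univ.image f ⊆ S then 1 else 0) * ∏ a, y (f a) := by
    intro S
    rw [← Finset.card_univ, ← Finset.prod_const, Finset.prod_univ_sum]
    simp only [ite_mul, one_mul, zero_mul]
    rw [← Finset.sum_filter]
    refine Finset.sum_congr ?_ fun _ _ => rfl
    ext f
    simp [Finset.image_subset_iff]
  have hB : ∀ f ∈ B, ∏ a, y (f a) = ∏ a, y a := by
    intro f hf
    have hs : Function.Surjective f := fun b => by
      have : b ∈ Finset.univ.image f := by rw [(Finset.mem_filter.mp hf).2]; exact Finset.mem_univ b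
      simpa using this
    exact Function.Bijective.prod_comp ⟨Finite.injective_iff_surjective.mpr hs, hs⟩ y
  have key : ∑ S : Finset ι, (-1 : ℂ) ^ S.card * (∑ i ∈ S, y i) ^ Fintype.card ι
      = K * ∏ i, y i := by
    simp only [hS, Finset.mul_sum, ← mul_assoc]
    rw [Finset.sum_comm]
    simp only [← Finset.sum_mul, sum_neg_one_pow_card_of_subset, ite_mul, zero_mul]
    rw [← Finset.sum_filter, ← Finset.mul_sum, Finset.sum_congr rfl hB, Finset.sum_const,
      nsmul_eq_mul, mul_assoc]
  simp only [mul_assoc, ← Finset.mul_sum]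
  rw [key, inv_mul_cancel_left₀ hK]

/-- A partial derivative of order `k` is a linear combination of `k`-th directional derivatives. -/
theorem exists_partialDeriv_eq_sum_dirDeriv (k : ℕ) {m : Fin d → ℕ} (hm : ∑ j, m j = k) :
    ∃ (T : Finset (EuclideanSpace ℝ (Fin d))) (c : EuclideanSpace ℝ (Fin d) → ℂ),
      ∀ (θ : Matrix (Fin d) (Fin d) ℝ) (x : Distribution θ),
        partialDeriv θ m x = ∑ v ∈ T, c v • dirDeriv θ k v x := by
  classical
  obtain ⟨c, hc⟩ := exists_prod_eq_sum_pow (Σ j : Fin d, Fin (m j))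
  -- The k factors of the symbol of D^m are indexed by pairs (j, i) with i < m_j, and a sum of
  -- factors over S is the symbol of the direction v(S). Distinct S may give the same vector, so
  -- coefficients are collected over the fibres of v.
  let v : Finset (Σ j : Fin d, Fin (m j)) → EuclideanSpace ℝ (Fin d) := fun S =>
    ∑ i ∈ S, EuclideanSpace.single i.1 1
  refine ⟨Finset.univ.image v, fun w => ∑ S with v S = w, c S, fun θ x => ?_⟩
  refine multiplier_sum _ _ (fun w => polyGrowth_dirSymbol_pow k w) _ (fun n => ?_) x
  have hv : ∀ S, ∑ i ∈ S, 2 * (Real.pi : ℂ) * Complex.I * (n i.1 : ℂ) = dirSymbol (v S) n := by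
    intro S
    rw [dirSymbol_eq_sum]
    simp only [v, WithLp.ofLp_sum, Finset.sum_apply, Complex.ofReal_sum, Finset.sum_mul]
    rw [Finset.sum_comm]
    refine Finset.sum_congr rfl fun i _ => ?_
    rw [Finset.sum_eq_single i.1]
    · simp
    · intro j _ hj
      simp [hj]
    · simp
  have h1 : derivSymbol m n
      = ∏ i : Σ j : Fin d, Fin (m j), (2 * (Real.pi : ℂ) * Complex.I * (n i.1 : ℂ)) := by
    rw [Fintype.prod_sigma, derivSymbol]
    simp
  rw [h1, hc]
  simp only [hv, Fintype.card_sigma, Fintype.card_fin, hm, Finset.sum_mul]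
  rw [← Finset.sum_fiberwise_of_maps_to (t := Finset.univ.image v) (g := v)
    fun S _ => Finset.mem_image_of_mem v (Finset.mem_univ S)]
  refine Finset.sum_congr rfl fun w _ => Finset.sum_congr rfl fun S hS => ?_
  rw [(Finset.mem_filter.mp hS).2, Pi.pow_apply]

end

/-! ### Sobolev spaces and Lipschitz classes -/

section

variable {d : ℕ} {θ : Matrix (Fin d) (Fin d) ℝ} {p : ℝ≥0∞} {k : ℕ} {x : Distribution θ}

theorem mem_indicesOfOrder {m : Fin d → ℕ} : m ∈ indicesOfOrder d k ↔ ∑ j, m j = k := by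
  simp [indicesOfOrder]

theorem partialDeriv_zero (x : Distribution θ) : partialDeriv θ 0 x = x := by
  have h : derivSymbol (0 : Fin d → ℕ) = 1 := by
    ext n
    simp [derivSymbol]
  rw [partialDeriv, multiplier_congr h _ (polyGrowth_of_norm_le (B := 1) fun n => by simp),
    multiplier_one]

theorem MemSobolev.memLp (hx : MemSobolev θ k p x) : MemLp θ p x := by
  have := hx 0 (mem_indicesUpTo.mpr (by simp))
  rwa [partialDeriv_zero] at this

theorem MemSobolev.memLp_partialDeriv (hx : MemSobolev θ k p x) {m : Fin d → ℕ}
    (hm : m ∈ indicesOfOrder d k) : MemLp θ p (partialDeriv θ m x) :=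
  hx m (mem_indicesUpTo.mpr (mem_indicesOfOrder.mp hm).le)

theorem lpNorm_partialDeriv_le_sobolevSeminorm (h1 : 1 ≤ p) (x : Distribution θ) {m : Fin d → ℕ}
    (hm : m ∈ indicesOfOrder d k) : lpNorm θ p (partialDeriv θ m x) ≤ sobolevSeminorm θ k p x := by
  by_cases hp : p = ∞
  · rw [sobolevSeminorm, if_pos hp]
    exact Finset.le_sup (f := fun m => lpNorm θ p (partialDeriv θ m x)) hm
  · have h0 : 0 < p.toReal := zero_lt_one.trans_le (one_le_toReal h1 hp)
    rw [sobolevSeminorm, if_neg hp, one_div, ENNReal.le_rpow_inv_iff h0]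
    exact Finset.single_le_sum (f := fun m => lpNorm θ p (partialDeriv θ m x) ^ p.toReal)
      (fun _ _ => zero_le) hm

/-- The p-th root of the number of terms is at most that number plus 1, a constant free of p; adding
1 ensures it is at least 1. -/
theorem sobolevSeminorm_le (h1 : 1 ≤ p) {B : ℝ≥0∞}
    (h : ∀ m ∈ indicesOfOrder d k, lpNorm θ p (partialDeriv θ m x) ≤ B) :
    sobolevSeminorm θ k p x ≤ ((indicesOfOrder d k).card + 1 : ℕ) * B := by
  have hc : (1 : ℝ≥0∞) ≤ ((indicesOfOrder d k).card + 1 : ℕ) := by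
    exact_mod_cast Nat.le_add_left 1 _
  by_cases hp : p = ∞
  · rw [sobolevSeminorm, if_pos hp]
    exact (Finset.sup_le h).trans (le_mul_of_one_le_left zero_le hc)
  · have h2 := one_le_toReal h1 hp
    have h0 : 0 < p.toReal := zero_lt_one.trans_le h2
    rw [sobolevSeminorm, if_neg hp, one_div, ENNReal.rpow_inv_le_iff h0,
      ENNReal.mul_rpow_of_nonneg _ _ h0.le]
    calc ∑ m ∈ indicesOfOrder d k, lpNorm θ p (partialDeriv θ m x) ^ p.toReal
        ≤ ∑ _m ∈ indicesOfOrder d k, B ^ p.toReal :=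
          Finset.sum_le_sum fun m hm => ENNReal.rpow_le_rpow (h m hm) h0.le
      _ = ((indicesOfOrder d k).card : ℝ≥0∞) * B ^ p.toReal := by
          rw [Finset.sum_const, nsmul_eq_mul]
      _ ≤ _ := by
          refine mul_le_mul_left ?_ _
          refine le_trans ?_ (ENNReal.le_rpow_self_of_one_le hc h2)
          exact_mod_cast Nat.le_succ _

theorem lipschitzSeminorm_le (h1 : 1 ≤ p) (hx : MemSobolev θ k p x) :
    lipschitzSeminorm θ k p x ≤ ∑ m ∈ indicesOfOrder d k,
      (Nat.multinomial Finset.univ m : ℝ≥0∞) * lpNorm θ p (partialDeriv θ m x) := by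
  refine iSup₂_le fun ε hε => ?_
  rw [ENNReal.div_le_iff (ENNReal.ofReal_pos.mpr (pow_pos hε k)).ne' ENNReal.ofReal_ne_top]
  refine iSup₂_le fun u hu => ?_
  obtain ⟨h2, h3⟩ := lpNorm_dirDeriv_le h1 (fun m hm => hx.memLp_partialDeriv hm) u
  refine (lpNorm_iterate_diff_le h1 hx.memLp k u h2).trans (h3.trans ?_)
  rw [mul_comm]
  exact mul_le_mul_right (ENNReal.ofReal_le_ofReal (pow_le_pow_left₀ (norm_nonneg u) hu.2 k)) _

theorem lpNorm_dirDeriv_le_lipschitzSeminorm (h1 : 1 ≤ p) (hk : 1 ≤ k) (hx : MemSobolev θ k p x)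
    (v : EuclideanSpace ℝ (Fin d)) : lpNorm θ p (dirDeriv θ k v x)
      ≤ lipschitzSeminorm θ k p x * ENNReal.ofReal (‖v‖ ^ k) := by
  obtain ⟨G, hG, hlim⟩ := exists_tendsto_dirDeriv h1 hk hx.memLp v
  exact lpNorm_le_of_tendsto h1 (lpNorm_dirDeriv_le h1 (fun m hm => hx.memLp_partialDeriv hm) v).1
    hG hlim

/-- The order of quantifiers is the point: polarization fixes the directions and coefficients before
θ, p and x are chosen. -/
theorem exists_lpNorm_partialDeriv_le (hk : 1 ≤ k) {m : Fin d → ℕ} (hm : ∑ j, m j = k) :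
    ∃ A : ℝ≥0, ∀ (θ : Matrix (Fin d) (Fin d) ℝ) (p : ℝ≥0∞), 1 ≤ p → ∀ x : Distribution θ,
      MemSobolev θ k p x →
        lpNorm θ p (partialDeriv θ m x) ≤ A * lipschitzSeminorm θ k p x := by
  obtain ⟨T, c, hT⟩ := exists_partialDeriv_eq_sum_dirDeriv k hm
  refine ⟨∑ v ∈ T, ‖c v‖₊ * Real.toNNReal (‖v‖ ^ k), fun θ p h1 x hx => ?_⟩
  rw [hT]
  refine (memLp_sum_smul h1 T c fun v _ =>
    (lpNorm_dirDeriv_le h1 (fun m hm => hx.memLp_partialDeriv hm) v).1).2.trans ?_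
  push_cast
  rw [Finset.sum_mul]
  refine Finset.sum_le_sum fun v _ => ?_
  rw [mul_assoc, mul_comm (Real.toNNReal _ : ℝ≥0∞)]
  exact mul_le_mul_right (lpNorm_dirDeriv_le_lipschitzSeminorm h1 hk hx v) _

/-- No Sobolev membership is assumed: for p = ∞ compactness yields the membership of the limit as
well as its bound. -/
theorem MemLipschitz.memLp_partialDeriv (hk : 1 ≤ k) (hx : MemLipschitz θ k x) {m : Fin d → ℕ}
    (hm : ∑ j, m j = k) : MemLp θ ∞ (partialDeriv θ m x) := by
  obtain ⟨T, c, hT⟩ := exists_partialDeriv_eq_sum_dirDeriv k hm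
  rw [hT]
  refine (memLp_sum_smul le_top T c fun v _ => ?_).1
  obtain ⟨G, hG, hlim⟩ := exists_tendsto_dirDeriv le_top hk hx.1 v
  exact (lpNorm_top_le_of_tendsto (ENNReal.mul_ne_top hx.2.ne ENNReal.ofReal_ne_top) hG hlim).1

/-! ### Derivatives of lower order: inverting ∂_j by discrete sawtooth functions. -/

theorem sum_natCast_mul_pow (w : ℂ) (N : ℕ) :
    (∑ l ∈ Finset.range N, (l : ℂ) * w ^ l) * (w - 1)
      = N * w ^ N - w * ∑ l ∈ Finset.range N, w ^ l := by
  induction N with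
  | zero => simp
  | succ N ih =>
    rw [Finset.sum_range_succ, Finset.sum_range_succ, add_mul, ih]
    push_cast
    ring

/-- Discrete sawtooth functions, which invert the derivation `∂_j` on frequencies `n_j ≠ 0`. -/
def sawtooth (N : ℕ) (a : ℤ) : ℂ :=
  ∑ l ∈ Finset.range N, (l : ℂ) / N ^ 2 * (Complex.exp (2 * Real.pi * Complex.I / N) ^ a) ^ l

/-- With N = i + 1 and w = e^{2πi a/N}, an N-th root of unity eventually different from 1, summation
by parts gives the value 1/(N(w - 1)), and N(w - 1) tends to 2πi a. -/
theorem tendsto_sawtooth {a : ℤ} (ha : a ≠ 0) :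
    Tendsto (fun i : ℕ => sawtooth (i + 1) a) atTop (𝓝 (2 * Real.pi * Complex.I * a)⁻¹) := by
  have hz : 2 * Real.pi * Complex.I * (a : ℂ) ≠ 0 :=
    mul_ne_zero Complex.two_pi_I_ne_zero (Int.cast_ne_zero.mpr ha)
  have h := tendsto_mul_exp_div_sub_one (2 * Real.pi * Complex.I * a)
  refine (h.inv₀ hz).congr' ?_
  filter_upwards [h.eventually_ne hz] with i hi
  have hN : ((i : ℂ) + 1) ≠ 0 := Nat.cast_add_one_ne_zero i
  have hw : Complex.exp (2 * Real.pi * Complex.I * a / (i + 1))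
      = Complex.exp (2 * Real.pi * Complex.I / (i + 1 : ℕ)) ^ a := by
    rw [← Complex.exp_int_mul]
    congr 1
    push_cast
    ring
  rw [hw] at hi ⊢
  have hζ := (Complex.isPrimitiveRoot_exp (i + 1) i.succ_ne_zero).pow_eq_one
  set w : ℂ := Complex.exp (2 * Real.pi * Complex.I / (i + 1 : ℕ)) ^ a with hwdef
  have h1 : w - 1 ≠ 0 := right_ne_zero_of_mul hi
  have hwN : w ^ (i + 1) = 1 := by
    rw [hwdef, ← zpow_natCast, zpow_comm, zpow_natCast, hζ, one_zpow]
  have hg : ∑ l ∈ Finset.range (i + 1), w ^ l = 0 := by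
    have := geom_sum_mul w (i + 1)
    rw [hwN, sub_self] at this
    exact (mul_eq_zero.mp this).resolve_right h1
  have hs := sum_natCast_mul_pow w (i + 1)
  rw [hg, hwN, mul_zero, sub_zero, mul_one] at hs
  push_cast at hs
  refine inv_eq_of_mul_eq_one_right ?_
  rw [sawtooth]
  simp only [div_mul_eq_mul_div, ← Finset.sum_div]
  rw [← hwdef]
  push_cast
  field_simp
  linear_combination hs

theorem sum_enorm_sawtooth_le (i : ℕ) :
    ∑ l ∈ Finset.range (i + 1), ‖(l : ℂ) / ((i + 1 : ℕ) : ℂ) ^ 2‖ₑ ≤ 1 := by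
  have h : ∀ l ∈ Finset.range (i + 1),
      ‖(l : ℂ) / ((i + 1 : ℕ) : ℂ) ^ 2‖ₑ ≤ ENNReal.ofReal (((i + 1 : ℕ) : ℝ)⁻¹) := by
    intro l hl
    have hl' : (l : ℝ) ≤ ((i + 1 : ℕ) : ℝ) := by exact_mod_cast (Finset.mem_range.mp hl).le
    have h0 : (0 : ℝ) < ((i + 1 : ℕ) : ℝ) := by exact_mod_cast i.succ_pos
    rw [← ofReal_norm, norm_div, norm_pow, Complex.norm_natCast, Complex.norm_natCast]
    refine ENNReal.ofReal_le_ofReal ?_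
    rw [div_le_iff₀ (pow_pos h0 2), sq, inv_mul_cancel_left₀ h0.ne']
    exact hl'
  refine (Finset.sum_le_sum h).trans (le_of_eq ?_)
  rw [Finset.sum_const, Finset.card_range, nsmul_eq_mul, ← ENNReal.ofReal_natCast,
    ← ENNReal.ofReal_mul (Nat.cast_nonneg _), mul_inv_cancel₀ (by positivity), ENNReal.ofReal_one]

theorem derivSymbol_add_single (m : Fin d → ℕ) (j : Fin d) (n : Fin d → ℤ) :
    derivSymbol (m + Pi.single j 1) n = derivSymbol m n * (2 * Real.pi * Complex.I * n j) := by
  simp only [derivSymbol, Pi.add_apply, pow_add, Finset.prod_mul_distrib]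
  congr 1
  rw [Finset.prod_eq_single j]
  · simp
  · intro i _ hi
    simp [hi]
  · simp

/-- Sawtooth multipliers are uniformly bounded on L_∞ and convert the extra ∂_j into the identity
wherever n_j ≠ 0. Where n_j = 0 nothing is lost, since m_j ≠ 0 makes the symbol of D^m vanish. The
limit stays in L_∞ by weak compactness. -/
theorem memLp_partialDeriv_of_add_single {m : Fin d → ℕ} {j : Fin d} (hj : m j ≠ 0)
    (h : MemLp θ ∞ (partialDeriv θ (m + Pi.single j 1) x)) : MemLp θ ∞ (partialDeriv θ m x) := by
  have hb : ∀ (i : ℕ) (n : Fin d → ℤ), ‖sawtooth (i + 1) (n j)‖ ≤ 1 := by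
    intro i n
    have h2 := sum_enorm_sawtooth_le i
    rw [← ENNReal.ofReal_one, ← Finset.sum_congr rfl fun l _ => ofReal_norm _,
      ← ENNReal.ofReal_sum_of_nonneg fun _ _ => norm_nonneg _,
      ENNReal.ofReal_le_ofReal_iff zero_le_one] at h2
    refine (norm_sum_le _ _).trans (le_trans (le_of_eq ?_) h2)
    refine Finset.sum_congr rfl fun l _ => ?_
    rw [norm_mul, ← character_single, Circle.norm_coe, mul_one]
  have hs : ∀ i, PolyGrowth fun n : Fin d → ℤ => sawtooth (i + 1) (n j) := fun i =>
    polyGrowth_of_norm_le (hb i)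
  refine (lpNorm_top_le_of_tendsto (G := fun i => multiplier θ (fun n => sawtooth (i + 1) (n j))
    (hs i) (partialDeriv θ (m + Pi.single j 1) x)) h.lpNorm_lt_top.ne (fun i => ?_)
    fun y => ?_).1
  · refine (memLp_multiplier_character le_top (Finset.range (i + 1))
      (fun l => (l : ℂ) / ((i + 1 : ℕ) : ℂ) ^ 2) (fun l => Pi.single j ((l : ℝ) / (i + 1 : ℕ)))
      (hs i) (fun n => ?_) h).2.trans ?_
    · simp only [sawtooth, character_single]
    · exact (mul_le_mul_left (sum_enorm_sawtooth_le i) _).trans (one_mul _).le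
  · simp only [partialDeriv, multiplier_multiplier]
    refine tendsto_multiplier _ _ (polyGrowth_derivSymbol (m + Pi.single j 1))
      (fun i n => ?_) (fun n => ?_) x y
    · rw [Pi.mul_apply, norm_mul]
      exact mul_le_of_le_one_left (norm_nonneg _) (hb i n)
    · simp only [Pi.mul_apply, derivSymbol_add_single]
      by_cases hn : n j = 0
      · have : derivSymbol m n = 0 := Finset.prod_eq_zero (Finset.mem_univ j) (by simp [hn, hj])
        simp [this]
      · have hz : 2 * Real.pi * Complex.I * (n j : ℂ) ≠ 0 :=
          mul_ne_zero Complex.two_pi_I_ne_zero (Int.cast_ne_zero.mpr hn)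
        have := (tendsto_sawtooth hn).mul_const (derivSymbol m n * (2 * Real.pi * Complex.I * n j))
        rwa [mul_comm (derivSymbol m n), inv_mul_cancel_left₀ hz, mul_comm _ (derivSymbol m n)]
          at this

theorem MemLipschitz.memSobolev (hk : 1 ≤ k) (hx : MemLipschitz θ k x) : MemSobolev θ k ∞ x := by
  -- Descending induction on the order: i counts the derivatives missing to reach k. A nonzero m is
  -- raised in a direction where it is already nonzero; m = 0 is the hypothesis on x itself.
  have key : ∀ (i : ℕ) (m : Fin d → ℕ), ∑ j, m j + i = k → MemLp θ ∞ (partialDeriv θ m x) := by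
    intro i
    induction i with
    | zero => exact fun m hm => hx.memLp_partialDeriv hk hm
    | succ i ih =>
      intro m hm
      by_cases h0 : m = 0
      · rw [h0, partialDeriv_zero]
        exact hx.1
      · obtain ⟨j, hj⟩ := Function.ne_iff.mp h0
        refine memLp_partialDeriv_of_add_single hj (ih _ ?_)
        simp only [Pi.add_apply, Finset.sum_add_distrib, Finset.sum_pi_single', Finset.mem_univ,
          if_true]
        omega
  intro m hm
  have := mem_indicesUpTo.mp hm
  exact key (k - ∑ j, m j) m (by omega)

theorem MemSobolev.memLipschitz (hx : MemSobolev θ k ∞ x) : MemLipschitz θ k x := by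
  refine ⟨hx.memLp, (lipschitzSeminorm_le le_top hx).trans_lt ?_⟩
  exact ENNReal.sum_lt_top.mpr fun m hm =>
    ENNReal.mul_lt_top (ENNReal.natCast_lt_top _) (hx.memLp_partialDeriv hm).lpNorm_lt_top

end

end QuantumTorus

end

open QuantumTorus in
theorem mainTheorem4 (d : ℕ) (hd : 2 ≤ d) (k : ℕ) (hk : 1 ≤ k) :
    (∃ c C : ℝ≥0, 0 < c ∧ 0 < C ∧
      ∀ (θ : Matrix (Fin d) (Fin d) ℝ), θ.transpose = -θ →
      ∀ (p : ℝ≥0∞), 1 ≤ p →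
      ∀ (x : QuantumTorus.Distribution θ), QuantumTorus.MemSobolev θ k p x →
        (c : ℝ≥0∞) * QuantumTorus.sobolevSeminorm θ k p x
            ≤ QuantumTorus.lipschitzSeminorm θ k p x ∧
        QuantumTorus.lipschitzSeminorm θ k p x
            ≤ (C : ℝ≥0∞) * QuantumTorus.sobolevSeminorm θ k p x) ∧
    (∀ (θ : Matrix (Fin d) (Fin d) ℝ), θ.transpose = -θ →
      ∀ (x : QuantumTorus.Distribution θ),
        QuantumTorus.MemSobolev θ k ∞ x ↔ QuantumTorus.MemLipschitz θ k x) := by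
  refine ⟨?_, fun θ _ x => ⟨fun h => h.memLipschitz, fun h => h.memSobolev hk⟩⟩
  -- For multi-indices of another order the constant is set to 0, so that a choice can be made for
  -- all m at once.
  have hA : ∀ m : Fin d → ℕ, ∃ A : ℝ≥0, m ∈ indicesOfOrder d k →
      ∀ (θ : Matrix (Fin d) (Fin d) ℝ) (p : ℝ≥0∞), 1 ≤ p → ∀ x : Distribution θ,
        MemSobolev θ k p x →
          lpNorm θ p (partialDeriv θ m x) ≤ A * lipschitzSeminorm θ k p x := by
    intro m
    by_cases hm : m ∈ indicesOfOrder d k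
    · obtain ⟨A, h⟩ := exists_lpNorm_partialDeriv_le hk (mem_indicesOfOrder.mp hm)
      exact ⟨A, fun _ => h⟩
    · exact ⟨0, fun h => absurd h hm⟩
  choose A hA using hA
  let N : ℝ≥0 := ((indicesOfOrder d k).card + 1 : ℕ)
  -- S bounds every polarization constant and N counts the multi-indices; the added ones keep both
  -- positive, so that NS can be inverted.
  let S : ℝ≥0 := ∑ m ∈ indicesOfOrder d k, A m + 1
  have hN : 0 < N := by positivity
  have hS : 0 < S := by positivity
  refine ⟨(N * S)⁻¹, ∑ m ∈ indicesOfOrder d k, (Nat.multinomial Finset.univ m : ℝ≥0) + 1,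
    by positivity, by positivity, fun θ _ p h1 x hx => ⟨?_, ?_⟩⟩
  · have h : sobolevSeminorm θ k p x ≤ (N * S : ℝ≥0) * lipschitzSeminorm θ k p x := by
      refine (sobolevSeminorm_le h1 (B := S * lipschitzSeminorm θ k p x) fun m hm => ?_).trans ?_
      · refine (hA m hm θ p h1 x hx).trans (mul_le_mul_left ?_ _)
        have : A m ≤ S := (Finset.single_le_sum (fun _ _ => zero_le) hm).trans le_self_add
        exact_mod_cast this
      · rw [ENNReal.coe_mul, mul_assoc]
        exact le_of_eq (by simp [N])
    have h0 : ((N * S : ℝ≥0) : ℝ≥0∞) ≠ 0 := by exact_mod_cast (mul_pos hN hS).ne'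
    rw [ENNReal.coe_inv (mul_pos hN hS).ne']
    refine (mul_le_mul_right h _).trans ?_
    rw [← mul_assoc, ENNReal.inv_mul_cancel h0 ENNReal.coe_ne_top, one_mul]
  · refine (lipschitzSeminorm_le h1 hx).trans ?_
    push_cast
    rw [add_mul, Finset.sum_mul]
    refine le_trans (Finset.sum_le_sum fun m hm => ?_) le_self_add
    exact mul_le_mul_right (lpNorm_partialDeriv_le_sobolevSeminorm h1 x hm) _
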